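/- \textbf{Definitions.} A \emph{Word-RAM with $w$-bit words} has registers and a memory whose cells hold $w$-bit words; a deterministic program is a finite list of instructions (arithmetic, bitwise operations and shifts, indirect load and store, comparisons with jumps, halt), each taking one unit of time. A decision problem \emph{requires $n^{e-o(1)}$ time} if for no $\varepsilon>0$ there is a deterministic program that decides it, on a Word-RAM with $O(\log n)$-bit words, in time $O(n^{e-\varepsilon})$ on all instances of size $n$. A $k$-\emph{hyperclique} in a $3$-uniform hypergraph is a set of $k$ vertices any three of which form a hyperedge. The \emph{3-uniform $k$-hyperclique hypothesis} says: for every integer $k\ge 3$, deciding whether a $3$-uniform hypergraph on $n$ vertices, given by its adjacency tensor, contains a $k$-hyperclique requires $n^{k-o(1)}$ time. A \emph{unary $d$-VASS} consists of a non-empty finite set $Q$ of states and a non-empty set $T\subseteq Q\times\{-1,0,1\}^d\times Q$ of transitions; its \emph{size} is $n=|Q|+|T|$. For $B\in\mathbb N$, a \emph{$B$-bounded run} is a sequence of configurations in $Q\times\{0,\dots,B\}^d$ in which each $(q',v')$ arises from its predecessor $(q,v)$ by a transition $(q,v'-v,q')\in T$. For a function $B(n)$, \emph{reachability in unary $(B(n),d)$-VASS}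 asks, given a unary $d$-VASS of size $n$ by the list of its transitions, and two configurations in $Q\times\{0,\dots,B(n)\}^d$, whether there is a $B(n)$-bounded run from the first to the second. \textbf{Theorem.} Assume the 3-uniform $k$-hyperclique hypothesis. Then for every integer $d\ge 0$ and every constant $\gamma>0$, reachability in linearly bounded, i.e. $(\lfloor\gamma n\rfloor, d+2)$-, unary VASS of size $n$ requires $n^{d-o(1)}$ time. (Equivalently, in dimension $d\ge 2$ it requires $n^{d-2-o(1)}$ time.) -/

import Mathlib

open Filter Asymptotics

/-! ### The Word-RAM

A Word-RAM with `w`-bit words has registers and a memory, each of whose cells holds a natural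
number below `2 ^ w`. A program is a finite list of instructions (so it names only finitely many
registers); every instruction costs one unit of time. An instruction whose result does not fit in
`w` bits cannot be executed. -/

namespace WordRAM

/-- The binary operations on words. Subtraction is truncated, `div` and `mod` are those of `ℕ`. -/
inductive Op where
  | add | sub | mul | div | mod | and | or | xor | shl | shr

def Op.eval : Op → ℕ → ℕ → ℕ
  | .add, a, b => a + b
  | .sub, a, b => a - b
  | .mul, a, b => a * b
  | .div, a, b => a / b
  | .mod, a, b => a % b
  | .and, a, b => a &&& b
  | .or, a, b => a ||| b
  | .xor, a, b => a ^^^ b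
  | .shl, a, b => a <<< b
  | .shr, a, b => a >>> b

inductive Instr where
  /-- `reg r := v` -/
  | const (r v : ℕ)
  /-- `reg r := o (reg a) (reg b)` -/
  | op (o : Op) (r a b : ℕ)
  /-- `reg r := mem (reg a)` -/
  | load (r a : ℕ)
  /-- `mem (reg a) := reg r` -/
  | store (a r : ℕ)
  /-- `goto l` -/
  | jump (l : ℕ)
  /-- `if reg a < reg b then goto l` -/
  | jumpLt (a b l : ℕ)
  /-- `if reg a = reg b then goto l` -/
  | jumpEq (a b l : ℕ)
  | halt

abbrev Program := List Instr

structure Config where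
  /-- index of the next instruction -/
  pc : ℕ
  reg : ℕ → ℕ
  mem : ℕ → ℕ

/-- Write the word `v` to register `r` and go to the next instruction, if `v` fits in `w` bits. -/
def Config.setReg (w : ℕ) (s : Config) (r v : ℕ) : Option Config :=
  if v < 2 ^ w then
    some { pc := s.pc + 1, reg := Function.update s.reg r v, mem := s.mem }
  else none

/-- Execute one instruction with `w`-bit words; `none` if the machine has halted, if the program
counter has left the program, or if the result overflows. -/
def step (w : ℕ) (P : Program) (s : Config) : Option Config :=
  match P[s.pc]? with
  | none => none
  | some (.const r v) => s.setReg w r v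
  | some (.op o r a b) => s.setReg w r (o.eval (s.reg a) (s.reg b))
  | some (.load r a) => s.setReg w r (s.mem (s.reg a))
  | some (.store a r) =>
      some { pc := s.pc + 1, reg := s.reg, mem := Function.update s.mem (s.reg a) (s.reg r) }
  | some (.jump l) => some { s with pc := l }
  | some (.jumpLt a b l) => some { s with pc := if s.reg a < s.reg b then l else s.pc + 1 }
  | some (.jumpEq a b l) => some { s with pc := if s.reg a = s.reg b then l else s.pc + 1 }
  | some .halt => none

/-- Execute exactly `t` instructions. -/
def steps (w : ℕ) (P : Program) : ℕ → Config → Option Config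
  | 0, s => some s
  | t + 1, s => (step w P s).bind (steps w P t)

/-- The input is stored in memory cells `0, 1, …`, its length in register `0`;
everything else is `0`. -/
def initial (input : List ℕ) : Config where
  pc := 0
  reg := fun r => if r = 0 then input.length else 0
  mem := fun i => input.getD i 0

/-- With `w`-bit words, and started on `input`, whose words have to fit in `w` bits, the program
executes `t` instructions, arrives at a `halt` instruction, and then register `0` contains
`out`. -/
def Outputs (w : ℕ) (P : Program) (input : List ℕ) (t out : ℕ) : Prop :=
  input.length < 2 ^ w ∧ (∀ a ∈ input, a < 2 ^ w) ∧
    ∃ s, steps w P t (initial input) = some s ∧ P[s.pc]? = some .halt ∧ s.reg 0 = out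

end WordRAM

/-- A decision problem whose instances have a size and an encoding as a list of words. -/
structure DecisionProblem where
  Instance : Type
  size : Instance → ℕ
  encode : Instance → List ℕ
  Yes : Instance → Prop

namespace DecisionProblem

/-- Some deterministic program decides `A` on a Word-RAM with `O(log n)`-bit words, in time at
most `T n` on all instances of size `n`. The answer is `1` for yes and `0` for no. -/
def DecidableInTime (A : DecisionProblem) (T : ℕ → ℕ) : Prop :=
  ∃ (P : WordRAM.Program) (c : ℕ), ∀ x : A.Instance,
    ∃ t ≤ T (A.size x), ∃ out,
      WordRAM.Outputs (c * (Nat.log 2 (A.size x) + 1)) P (A.encode x) t out ∧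
        (A.Yes x ∧ out = 1 ∨ ¬ A.Yes x ∧ out = 0)

/-- `A` requires `n ^ (e - o(1))` time: it is not decidable in time `O(n ^ (e - ε))`
for any `ε > 0`. -/
def RequiresTimePow (A : DecisionProblem) (e : ℝ) : Prop :=
  ∀ ε : ℝ, 0 < ε → ∀ T : ℕ → ℕ,
    (fun n : ℕ => (T n : ℝ)) =O[atTop] (fun n : ℕ => (n : ℝ) ^ (e - ε)) →
      ¬ A.DecidableInTime T

end DecisionProblem

/-! ### Hypergraphs and hypercliques -/

namespace Hypergraph

/-- Every hyperedge has cardinality `μ`. -/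
def IsUniform {V : Type} (H : Hypergraph V) (μ : ℕ) : Prop :=
  ∀ e ∈ H.edgeSet, e.Finite ∧ e.ncard = μ

/-- A `k`-hyperclique of a `μ`-uniform hypergraph: `k` vertices such that any `μ` of them form
a hyperedge. -/
def HasHyperclique {V : Type} (H : Hypergraph V) (μ k : ℕ) : Prop :=
  ∃ S : Finset V, (S : Set V) ⊆ H.vertexSet ∧ S.card = k ∧
    ∀ e : Finset V, e ⊆ S → e.card = μ → (e : Set V) ∈ H.edgeSet

open Classical in
/-- The input word list of a `3`-uniform hypergraph with vertices `0, …, n - 1`: `n`, then the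
`n ^ 3` entries of its adjacency tensor in lexicographic order. -/
noncomputable def encode3 {n : ℕ} (H : Hypergraph (Fin n)) : List ℕ :=
  n :: (List.finRange n).flatMap fun i => (List.finRange n).flatMap fun j =>
    (List.finRange n).map fun l => if ({i, j, l} : Set (Fin n)) ∈ H.edgeSet then 1 else 0

end Hypergraph

/-- A `3`-uniform hypergraph with vertex set `{0, …, n - 1}`. -/
structure Hypergraph3 where
  n : ℕ
  graph : Hypergraph (Fin n)
  vertexSet_eq : graph.vertexSet = Set.univ
  uniform : graph.IsUniform 3

/-- The problem of finding out whether a `3`-uniform hypergraph contains a `k`-hyperclique; the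
size of an instance is its number of vertices. -/
noncomputable def hypercliqueProblem (k : ℕ) : DecisionProblem where
  Instance := Hypergraph3
  size H := H.n
  encode H := H.graph.encode3
  Yes H := H.graph.HasHyperclique 3 k

/-- The `3`-uniform `k`-hyperclique hypothesis. -/
def HypercliqueHypothesis : Prop :=
  ∀ k : ℕ, 3 ≤ k → (hypercliqueProblem k).RequiresTimePow k

/-! ### Vector addition systems with states -/

/-- A `d`-dimensional vector addition system with states `Q`
(which is non-empty because there is a transition). -/
structure VASS (Q : Type) (d : ℕ) where
  trans : Finset (Q × (Fin d → ℤ) × Q)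
  trans_nonempty : trans.Nonempty

namespace VASS

variable {Q : Type} {d : ℕ}

/-- All updates are in `{-1, 0, 1} ^ d`. -/
def IsUnary (V : VASS Q d) : Prop :=
  ∀ t ∈ V.trans, ∀ i, t.2.1 i = -1 ∨ t.2.1 i = 0 ∨ t.2.1 i = 1

/-- The size `|Q| + |T|` of a unary VASS. -/
def unarySize [Fintype Q] (V : VASS Q d) : ℕ := Fintype.card Q + V.trans.card

/-- One step of the `B`-bounded VASS, between configurations in `Q × {0, …, B} ^ d`. -/
def BStep (V : VASS Q d) (B : ℕ) (c c' : Q × (Fin d → ℕ)) : Prop :=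
  (∀ i, c.2 i ≤ B) ∧ (∀ i, c'.2 i ≤ B) ∧
    ∃ x : Fin d → ℤ, (c.1, x, c'.1) ∈ V.trans ∧ ∀ i, (c'.2 i : ℤ) = (c.2 i : ℤ) + x i

/-- There is a run of the `B`-bounded VASS from one configuration to the other. -/
def BReach (V : VASS Q d) (B : ℕ) : Q × (Fin d → ℕ) → Q × (Fin d → ℕ) → Prop :=
  Relation.ReflTransGen (V.BStep B)

end VASS

/-- An instance of reachability in unary `(B(n), d)`-VASS: a unary `d`-VASS with states
`0, …, numStates - 1`, its transitions listed in any order, and an initial and a target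
configuration of the `B(n)`-bounded VASS, where `n` is the size of the VASS. -/
structure BoundedReachInstance (d : ℕ) (B : ℕ → ℕ) where
  numStates : ℕ
  vass : VASS (Fin numStates) d
  unary : vass.IsUnary
  transList : List (Fin numStates × (Fin d → ℤ) × Fin numStates)
  transList_nodup : transList.Nodup
  mem_transList : ∀ t, t ∈ transList ↔ t ∈ vass.trans
  source : Fin numStates × (Fin d → ℕ)
  target : Fin numStates × (Fin d → ℕ)
  source_le : ∀ i, source.2 i ≤ B vass.unarySize
  target_le : ∀ i, target.2 i ≤ B vass.unarySize

namespace BoundedReachInstance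

variable {d : ℕ} {B : ℕ → ℕ}

/-- The input word list: the numbers of states and of transitions, the initial and the target
configuration, and then each transition `(p, x, q)` as `p, x₁ + 1, …, x_d + 1, q`. -/
def encode (I : BoundedReachInstance d B) : List ℕ :=
  [I.numStates, I.transList.length] ++
    (I.source.1.val :: List.ofFn I.source.2) ++ (I.target.1.val :: List.ofFn I.target.2) ++
      I.transList.flatMap fun t =>
        t.1.val :: ((List.ofFn fun i => (t.2.1 i + 1).toNat) ++ [t.2.2.val])

end BoundedReachInstance

/-- Reachability in unary `(B(n), d)`-VASS of size `n`. The function `B` belongs to the problem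
and is not part of the input. -/
def boundedReachability (d : ℕ) (B : ℕ → ℕ) : DecisionProblem where
  Instance := BoundedReachInstance d B
  size I := I.vass.unarySize
  encode I := I.encode
  Yes I := I.vass.BReach (B I.vass.unarySize) I.source I.target

/-! For `d ≥ 2`, a hyperclique of size `d * K` is searched for by a VASS with `d` working counters,
each holding `K` vertices as the base-`N` digits of a number below `N ^ K`. For fixed `d` and `K`
its size is `n = O(N ^ (K + 3))`, so time `n ^ (d - ε)` would amount to at most `N ^ (d * K + 3 * d
- K * ε)`, up to a constant. If `K * ε ≥ 3 * d + 1`, this is at most `N ^ (d * K - 1)`, which the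
hypothesis forbids.

The working counters are loaded with arbitrary numbers. Then, for each of the `R` triples of vertex
positions, the VASS guesses a tensor index `m < N ^ 3` of a hyperedge and compares its three digits
with the counters. The state stores `m` together with a number `g < N ^ K`: counter `j` is read by
moving its units one by one into `g`, comparing digits of `g` with digits of `m`, and moving the
units back. The comparison is meaningful only if the counter was emptied, but a VASS has no zero
tests. Bookkeeping replaces them. An accumulating counter gains one unit for every unit that is
read, so a check adds at most the sum `s` of the working counters, and adds exactly `s` only if
every counter was read completely. At the end the working counters are taken down unit by unit, and
every unit takes `R` units off the accumulator. All counters can reach zero only if the accumulator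
had its maximal value `R * s`, that is, if all readings were complete. The honest run needs counter
values up to `R * d * N ^ K`, and isolated padding states make this at most `γ * n`. The remaining
counter stays zero.

`Shape.soundness` carries the bookkeeping as an invariant, `Shape.completeness` is the honest run,
and `Shape.exists_checks_iff` relates the checks to hypercliques. `WordRAM.exists_generator` shows
that a Word-RAM can write down the VASS in time `O(N ^ (K + 3))`, because every transition is given
by arithmetic expressions in an index and one tensor entry.

For `d ≤ 1` the bound holds unconditionally: a program running in sublinear time misses part of its
input (`not_decidableInTime_of_isLittleO`). -/

namespace WordRAM

/-! ### Composition of Word-RAM programs -/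

theorem steps_add (w : ℕ) (P : Program) (a b : ℕ) (s : Config) :
    steps w P (a + b) s = (steps w P a s).bind (steps w P b) := by
  induction a generalizing s with
  | zero => simp [steps]
  | succ a ih =>
    rw [Nat.succ_add]
    simp only [steps]
    cases step w P s with
    | none => rfl
    | some s' => simpa using ih s'

theorem steps_trans {w : ℕ} {P : Program} {a b : ℕ} {s s' s'' : Config}
    (h : steps w P a s = some s') (h' : steps w P b s' = some s'') :
    steps w P (a + b) s = some s'' := by
  rw [steps_add, h]; exact h'

theorem steps_one {w : ℕ} {P : Program} {s : Config} : steps w P 1 s = step w P s := by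
  simp only [steps]
  cases step w P s <;> rfl

/-- A simulation of single steps along a map `f` of configurations extends to runs. It is applied to
the identity (longer words, appended code) and to a shift of the program counter (code put in
front). -/
theorem steps_of_step {w w' : ℕ} {P P' : Program} {f : Config → Config}
    (h : ∀ s s', step w P s = some s' → step w' P' (f s) = some (f s')) {t : ℕ} {s s' : Config}
    (hs : steps w P t s = some s') : steps w' P' t (f s) = some (f s') := by
  induction t generalizing s with
  | zero => simp only [steps, Option.some.injEq] at hs ⊢; rw [hs]
  | succ t ih =>
    simp only [steps] at hs ⊢
    cases h1 : step w P s with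
    | none => rw [h1] at hs; simp at hs
    | some s1 =>
      rw [h1] at hs
      rw [h _ _ h1]
      exact ih hs

theorem Config.setReg_mono {w w' : ℕ} (hw : w ≤ w') {s s' : Config} {r v : ℕ}
    (h : s.setReg w r v = some s') : s.setReg w' r v = some s' := by
  unfold Config.setReg at h ⊢
  split at h
  · rename_i hv
    rw [if_pos (hv.trans_le (Nat.pow_le_pow_right (by norm_num) hw))]
    exact h
  · simp at h

/-- A step stays possible with longer words and in a longer program. -/
theorem step_mono {w w' : ℕ} (hw : w ≤ w') (P X : Program) (s s' : Config)
    (h : step w P s = some s') : step w' (P ++ X) s = some s' := by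
  unfold step at h ⊢
  cases hi : P[s.pc]? with
  | none => rw [hi] at h; simp at h
  | some ins =>
    rw [hi] at h
    have hlt : s.pc < P.length := by
      by_contra hc
      rw [List.getElem?_eq_none (by omega)] at hi
      simp at hi
    rw [List.getElem?_append_left hlt, hi]
    cases ins <;> first | exact Config.setReg_mono hw h | exact h

theorem steps_mono {w w' : ℕ} (hw : w ≤ w') {P X : Program} {t : ℕ} {s s' : Config}
    (h : steps w P t s = some s') : steps w' (P ++ X) t s = some s' :=
  steps_of_step (f := id) (step_mono hw P X) h

/-- Move the jump targets by `k`. -/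
def Instr.shift (k : ℕ) : Instr → Instr
  | .jump l => .jump (k + l)
  | .jumpLt a b l => .jumpLt a b (k + l)
  | .jumpEq a b l => .jumpEq a b (k + l)
  | i => i

def Config.shift (k : ℕ) (s : Config) : Config := { s with pc := k + s.pc }

theorem getElem?_shift (A P : Program) (i : ℕ) :
    (A ++ P.map (Instr.shift A.length))[A.length + i]? = (P[i]?).map (Instr.shift A.length) := by
  rw [List.getElem?_append_right (by omega), List.getElem?_map]
  simp

theorem Config.setReg_shift {w k : ℕ} {s s' : Config} {r v : ℕ}
    (h : s.setReg w r v = some s') : (s.shift k).setReg w r v = some (s'.shift k) := by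
  unfold Config.setReg at h ⊢
  split at h
  · rename_i hv
    rw [if_pos hv]
    simp only [Option.some.injEq] at h
    subst h
    rfl
  · simp at h

theorem step_shift {w : ℕ} (A P : Program) (s s' : Config) (h : step w P s = some s') :
    step w (A ++ P.map (Instr.shift A.length)) (s.shift A.length) = some (s'.shift A.length) := by
  unfold step at h ⊢
  have hpc : (s.shift A.length).pc = A.length + s.pc := rfl
  rw [hpc, getElem?_shift]
  cases hi : P[s.pc]? with
  | none => rw [hi] at h; simp at h
  | some ins =>
    rw [hi] at h
    cases ins with
    | const | op | load => exact Config.setReg_shift h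
    | store a r =>
      simp only [Option.some.injEq] at h
      subst h; rfl
    | jump l =>
      simp only [Option.some.injEq] at h
      subst h; rfl
    | jumpLt a b l =>
      simp only [Option.some.injEq] at h
      subst h
      simp only [Option.map_some, Instr.shift, Config.shift, Option.some.injEq, Config.mk.injEq,
        and_true]
      split <;> rename_i hc <;> simp [hc, add_assoc]
    | jumpEq a b l =>
      simp only [Option.some.injEq] at h
      subst h
      simp only [Option.map_some, Instr.shift, Config.shift, Option.some.injEq, Config.mk.injEq,
        and_true]
      split <;> rename_i hc <;> simp [hc, add_assoc]
    | halt => simp at h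

theorem steps_shift {w : ℕ} (A P : Program) {t : ℕ} {s s' : Config}
    (h : steps w P t s = some s') :
    steps w (A ++ P.map (Instr.shift A.length)) t (s.shift A.length) =
      some (s'.shift A.length) :=
  steps_of_step (f := Config.shift A.length) (step_shift A P) h

/-- If `A` turns the input into the input of `P`, then `A` followed by `P` computes what `P`
computes. -/
theorem Outputs.comp {w w' : ℕ} {A P : Program} {inp inp' : List ℕ} {t t' out : ℕ}
    (hw : w' ≤ w) (hl : inp.length < 2 ^ w) (hb : ∀ a ∈ inp, a < 2 ^ w)
    (hA : steps w A t (initial inp) = some { initial inp' with pc := A.length })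
    (hP : Outputs w' P inp' t' out) :
    Outputs w (A ++ P.map (Instr.shift A.length)) inp (t + t') out := by
  obtain ⟨-, -, s, hs, hh, ho⟩ := hP
  refine ⟨hl, hb, s.shift A.length, ?_, ?_, ho⟩
  · refine steps_trans (steps_mono le_rfl hA) (steps_shift A P (s := initial inp') ?_)
    simpa using steps_mono (X := []) hw hs
  · have hpc : (s.shift A.length).pc = A.length + s.pc := rfl
    rw [hpc, getElem?_shift, hh]; rfl

/-- The register that an instruction writes to. -/
def Instr.writes : Instr → Option ℕ
  | .const r _ => some r
  | .op _ r _ _ => some r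
  | .load r _ => some r
  | _ => none

theorem Config.setReg_reg_of_ne {w : ℕ} {s s' : Config} {r v q : ℕ}
    (h : s.setReg w r v = some s') (hq : r ≠ q) : s'.reg q = s.reg q := by
  unfold Config.setReg at h
  split at h
  · simp only [Option.some.injEq] at h
    subst h
    simp [Function.update_of_ne hq.symm]
  · simp at h

theorem step_reg_of_not_writes {w : ℕ} {P : Program} {s s' : Config} {q : ℕ}
    (hq : ∀ i ∈ P, i.writes ≠ some q) (h : step w P s = some s') : s'.reg q = s.reg q := by
  unfold step at h
  cases hi : P[s.pc]? with
  | none => rw [hi] at h; simp at h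
  | some ins =>
    rw [hi] at h
    have hw := hq ins (List.mem_of_getElem? hi)
    cases ins with
    | const | op | load =>
      exact Config.setReg_reg_of_ne h (by simpa [Instr.writes] using hw)
    | halt => simp at h
    | store | jump | jumpLt | jumpEq =>
      simp only [Option.some.injEq] at h
      subst h; rfl

theorem steps_reg_of_not_writes {w : ℕ} {P : Program} {t : ℕ} {s s' : Config} {q : ℕ}
    (hq : ∀ i ∈ P, i.writes ≠ some q) (h : steps w P t s = some s') : s'.reg q = s.reg q := by
  induction t generalizing s with
  | zero => simp only [steps, Option.some.injEq] at h; rw [h]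
  | succ t ih =>
    simp only [steps] at h
    cases h1 : step w P s with
    | none => rw [h1] at h; simp at h
    | some s1 =>
      rw [h1] at h
      exact (ih h).trans (step_reg_of_not_writes hq h1)

/-- A program names finitely many registers. Those from `m` on keep their initial value 0, so
clearing finitely many registers after a run is enough to restore the registers of a fresh start. -/
theorem exists_writes_lt (P : Program) : ∃ m, ∀ i ∈ P, ∀ r, i.writes = some r → r < m := by
  induction P with
  | nil => exact ⟨0, by simp⟩
  | cons i P ih =>
    obtain ⟨m, hm⟩ := ih
    refine ⟨max m ((i.writes.getD 0) + 1), ?_⟩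
    intro j hj r hr
    rcases List.mem_cons.1 hj with rfl | hj
    · rw [hr]; simp
    · exact (hm j hj r hr).trans_le (le_max_left _ _)

/-! ### Code fragments -/

/-- The program `P` contains `code` from position `a` on. -/
def CodeAt (P : Program) (a : ℕ) (code : Program) : Prop :=
  ∃ l r, P = l ++ (code ++ r) ∧ l.length = a

theorem CodeAt.left {P c c' : Program} {a : ℕ} (h : CodeAt P a (c ++ c')) : CodeAt P a c := by
  obtain ⟨l, r, rfl, rfl⟩ := h
  exact ⟨l, c' ++ r, by simp, rfl⟩

theorem CodeAt.right {P c c' : Program} {a : ℕ} (h : CodeAt P a (c ++ c')) :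
    CodeAt P (a + c.length) c' := by
  obtain ⟨l, r, rfl, rfl⟩ := h
  exact ⟨l ++ c, r, by simp, by simp⟩

theorem CodeAt.getElem? {P c : Program} {i : Instr} {a : ℕ} (h : CodeAt P a (i :: c)) :
    P[a]? = some i := by
  obtain ⟨l, r, rfl, rfl⟩ := h
  simp

theorem CodeAt.tail {P c : Program} {i : Instr} {a : ℕ} (h : CodeAt P a (i :: c)) :
    CodeAt P (a + 1) c :=
  CodeAt.right (c := [i]) h

/-- Arithmetic operations, which have results of polynomial size. -/
inductive ArithOp where
  | add | sub | mul | div | mod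

def ArithOp.toOp : ArithOp → Op
  | .add => .add
  | .sub => .sub
  | .mul => .mul
  | .div => .div
  | .mod => .mod

/-- The multiplicative form of the bound makes degrees of expressions add up under every operation.
-/
theorem ArithOp.eval_lt (o : ArithOp) (a b : ℕ) : o.toOp.eval a b + 1 ≤ (a + 1) * (b + 1) := by
  have h0 : a + 1 ≤ (a + 1) * (b + 1) := Nat.le_mul_of_pos_right _ (by omega)
  cases o with
  | add => simp only [toOp, Op.eval]; nlinarith [Nat.zero_le (a * b)]
  | sub => simp only [toOp, Op.eval]; omega
  | mul => simp only [toOp, Op.eval]; nlinarith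
  | div => simp only [toOp, Op.eval]; have := Nat.div_le_self a b; omega
  | mod => simp only [toOp, Op.eval]; have := Nat.mod_le a b; omega

/-- Arithmetic expressions in five variables. -/
inductive Expr where
  | var (v : Fin 5)
  | lit (n : ℕ)
  | bin (o : ArithOp) (a b : Expr)

namespace Expr

def eval (ρ : Fin 5 → ℕ) : Expr → ℕ
  | var v => ρ v
  | lit n => n
  | bin o a b => o.toOp.eval (a.eval ρ) (b.eval ρ)

/-- The value of an expression is below `U ^ deg` whenever its variables are below `U ≥ 2`; a
literal `n` has degree `n` because `n < U ^ n`. The degree depends on the code alone, so all values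
fit in words of `O(log U)` bits. -/
def deg : Expr → ℕ
  | var _ => 1
  | lit n => n
  | bin _ a b => a.deg + b.deg

theorem eval_lt {ρ : Fin 5 → ℕ} {U : ℕ} (hU : 2 ≤ U) (hρ : ∀ v, ρ v < U) (e : Expr) :
    e.eval ρ < U ^ e.deg := by
  induction e with
  | var v => simpa [eval, deg] using hρ v
  | lit n => exact Nat.lt_pow_self hU
  | bin o a b iha ihb =>
    have := o.eval_lt (a.eval ρ) (b.eval ρ)
    simp only [eval, deg, pow_add]
    exact this.trans (Nat.mul_le_mul iha ihb)

/-- Code that computes the value of an expression in register `t`, using the registers from `t`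
on. -/
def code : Expr → ℕ → Program
  -- The conjunction of a register with itself serves as a move instruction.
  | var v, t => [.op .and t v.val v.val]
  | lit n, t => [.const t n]
  | bin o a b, t => a.code t ++ (b.code (t + 1) ++ [.op o.toOp t t (t + 1)])

theorem run_code {w U : ℕ} (hU : 2 ≤ U) {ρ : Fin 5 → ℕ} (hρ : ∀ v, ρ v < U) {P : Program}
    (e : Expr) (he : U ^ e.deg ≤ 2 ^ w) {t : ℕ} (ht : 5 ≤ t) {s : Config}
    (hP : CodeAt P s.pc (e.code t)) (hs : ∀ v : Fin 5, s.reg v.val = ρ v) :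
    ∃ s', steps w P (e.code t).length s = some s' ∧ s'.pc = s.pc + (e.code t).length ∧
      s'.reg t = e.eval ρ ∧ (∀ r < t, s'.reg r = s.reg r) ∧ s'.mem = s.mem := by
  induction e generalizing t s with
  | var v =>
    refine ⟨{ pc := s.pc + 1, reg := Function.update s.reg t (ρ v), mem := s.mem }, ?_, ?_, ?_, ?_,
      rfl⟩
    · simp only [code, List.length_singleton]
      rw [steps_one]
      have hv := hρ v
      rw [deg, pow_one] at he
      simp only [step, hP.getElem?, Config.setReg, Op.eval, hs, Nat.and_self]
      rw [if_pos (hv.trans_le he)]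
    · rfl
    · simp [eval]
    · intro r hr
      exact Function.update_of_ne hr.ne _ _
  | lit n =>
    refine ⟨{ pc := s.pc + 1, reg := Function.update s.reg t n, mem := s.mem }, ?_, ?_, ?_, ?_,
      rfl⟩
    · simp only [code, List.length_singleton]
      rw [steps_one]
      have hv : n < U ^ n := Nat.lt_pow_self hU
      simp only [step, hP.getElem?, Config.setReg]
      rw [if_pos (hv.trans_le he)]
    · rfl
    · simp [eval]
    · intro r hr
      exact Function.update_of_ne hr.ne _ _
  | bin o a b iha ihb =>
    have hval : (bin o a b).eval ρ < 2 ^ w := (eval_lt hU hρ _).trans_le he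
    have hle : ∀ x, x ≤ (bin o a b).deg → U ^ x ≤ 2 ^ w := fun x hx =>
      (Nat.pow_le_pow_right (by omega) hx).trans he
    obtain ⟨s1, h1, hpc1, hv1, hr1, hm1⟩ := iha (hle _ (by simp [deg])) ht hP.left hs
    have hP1 := hP.right
    rw [← hpc1] at hP1
    obtain ⟨s2, h2, hpc2, hv2, hr2, hm2⟩ := ihb (hle _ (by simp [deg])) (t := t + 1) (by omega)
      hP1.left (fun v => by rw [hr1 _ (by have := v.isLt; omega), hs])
    have hP2 := hP1.right
    rw [← hpc2] at hP2
    refine ⟨{ pc := s2.pc + 1, reg := Function.update s2.reg t ((bin o a b).eval ρ),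
              mem := s2.mem }, ?_, ?_, ?_, ?_, ?_⟩
    · simp only [code, List.length_append, List.length_singleton]
      refine steps_trans h1 (steps_trans h2 ?_)
      rw [steps_one]
      simp only [step, hP2.getElem?, Config.setReg]
      rw [hv2, hr2 t (by omega), hv1]
      exact if_pos hval
    · simp only [code, List.length_append, List.length_singleton]
      rw [hpc2, hpc1]; omega
    · simp
    · intro r hr
      exact (Function.update_of_ne hr.ne _ _).trans ((hr2 r (by omega)).trans (hr1 r hr))
    · exact hm2.trans hm1

end Expr

/-- The configuration `s` is at position `a`, and has the values `ρ` in the first five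
registers. -/
structure At (s : Config) (a : ℕ) (ρ : Fin 5 → ℕ) (mem : ℕ → ℕ) : Prop where
  pc_eq : s.pc = a
  reg_eq : ∀ v : Fin 5, s.reg v.val = ρ v
  mem_eq : s.mem = mem

/-- From every configuration of the first kind, `t` instructions lead to one of the second. -/
def Leads (w : ℕ) (P : Program) (t : ℕ) (a : ℕ) (ρ : Fin 5 → ℕ) (mem : ℕ → ℕ)
    (a' : ℕ) (ρ' : Fin 5 → ℕ) (mem' : ℕ → ℕ) : Prop :=
  ∀ s, At s a ρ mem → ∃ s', steps w P t s = some s' ∧ At s' a' ρ' mem'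

theorem Leads.refl (w : ℕ) (P : Program) (a : ℕ) (ρ : Fin 5 → ℕ) (mem : ℕ → ℕ) :
    Leads w P 0 a ρ mem a ρ mem := fun s hs => ⟨s, rfl, hs⟩

theorem Leads.trans {w : ℕ} {P : Program} {t t' a a' a'' : ℕ} {ρ ρ' ρ'' : Fin 5 → ℕ}
    {m m' m'' : ℕ → ℕ} (h : Leads w P t a ρ m a' ρ' m') (h' : Leads w P t' a' ρ' m' a'' ρ'' m'') :
    Leads w P (t + t') a ρ m a'' ρ'' m'' := by
  intro s hs
  obtain ⟨s1, h1, hs1⟩ := h s hs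
  obtain ⟨s2, h2, hs2⟩ := h' s1 hs1
  exact ⟨s2, steps_trans h1 h2, hs2⟩

/-- Code for `variable := expression`. -/
def assign (v : Fin 5) (e : Expr) : Program := e.code 5 ++ [.op .and v.val 5 5]

theorem leads_assign {w U : ℕ} (hU : 2 ≤ U) {ρ : Fin 5 → ℕ} (hρ : ∀ v, ρ v < U) {P : Program}
    (v : Fin 5) (e : Expr) (he : U ^ e.deg ≤ 2 ^ w) {a : ℕ} (hP : CodeAt P a (assign v e))
    (mem : ℕ → ℕ) :
    Leads w P (assign v e).length a ρ mem (a + (assign v e).length)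
      (Function.update ρ v (e.eval ρ)) mem := by
  rintro s ⟨rfl, hr, rfl⟩
  obtain ⟨s1, h1, hpc1, hv1, hr1, hm1⟩ := e.run_code hU hρ he le_rfl hP.left hr
  have hP1 := hP.right
  rw [← hpc1] at hP1
  refine ⟨{ pc := s1.pc + 1, reg := Function.update s1.reg v.val (e.eval ρ), mem := s1.mem },
    ?_, ?_, ?_, hm1⟩
  · simp only [assign, List.length_append, List.length_singleton]
    refine steps_trans h1 ?_
    rw [steps_one]
    simp only [step, hP1.getElem?, Config.setReg, Op.eval, hv1, Nat.and_self]
    exact if_pos ((e.eval_lt hU hρ).trans_le he)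
  · simp only [assign, List.length_append, List.length_singleton]
    rw [hpc1]; omega
  · intro u
    by_cases huv : u = v
    · subst huv; simp
    · rw [Function.update_of_ne huv, ← hr, ← hr1 u.val u.isLt]
      exact Function.update_of_ne (fun h => huv (Fin.ext h)) _ _

/-- Code for `variable := memory cell`. -/
def fetch (v : Fin 5) (e : Expr) : Program := e.code 5 ++ [.load v.val 5]

theorem leads_fetch {w U : ℕ} (hU : 2 ≤ U) {ρ : Fin 5 → ℕ} (hρ : ∀ v, ρ v < U) {P : Program}
    (v : Fin 5) (e : Expr) (he : U ^ e.deg ≤ 2 ^ w) {a : ℕ} (hP : CodeAt P a (fetch v e))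
    (mem : ℕ → ℕ) (hm : mem (e.eval ρ) < 2 ^ w) :
    Leads w P (fetch v e).length a ρ mem (a + (fetch v e).length)
      (Function.update ρ v (mem (e.eval ρ))) mem := by
  rintro s ⟨rfl, hr, rfl⟩
  obtain ⟨s1, h1, hpc1, hv1, hr1, hm1⟩ := e.run_code hU hρ he le_rfl hP.left hr
  have hP1 := hP.right
  rw [← hpc1] at hP1
  refine ⟨{ pc := s1.pc + 1, reg := Function.update s1.reg v.val (s.mem (e.eval ρ)),
            mem := s1.mem }, ?_, ?_, ?_, hm1⟩
  · simp only [fetch, List.length_append, List.length_singleton]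
    refine steps_trans h1 ?_
    rw [steps_one]
    simp only [step, hP1.getElem?, Config.setReg, hv1, hm1]
    exact if_pos hm
  · simp only [fetch, List.length_append, List.length_singleton]
    rw [hpc1]; omega
  · intro u
    by_cases huv : u = v
    · subst huv; simp
    · rw [Function.update_of_ne huv, ← hr, ← hr1 u.val u.isLt]
      exact Function.update_of_ne (fun h => huv (Fin.ext h)) _ _

/-- Code for `memory cell := expression`. -/
def put (e e' : Expr) : Program := e.code 5 ++ (e'.code 6 ++ [.store 5 6])

theorem leads_put {w U : ℕ} (hU : 2 ≤ U) {ρ : Fin 5 → ℕ} (hρ : ∀ v, ρ v < U) {P : Program}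
    (e e' : Expr) (he : U ^ e.deg ≤ 2 ^ w) (he' : U ^ e'.deg ≤ 2 ^ w) {a : ℕ}
    (hP : CodeAt P a (put e e')) (mem : ℕ → ℕ) :
    Leads w P (put e e').length a ρ mem (a + (put e e').length) ρ
      (Function.update mem (e.eval ρ) (e'.eval ρ)) := by
  rintro s ⟨rfl, hr, rfl⟩
  obtain ⟨s1, h1, hpc1, hv1, hr1, hm1⟩ := e.run_code hU hρ he le_rfl hP.left hr
  have hP1 := hP.right
  rw [← hpc1] at hP1
  obtain ⟨s2, h2, hpc2, hv2, hr2, hm2⟩ := e'.run_code hU hρ he' (t := 6) (by norm_num) hP1.left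
    (fun v => by rw [hr1 _ v.isLt, hr])
  have hP2 := hP1.right
  rw [← hpc2] at hP2
  refine ⟨{ pc := s2.pc + 1, reg := s2.reg, mem := Function.update s.mem (e.eval ρ) (e'.eval ρ) },
    ?_, ?_, ?_, rfl⟩
  · simp only [put, List.length_append, List.length_singleton]
    refine steps_trans h1 (steps_trans h2 ?_)
    rw [steps_one]
    simp only [step, hP2.getElem?]
    rw [hv2, hr2 5 (by norm_num), hv1, hm2, hm1]
  · simp only [put, List.length_append, List.length_singleton]
    rw [hpc2, hpc1]; omega
  · intro u
    change s2.reg u.val = ρ u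
    rw [hr2 _ (by have := u.isLt; omega), hr1 _ u.isLt, hr]

/-- The memory after writing a list of words from address `a` on. -/
def writeList (mem : ℕ → ℕ) (a : ℕ) (l : List ℕ) : ℕ → ℕ := fun x =>
  if a ≤ x ∧ x < a + l.length then l.getD (x - a) 0 else mem x

theorem writeList_cons (mem : ℕ → ℕ) (a v : ℕ) (l : List ℕ) :
    writeList mem a (v :: l) = writeList (Function.update mem a v) (a + 1) l := by
  funext x
  simp only [writeList, List.length_cons]
  rcases lt_trichotomy x a with h | rfl | h
  · rw [if_neg (by omega), if_neg (by omega), Function.update_of_ne (by omega)]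
  · rw [if_pos (by omega), if_neg (by omega)]; simp
  · by_cases h' : x < a + (l.length + 1)
    · rw [if_pos (by omega), if_pos (by omega)]
      obtain ⟨y, rfl⟩ : ∃ y, x = a + 1 + y := ⟨x - (a + 1), by omega⟩
      rw [show a + 1 + y - a = y + 1 by omega, show a + 1 + y - (a + 1) = y by omega]
      simp
    · rw [if_neg (by omega), if_neg (by omega), Function.update_of_ne (by omega)]

/-- Code that writes the values of a list of expressions to consecutive memory cells. -/
def emit (e : Expr) : ℕ → List Expr → Program
  | _, [] => []
  | k, f :: l => put (.bin .add e (.lit k)) f ++ emit e (k + 1) l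

theorem leads_emit {w U : ℕ} (hU : 2 ≤ U) {ρ : Fin 5 → ℕ} (hρ : ∀ v, ρ v < U) {P : Program}
    (e : Expr) (l : List Expr) (k : ℕ) (he : U ^ (e.deg + k + l.length) ≤ 2 ^ w)
    (hl : ∀ f ∈ l, U ^ f.deg ≤ 2 ^ w) {a : ℕ} (hP : CodeAt P a (emit e k l)) (mem : ℕ → ℕ) :
    Leads w P (emit e k l).length a ρ mem (a + (emit e k l).length) ρ
      (writeList mem (e.eval ρ + k) (l.map (Expr.eval ρ))) := by
  induction l generalizing k a mem with
  | nil =>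
    have : writeList mem (e.eval ρ + k) (List.map (Expr.eval ρ) []) = mem := by
      funext x
      simp only [writeList, List.map_nil, List.length_nil]
      rw [if_neg (by omega)]
    rw [this]
    exact Leads.refl _ _ _ _ _
  | cons f l ih =>
    have h1 := leads_put hU hρ (.bin .add e (.lit k)) f
      ((Nat.pow_le_pow_right (by omega) (by simp [Expr.deg])).trans he)
      (hl f (by simp)) hP.left mem
    have h2 := ih (k + 1) (by rw [List.length_cons] at he; convert he using 2; omega)
      (fun g hg => hl g (by simp [hg])) hP.right
      (Function.update mem ((Expr.bin .add e (.lit k)).eval ρ) (f.eval ρ))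
    have h := h1.trans h2
    rw [List.map_cons, writeList_cons]
    simp only [emit, List.length_append, ← add_assoc] at h ⊢
    exact h

end WordRAM

/-! ### Lists composed of blocks of equal length -/

theorem List.length_flatMap_const {α β : Type*} (l : List β) (f : β → List α) (len : ℕ)
    (h : ∀ i, (f i).length = len) : (l.flatMap f).length = l.length * len := by
  simp [List.length_flatMap, h]

theorem List.getD_flatMap_const {α β : Type*} (l : List β) (f : β → List α) (len : ℕ)
    (h : ∀ i, (f i).length = len) (a : α) {i j : ℕ} (hi : i < l.length) (hj : j < len) :
    (l.flatMap f).getD (i * len + j) a = (f l[i]).getD j a := by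
  induction l generalizing i with
  | nil => simp at hi
  | cons b l ih =>
    rw [List.flatMap_cons]
    cases i with
    | zero => rw [List.getD_append _ _ _ _ (by rw [h]; omega)]; simp
    | succ i =>
      rw [List.getD_append_right _ _ _ _ (by rw [h]; nlinarith), h,
        show (i + 1) * len + j - len = i * len + j by rw [Nat.succ_mul]; omega,
        ih (by simpa using hi)]
      rfl

theorem List.length_flatMap_range {α : Type*} (f : ℕ → List α) (len I : ℕ)
    (h : ∀ i, (f i).length = len) : ((List.range I).flatMap f).length = I * len := by
  rw [List.length_flatMap_const _ _ _ h, List.length_range]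

theorem List.getD_flatMap_range {α : Type*} (f : ℕ → List α) (len : ℕ)
    (h : ∀ i, (f i).length = len) (a : α) {I i j : ℕ} (hi : i < I) (hj : j < len) :
    ((List.range I).flatMap f).getD (i * len + j) a = (f i).getD j a := by
  rw [List.getD_flatMap_const _ _ _ h a (by simpa using hi) hj, List.getElem_range]

/-! ### A program that replaces its input by a generated list -/

namespace WordRAM

/-- Code that clears the registers `1, …, m`. -/
def clear : ℕ → Program
  | 0 => []
  | m + 1 => clear m ++ [.const (m + 1) 0]

theorem length_clear (m : ℕ) : (clear m).length = m := by
  induction m with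
  | zero => rfl
  | succ m ih => simp [clear, ih]

theorem steps_clear (w : ℕ) {P : Program} (m : ℕ) {s : Config} (hP : CodeAt P s.pc (clear m)) :
    steps w P m s =
      some { pc := s.pc + m, reg := fun r => if 1 ≤ r ∧ r ≤ m then 0 else s.reg r,
             mem := s.mem } := by
  induction m with
  | zero =>
    have : (fun r => if 1 ≤ r ∧ r ≤ 0 then 0 else s.reg r) = s.reg := by
      funext r; rw [if_neg (by omega)]
    rw [this]; rfl
  | succ m ih =>
    have h := hP.right
    rw [length_clear] at h
    refine steps_trans (ih hP.left) ?_
    rw [steps_one]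
    simp only [step, h.getElem?, Config.setReg]
    rw [if_pos (by positivity)]
    simp only [Option.some.injEq, Config.mk.injEq, and_true]
    refine ⟨by omega, ?_⟩
    funext r
    by_cases hr : r = m + 1
    · subst hr; simp
    · rw [Function.update_of_ne hr]
      by_cases h' : 1 ≤ r ∧ r ≤ m
      · rw [if_pos h', if_pos (by omega)]
      · rw [if_neg h', if_neg (by omega)]

namespace Expr

def pow (e : Expr) : ℕ → Expr
  | 0 => lit 1
  | n + 1 => bin .mul (pow e n) e

@[simp] theorem eval_pow (ρ : Fin 5 → ℕ) (e : Expr) (n : ℕ) :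
    (e.pow n).eval ρ = e.eval ρ ^ n := by
  induction n with
  | zero => rfl
  | succ n ih => rw [pow_succ, ← ih]; rfl

@[simp] theorem eval_var (ρ : Fin 5 → ℕ) (v : Fin 5) : (var v).eval ρ = ρ v := rfl
@[simp] theorem eval_lit (ρ : Fin 5 → ℕ) (n : ℕ) : (lit n).eval ρ = n := rfl
@[simp] theorem eval_add (ρ : Fin 5 → ℕ) (a b : Expr) :
    (bin .add a b).eval ρ = a.eval ρ + b.eval ρ := rfl
@[simp] theorem eval_sub (ρ : Fin 5 → ℕ) (a b : Expr) :
    (bin .sub a b).eval ρ = a.eval ρ - b.eval ρ := rfl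
@[simp] theorem eval_mul (ρ : Fin 5 → ℕ) (a b : Expr) :
    (bin .mul a b).eval ρ = a.eval ρ * b.eval ρ := rfl
@[simp] theorem eval_div (ρ : Fin 5 → ℕ) (a b : Expr) :
    (bin .div a b).eval ρ = a.eval ρ / b.eval ρ := rfl
@[simp] theorem eval_mod (ρ : Fin 5 → ℕ) (a b : Expr) :
    (bin .mod a b).eval ρ = a.eval ρ % b.eval ρ := rfl

end Expr

/-- The values of the variables of a generator: the zero register, the number `N` of vertices, the
loop variable, the number of iterations, and an entry of the adjacency tensor. -/
def env (N i I τ : ℕ) : Fin 5 → ℕ := ![0, N, i, I, τ]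

section Generator

variable (q : ℕ) (header body : List Expr)

/-- Register 0 initially contains the length of the input and is cleared to be the constant 0 of the
loop test. `N` is kept in register 1, since its cell will be overwritten. The loop variable starts
at `N ^ q` and counts down. -/
def genPrologue : Program :=
  [.const 0 0] ++ (fetch 1 (.lit 0) ++ (assign 3 ((Expr.var 1).pow q) ++ assign 2 (.var 3)))

def genIndex : Expr := .bin .add (.lit 1) (.bin .mod (.var 2) ((Expr.var 1).pow 3))

/-- The output overwrites the input, so the blocks are written from the last to the first: the
tensor entry needed for block `i` lies below all blocks written before. -/
def genInner : Program :=
  assign 2 (.bin .sub (.var 2) (.lit 1)) ++ (fetch 4 genIndex ++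
    emit (.bin .mul (.var 2) (.lit body.length)) header.length body)

def genLoop : Program :=
  [.jumpEq 2 0 ((genPrologue q).length + ((genInner header body).length + 2))] ++
    (genInner header body ++ [.jump (genPrologue q).length])

/-- The header comes last because it covers the beginning of the input. Variable 4 is reset so that
the environment of the header does not depend on the last tensor entry read. Register 0 finally
receives the length of the output. -/
def genEpilogue : Program :=
  assign 4 (.lit 0) ++ (emit (.lit 0) 0 header ++
    assign 0 (.bin .add (.lit header.length) (.bin .mul (.var 3) (.lit body.length))))

/-- A program that writes a header, and then a block of words for each `i < N ^ q`. -/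
def gen : Program := genPrologue q ++ (genLoop q header body ++ genEpilogue header body)

/-- The list of words that the generator writes. -/
def genOutput (N : ℕ) (inp : List ℕ) : List ℕ :=
  header.map (Expr.eval (env N 0 (N ^ q) 0)) ++ (List.range (N ^ q)).flatMap fun i =>
    body.map (Expr.eval (env N i (N ^ q) (inp.getD (1 + i % N ^ 3) 0)))

theorem length_genOutput (N : ℕ) (inp : List ℕ) :
    (genOutput q header body N inp).length = header.length + N ^ q * body.length := by
  rw [genOutput, List.length_append, List.length_flatMap_range _ body.length]
  · simp
  · simp

theorem genOutput_getD (N : ℕ) (inp : List ℕ) {i j : ℕ} (hi : i < N ^ q) (hj : j < body.length) :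
    (genOutput q header body N inp).getD (i * body.length + header.length + j) 0 =
      (body.map (Expr.eval (env N i (N ^ q) (inp.getD (1 + i % N ^ 3) 0)))).getD j 0 := by
  rw [genOutput, List.getD_append_right _ _ _ _ (by rw [List.length_map]; omega), List.length_map,
    show i * body.length + header.length + j - header.length = i * body.length + j by omega,
    List.getD_flatMap_range _ body.length (by simp) 0 hi hj]

/-- The memory after all iterations from `i` on. -/
def genMem (N : ℕ) (inp : List ℕ) (i : ℕ) : ℕ → ℕ := fun x =>
  if x < i * body.length + header.length then inp.getD x 0
  else (genOutput q header body N inp).getD x 0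

theorem writeList_genMem (N : ℕ) (inp : List ℕ) {i : ℕ} (hi : i < N ^ q) :
    writeList (genMem q header body N inp (i + 1)) (i * body.length + header.length)
      (body.map (Expr.eval (env N i (N ^ q) (inp.getD (1 + i % N ^ 3) 0)))) =
      genMem q header body N inp i := by
  funext x
  have hs : (i + 1) * body.length = i * body.length + body.length := by ring
  simp only [writeList, genMem, List.length_map, hs]
  by_cases h1 : x < i * body.length + header.length
  · rw [if_neg (by omega), if_pos (by omega), if_pos h1]
  · rw [if_neg h1]
    by_cases h2 : x < i * body.length + header.length + body.length
    · rw [if_pos (by omega)]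
      obtain ⟨j, rfl⟩ : ∃ j, x = i * body.length + header.length + j :=
        ⟨x - (i * body.length + header.length), by omega⟩
      rw [genOutput_getD q header body N inp hi (by omega), Nat.add_sub_cancel_left]
    · rw [if_neg (by omega), if_neg (by omega)]

theorem writeList_genMem_zero (N : ℕ) (inp : List ℕ) :
    writeList (genMem q header body N inp 0) 0 (header.map (Expr.eval (env N 0 (N ^ q) 0))) =
      fun x => (genOutput q header body N inp).getD x 0 := by
  funext x
  simp only [writeList, genMem, List.length_map, genOutput]
  by_cases h1 : x < header.length
  · rw [if_pos (by omega), List.getD_append _ _ _ _ (by simpa using h1)]; rfl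
  · rw [if_neg (by omega), if_neg (by omega)]

variable {q} {header body} {w N : ℕ}

/-- A bound for the degrees of all the expressions in the generator. -/
structure GenDeg (q : ℕ) (header body : List Expr) (D : ℕ) : Prop where
  le_six : 6 ≤ D
  le_pow : q + 1 ≤ D
  le_header : ∀ e ∈ header, e.deg ≤ D
  le_body : ∀ e ∈ body, e.deg ≤ D
  le_lengths : 1 + header.length + 2 * body.length ≤ D

theorem exists_forall_deg_le (l : List Expr) : ∃ D, ∀ e ∈ l, e.deg ≤ D := by
  induction l with
  | nil => exact ⟨0, by simp⟩
  | cons e l ih =>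
    obtain ⟨D, hD⟩ := ih
    refine ⟨max D e.deg, fun f hf => ?_⟩
    rcases List.mem_cons.1 hf with rfl | hf
    · exact le_max_right _ _
    · exact (hD f hf).trans (le_max_left _ _)

theorem exists_genDeg (q : ℕ) (header body : List Expr) : ∃ D, GenDeg q header body D := by
  obtain ⟨D1, h1⟩ := exists_forall_deg_le header
  obtain ⟨D2, h2⟩ := exists_forall_deg_le body
  refine ⟨6 + (q + 1) + D1 + D2 + (1 + header.length + 2 * body.length), by omega, by omega,
    fun e he => (h1 e he).trans (by omega), fun e he => (h2 e he).trans (by omega), by omega⟩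

/-- The input of the generator. -/
structure GenInput (N : ℕ) (inp : List ℕ) : Prop where
  zero : inp.getD 0 0 = N
  length : inp.length = N ^ 3 + 1
  le_one : ∀ x, 1 ≤ x → inp.getD x 0 ≤ 1

theorem Expr.deg_pow (v : Fin 5) (n : ℕ) : ((Expr.var v).pow n).deg = n + 1 := by
  induction n with
  | zero => rfl
  | succ n ih => simp only [Expr.pow, Expr.deg, ih]

theorem update_env_one (a N i I τ : ℕ) : Function.update (env a i I τ) 1 N = env N i I τ := by
  funext v; fin_cases v <;> simp [env, Function.update]

theorem update_env_two (N a i I τ : ℕ) : Function.update (env N a I τ) 2 i = env N i I τ := by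
  funext v; fin_cases v <;> simp [env, Function.update]

theorem update_env_three (N i a I τ : ℕ) : Function.update (env N i a τ) 3 I = env N i I τ := by
  funext v; fin_cases v <;> simp [env, Function.update]

theorem update_env_four (N i I a τ : ℕ) : Function.update (env N i I a) 4 τ = env N i I τ := by
  funext v; fin_cases v <;> simp [env, Function.update]

theorem env_lt {U N i I τ : ℕ} (h2 : 2 ≤ U) (h : N < U) (hi : i < U) (hI : I < U) (hτ : τ ≤ 1)
    (v : Fin 5) : env N i I τ v < U := by
  fin_cases v <;> simp [env] <;> omega

@[simp] theorem env_apply_one (N i I τ : ℕ) : env N i I τ 1 = N := rfl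
@[simp] theorem env_apply_two (N i I τ : ℕ) : env N i I τ 2 = i := rfl
@[simp] theorem env_apply_three (N i I τ : ℕ) : env N i I τ 3 = I := rfl
@[simp] theorem env_apply_four (N i I τ : ℕ) : env N i I τ 4 = τ := rfl

variable {U D : ℕ} {inp : List ℕ} {P : Program}

/-- The `N ^ 3 + 1` input words end below the end of the output, and beyond the output both lists
have the default value 0, as does the memory. -/
theorem genMem_top (hq : 3 ≤ q) (hh : 2 ≤ header.length) (hb : 1 ≤ body.length)
    (hinp : GenInput N inp) :
    genMem q header body N inp (N ^ q) = fun x => inp.getD x 0 := by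
  funext x
  simp only [genMem]
  split
  · rfl
  · rename_i hx
    have h3 : N ^ 3 ≤ N ^ q := by
      rcases Nat.eq_zero_or_pos N with rfl | hN
      · simp
      · exact Nat.pow_le_pow_right hN hq
    have : N ^ q ≤ N ^ q * body.length := Nat.le_mul_of_pos_right _ hb
    rw [List.getD_eq_default, List.getD_eq_default]
    · rw [hinp.length]; omega
    · rw [length_genOutput]; omega

theorem leads_genPrologue (hU : 2 ≤ U) (hN : N < U) (hI : N ^ q < U) (hw : U ^ D ≤ 2 ^ w)
    (hD : GenDeg q header body D) (hinp : GenInput N inp) (hP : CodeAt P 0 (genPrologue q)) :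
    ∃ s, steps w P (genPrologue q).length (initial inp) = some s ∧
      At s (genPrologue q).length (env N (N ^ q) (N ^ q) 0) (fun x => inp.getD x 0) := by
  have hle : ∀ x, x ≤ D → U ^ x ≤ 2 ^ w := fun x hx =>
    (Nat.pow_le_pow_right (by omega) hx).trans hw
  have h6 := hD.le_six
  have hU0 : 0 < U := by omega
  have h1 : ∃ s, steps w P 1 (initial inp) = some s ∧
      At s 1 (env 0 0 0 0) (fun x => inp.getD x 0) := by
    refine ⟨{ pc := 1, reg := fun _ => 0, mem := fun x => inp.getD x 0 }, ?_, ⟨rfl, ?_, rfl⟩⟩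
    · rw [steps_one]
      have h := hP.getElem?
      simp only [step, initial, h, Config.setReg]
      rw [if_pos (by positivity)]
      simp only [Option.some.injEq, Config.mk.injEq, and_true, zero_add, true_and]
      funext r
      by_cases hr : r = 0
      · subst hr; simp
      · rw [Function.update_of_ne hr, if_neg hr]
    · intro v; fin_cases v <;> rfl
  have hP1 := hP.right
  have h2 := leads_fetch hU (env_lt hU hU0 hU0 hU0 zero_le_one) 1 (.lit 0)
    (hle _ (by simp [Expr.deg]))
    hP1.left (fun x => inp.getD x 0)
    (by rw [Expr.eval_lit, hinp.zero]
        exact hN.trans_le (by simpa using hle 1 (by omega)))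
  rw [Expr.eval_lit, hinp.zero, update_env_one] at h2
  have hP2 := hP1.right
  have h3 := leads_assign hU (env_lt hU hN hU0 hU0 zero_le_one) 3 ((Expr.var 1).pow q)
    (hle _ (by rw [Expr.deg_pow]; exact hD.le_pow)) hP2.left (fun x => inp.getD x 0)
  rw [Expr.eval_pow, Expr.eval_var, env_apply_one, update_env_three] at h3
  have h4 := leads_assign hU (env_lt hU hN hU0 hI zero_le_one) 2 (.var 3)
    (hle _ (by simp [Expr.deg]; omega)) hP2.right (fun x => inp.getD x 0)
  rw [Expr.eval_var, env_apply_three, update_env_two] at h4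
  obtain ⟨s, hs, hat⟩ := h1
  obtain ⟨s', hs', hat'⟩ := ((h2.trans h3).trans h4) s hat
  refine ⟨s', ?_, ?_⟩
  · have := steps_trans hs hs'
    rw [← this]
    simp only [genPrologue, List.length_append, List.length_singleton]
    congr 1
  · convert hat' using 1
    simp only [genPrologue, List.length_append, List.length_singleton]
    omega

theorem leads_genInner (hU : 2 ≤ U) (hN : N < U) (hI : N ^ q < U) (hw : U ^ D ≤ 2 ^ w)
    (hD : GenDeg q header body D) (hh : 2 ≤ header.length) (hb : 1 ≤ body.length)
    (hinp : GenInput N inp) {a : ℕ} (hP : CodeAt P a (genInner header body)) {i τ : ℕ}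
    (hi : i < N ^ q) (hτ : τ ≤ 1) :
    Leads w P (genInner header body).length a (env N (i + 1) (N ^ q) τ)
      (genMem q header body N inp (i + 1)) (a + (genInner header body).length)
      (env N i (N ^ q) (inp.getD (1 + i % N ^ 3) 0)) (genMem q header body N inp i) := by
  have hle : ∀ x, x ≤ D → U ^ x ≤ 2 ^ w := fun x hx =>
    (Nat.pow_le_pow_right (by omega) hx).trans hw
  have h6 := hD.le_six
  have hlen := hD.le_lengths
  have h1 := leads_assign hU (env_lt hU hN (by omega : i + 1 < U) hI hτ) 2
    (.bin .sub (.var 2) (.lit 1)) (hle _ (by simp [Expr.deg]; omega)) hP.left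
    (genMem q header body N inp (i + 1))
  rw [Expr.eval_sub, Expr.eval_var, Expr.eval_lit, env_apply_two, Nat.add_sub_cancel,
    update_env_two] at h1
  have hget : genMem q header body N inp (i + 1) (1 + i % N ^ 3) =
      inp.getD (1 + i % N ^ 3) 0 := by
    simp only [genMem]
    -- The cell is still intact: `1 + i % N ^ 3 ≤ 1 + i`, which is less than `(i + 1) * body.length
    -- + header.length`.
    refine if_pos ?_
    have := Nat.mod_le i (N ^ 3)
    nlinarith
  have hτ' := hinp.le_one (1 + i % N ^ 3) (Nat.le_add_right _ _)
  have hidx : genIndex.eval (env N i (N ^ q) τ) = 1 + i % N ^ 3 := by simp [genIndex]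
  have h2 := leads_fetch hU (env_lt hU hN (hi.trans hI) hI hτ) 4 genIndex
    (hle _ (by simp [Expr.deg, genIndex, Expr.deg_pow]; omega)) hP.right.left
    (genMem q header body N inp (i + 1))
    (by rw [hidx, hget]
        exact (Nat.lt_of_le_of_lt hτ' hU).trans_le (by simpa using hle 1 (by omega)))
  rw [hidx, hget, update_env_four] at h2
  have h3 := leads_emit hU (env_lt hU hN (hi.trans hI) hI hτ')
    (.bin .mul (.var 2) (.lit body.length)) body header.length
    (hle _ (by simp [Expr.deg]; omega)) (fun e he => hle _ (hD.le_body e he)) hP.right.right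
    (genMem q header body N inp (i + 1))
  rw [Expr.eval_mul, Expr.eval_var, env_apply_two, Expr.eval_lit, writeList_genMem _ _ _ _ _ hi]
    at h3
  have h := (h1.trans h2).trans h3
  simp only [genInner, List.length_append, ← add_assoc] at h ⊢
  exact h

theorem leads_genLoop (hU : 2 ≤ U) (hN : N < U) (hI : N ^ q < U) (hw : U ^ D ≤ 2 ^ w)
    (hD : GenDeg q header body D) (hh : 2 ≤ header.length) (hb : 1 ≤ body.length)
    (hinp : GenInput N inp) (hP : CodeAt P (genPrologue q).length (genLoop q header body))
    (i : ℕ) (hi : i ≤ N ^ q) {τ : ℕ} (hτ : τ ≤ 1) :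
    ∃ τ' ≤ 1, Leads w P (i * (genLoop q header body).length + 1)
      (genPrologue q).length (env N i (N ^ q) τ) (genMem q header body N inp i)
      ((genPrologue q).length + (genLoop q header body).length) (env N 0 (N ^ q) τ')
      (genMem q header body N inp 0) := by
  have hlen : (genLoop q header body).length = (genInner header body).length + 2 := by
    simp [genLoop]
  have hP1 : CodeAt P ((genPrologue q).length + 1)
      (genInner header body ++ [.jump (genPrologue q).length]) := hP.tail
  induction i generalizing τ with
  | zero =>
    refine ⟨τ, hτ, ?_⟩
    rintro s ⟨hpc, hr, hm⟩
    refine ⟨{ s with pc := (genPrologue q).length + (genLoop q header body).length }, ?_,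
      ⟨rfl, hr, hm⟩⟩
    rw [zero_mul, zero_add, steps_one]
    have h0 : s.reg 0 = 0 := hr 0
    have h2 : s.reg 2 = 0 := hr 2
    rw [← hpc] at hP
    simp only [step, hP.getElem?, h0, h2, if_true, hlen]
  | succ i ih =>
    obtain ⟨τ', hτ', h⟩ := ih (by omega) (hinp.le_one (1 + i % N ^ 3) (Nat.le_add_right _ _))
    refine ⟨τ', hτ', ?_⟩
    have h1 : Leads w P 1 (genPrologue q).length (env N (i + 1) (N ^ q) τ)
        (genMem q header body N inp (i + 1)) ((genPrologue q).length + 1)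
        (env N (i + 1) (N ^ q) τ) (genMem q header body N inp (i + 1)) := by
      rintro s ⟨hpc, hr, hm⟩
      refine ⟨{ s with pc := s.pc + 1 }, ?_, ⟨by rw [hpc], hr, hm⟩⟩
      rw [steps_one]
      have h0 : s.reg 0 = 0 := hr 0
      have h2 : s.reg 2 = i + 1 := hr 2
      rw [← hpc] at hP
      simp only [step, hP.getElem?, h0, h2]
      rw [if_neg (by omega)]
    have h2 := leads_genInner hU hN hI hw hD hh hb hinp hP1.left (Nat.lt_of_succ_le hi) hτ
    have h3 : Leads w P 1 ((genPrologue q).length + 1 + (genInner header body).length)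
        (env N i (N ^ q) (inp.getD (1 + i % N ^ 3) 0)) (genMem q header body N inp i)
        (genPrologue q).length (env N i (N ^ q) (inp.getD (1 + i % N ^ 3) 0))
        (genMem q header body N inp i) := by
      rintro s ⟨hpc, hr, hm⟩
      refine ⟨{ s with pc := (genPrologue q).length }, ?_, ⟨rfl, hr, hm⟩⟩
      rw [steps_one]
      have hP' := hP1.right
      rw [← hpc] at hP'
      simp only [step, hP'.getElem?]
    have h4 := ((h1.trans h2).trans h3).trans h
    convert h4 using 1
    rw [hlen]; ring

theorem leads_genEpilogue (hU : 2 ≤ U) (hN : N < U) (hI : N ^ q < U) (hw : U ^ D ≤ 2 ^ w)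
    (hD : GenDeg q header body D) {a : ℕ} (hP : CodeAt P a (genEpilogue header body)) {τ : ℕ}
    (hτ : τ ≤ 1) :
    ∃ ρ : Fin 5 → ℕ, ρ 0 = (genOutput q header body N inp).length ∧
      Leads w P (genEpilogue header body).length a (env N 0 (N ^ q) τ)
        (genMem q header body N inp 0) (a + (genEpilogue header body).length) ρ
        (fun x => (genOutput q header body N inp).getD x 0) := by
  have hle : ∀ x, x ≤ D → U ^ x ≤ 2 ^ w := fun x hx =>
    (Nat.pow_le_pow_right (by omega) hx).trans hw
  have h6 := hD.le_six
  have hlen := hD.le_lengths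
  have hU0 : 0 < U := by omega
  have h1 := leads_assign hU (env_lt hU hN hU0 hI hτ) 4 (.lit 0)
    (hle _ (by simp [Expr.deg])) hP.left (genMem q header body N inp 0)
  rw [Expr.eval_lit, update_env_four] at h1
  have h2 := leads_emit hU (env_lt hU hN hU0 hI zero_le_one) (.lit 0) header 0
    (hle _ (by simp [Expr.deg]; omega)) (fun e he => hle _ (hD.le_header e he)) hP.right.left
    (genMem q header body N inp 0)
  rw [Expr.eval_lit, add_zero, writeList_genMem_zero] at h2
  have h3 := leads_assign hU (env_lt hU hN hU0 hI zero_le_one) 0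
    (.bin .add (.lit header.length) (.bin .mul (.var 3) (.lit body.length)))
    (hle _ (by simp [Expr.deg]; omega)) hP.right.right
    (fun x => (genOutput q header body N inp).getD x 0)
  have h := (h1.trans h2).trans h3
  simp only [genEpilogue, List.length_append, ← add_assoc] at h ⊢
  refine ⟨_, ?_, h⟩
  rw [Function.update_self, length_genOutput]
  simp

/-- There is a program that replaces an encoded hypergraph by the output of a generator. -/
theorem exists_generator (hq : 3 ≤ q) (hh : 2 ≤ header.length) (hb : 1 ≤ body.length) :
    ∃ (A : Program) (c k : ℕ), ∀ (N : ℕ) (inp : List ℕ), GenInput N inp →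
      ∀ w, c * (Nat.log 2 N + 1) ≤ w → ∃ t ≤ k * (N ^ q + 1),
        steps w A t (initial inp) =
          some { initial (genOutput q header body N inp) with pc := A.length } := by
  obtain ⟨D, hD⟩ := exists_genDeg q header body
  obtain ⟨m, hm⟩ := exists_writes_lt (gen q header body)
  refine ⟨gen q header body ++ clear (max m 5), q * D,
    (genPrologue q).length + (genLoop q header body).length + 1 +
      (genEpilogue header body).length + max m 5, ?_⟩
  intro N inp hinp w hw
  -- `W` is a power of two above `N`, and `W ^ q` bounds all variables, including `N ^ q`.
  -- Expressions of degree at most `D` then need `q * D * (Nat.log 2 N + 1)` bits, whence the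
  -- constant `q * D`.
  set W := 2 ^ (Nat.log 2 N + 1) with hW
  have hNW : N < W := Nat.lt_pow_succ_log_self (by norm_num) N
  have hW2 : 2 ≤ W := by rw [hW, pow_succ]; have := Nat.one_le_two_pow (n := Nat.log 2 N); omega
  have hWq : W ≤ W ^ q := Nat.le_self_pow (by omega) W
  have hfit : (W ^ q) ^ D ≤ 2 ^ w := by
    rw [← pow_mul, hW, ← pow_mul]
    refine Nat.pow_le_pow_right (by norm_num) ?_
    rw [mul_comm]; exact hw
  have hU : 2 ≤ W ^ q := hW2.trans hWq
  have hNU : N < W ^ q := hNW.trans_le hWq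
  have hIU : N ^ q < W ^ q := Nat.pow_lt_pow_left hNW (by omega)
  have hP : CodeAt (gen q header body) 0 (gen q header body) := ⟨[], [], by simp, rfl⟩
  obtain ⟨s0, hs0, hat0⟩ := leads_genPrologue hU hNU hIU hfit hD hinp hP.left
  have hP1 := hP.right
  rw [zero_add] at hP1
  obtain ⟨τ, hτ, hl⟩ := leads_genLoop hU hNU hIU hfit hD hh hb hinp hP1.left (N ^ q) le_rfl
    zero_le_one
  rw [genMem_top hq hh hb hinp] at hl
  obtain ⟨ρ, hρ, he⟩ := leads_genEpilogue (inp := inp) hU hNU hIU hfit hD hP1.right hτ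
  obtain ⟨s1, hs1, hat1⟩ := (hl.trans he) s0 hat0
  have hs := steps_trans hs0 hs1
  have hpc : s1.pc = (gen q header body).length := by
    rw [hat1.pc_eq]; simp [gen, add_assoc]
  have hclr := steps_clear w (P := gen q header body ++ clear (max m 5)) (max m 5) (s := s1)
    ⟨gen q header body, [], by simp, hpc.symm⟩
  refine ⟨_, ?_, (steps_trans (steps_mono le_rfl hs) hclr).trans ?_⟩
  · set x := N ^ q
    set l := (genLoop q header body).length
    nlinarith [Nat.zero_le (x * (genPrologue q).length),
      Nat.zero_le (x * (genEpilogue header body).length), Nat.zero_le (x * max m 5)]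
  · simp only [Option.some.injEq, Config.mk.injEq]
    refine ⟨by rw [hpc, List.length_append, length_clear], ?_, hat1.mem_eq⟩
    funext r
    simp only [initial]
    rcases Nat.eq_zero_or_pos r with rfl | hr
    · rw [if_neg (by omega), if_pos rfl, ← hρ]
      exact hat1.reg_eq 0
    · rw [if_neg (by omega : r ≠ 0)]
      by_cases hr' : r ≤ max m 5
      · rw [if_pos ⟨hr, hr'⟩]
      · rw [if_neg (by omega), steps_reg_of_not_writes _ hs]
        · simp only [initial]
          rw [if_neg (by omega)]
        · intro i hi h
          have := hm i hi r h
          omega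

end Generator

end WordRAM

/-! ### Vector addition systems with states given by lists -/

/-- A unary VASS with states `0, …, states - 1`, given by the list of its transitions. -/
structure ListVASS (D : ℕ) where
  states : ℕ
  trans : List (ℕ × (Fin D → ℤ) × ℕ)
  ne_nil : trans ≠ []
  nodup : trans.Nodup
  unary : ∀ t ∈ trans, ∀ i, t.2.1 i = -1 ∨ t.2.1 i = 0 ∨ t.2.1 i = 1
  lt : ∀ t ∈ trans, t.1 < states ∧ t.2.2 < states

namespace ListVASS

variable {D : ℕ} (X : ListVASS D)

theorem pos : 0 < X.states := by
  obtain ⟨t, ht⟩ := List.exists_mem_of_ne_nil _ X.ne_nil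
  exact (Nat.zero_le _).trans_lt (X.lt t ht).1

instance : NeZero X.states := ⟨X.pos.ne'⟩

def size : ℕ := X.states + X.trans.length

def Step (B : ℕ) (c c' : ℕ × (Fin D → ℕ)) : Prop :=
  (∀ i, c.2 i ≤ B) ∧ (∀ i, c'.2 i ≤ B) ∧
    ∃ x : Fin D → ℤ, (c.1, x, c'.1) ∈ X.trans ∧ ∀ i, (c'.2 i : ℤ) = (c.2 i : ℤ) + x i

/-- `Fin.ofNat` reduces modulo the number of states, which by `lt` changes no state of a transition.
-/
def finTrans (t : ℕ × (Fin D → ℤ) × ℕ) : Fin X.states × (Fin D → ℤ) × Fin X.states :=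
  (Fin.ofNat X.states t.1, t.2.1, Fin.ofNat X.states t.2.2)

theorem mem_map_finTrans (p q : Fin X.states) (x : Fin D → ℤ) :
    (p, x, q) ∈ X.trans.map X.finTrans ↔ (p.val, x, q.val) ∈ X.trans := by
  rw [List.mem_map]
  constructor
  · rintro ⟨⟨a, y, b⟩, hm, h⟩
    obtain ⟨ha, hb⟩ := X.lt _ hm
    simp only [finTrans, Prod.mk.injEq] at h
    obtain ⟨rfl, rfl, rfl⟩ := h
    simpa [Nat.mod_eq_of_lt ha, Nat.mod_eq_of_lt hb] using hm
  · intro h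
    exact ⟨_, h, by simp [finTrans]⟩

theorem nodup_map_finTrans : (X.trans.map X.finTrans).Nodup := by
  refine List.Nodup.map_on ?_ X.nodup
  rintro ⟨a, x, b⟩ h ⟨a', x', b'⟩ h' he
  obtain ⟨ha, hb⟩ := X.lt _ h
  obtain ⟨ha', hb'⟩ := X.lt _ h'
  simp only [finTrans, Prod.mk.injEq, Fin.ext_iff, Fin.val_ofNat] at he
  simp only [Nat.mod_eq_of_lt ha, Nat.mod_eq_of_lt hb, Nat.mod_eq_of_lt ha',
    Nat.mod_eq_of_lt hb'] at he
  simp only [Prod.mk.injEq]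
  exact he

def toVASS : VASS (Fin X.states) D where
  trans := ⟨X.trans.map X.finTrans, X.nodup_map_finTrans⟩
  trans_nonempty := by
    obtain ⟨t, ht⟩ := List.exists_mem_of_ne_nil _ X.ne_nil
    exact ⟨X.finTrans t, List.mem_map_of_mem ht⟩

theorem mem_toVASS (t) : t ∈ X.toVASS.trans ↔ t ∈ X.trans.map X.finTrans := Iff.rfl

theorem unarySize_toVASS : X.toVASS.unarySize = X.size := by
  simp [VASS.unarySize, toVASS, size, Finset.card]

/-- The question whether state `t` is reachable from state `s`, with all counters zero. -/
def inst (B : ℕ → ℕ) (s t : Fin X.states) : BoundedReachInstance D B where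
  numStates := X.states
  vass := X.toVASS
  unary := by
    rintro ⟨p, x, q⟩ h
    rw [mem_toVASS, mem_map_finTrans] at h
    exact X.unary _ h
  transList := X.trans.map X.finTrans
  transList_nodup := X.nodup_map_finTrans
  mem_transList _ := Iff.rfl
  source := (s, fun _ => 0)
  target := (t, fun _ => 0)
  source_le _ := Nat.zero_le _
  target_le _ := Nat.zero_le _

/-- The words that encode a transition. -/
def transWords (t : ℕ × (Fin D → ℤ) × ℕ) : List ℕ :=
  t.1 :: ((List.ofFn fun i => (t.2.1 i + 1).toNat) ++ [t.2.2])

theorem encode_inst (B : ℕ → ℕ) (s t : Fin X.states) :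
    (X.inst B s t).encode = ([X.states, X.trans.length] ++ (s.val :: List.replicate D 0) ++
      (t.val :: List.replicate D 0)) ++ X.trans.flatMap transWords := by
  have h : (X.trans.map X.finTrans).flatMap (fun t =>
      t.1.val :: ((List.ofFn fun i => (t.2.1 i + 1).toNat) ++ [t.2.2.val])) =
      X.trans.flatMap transWords := by
    rw [List.flatMap_map]
    refine List.flatMap_congr fun u hu => ?_
    obtain ⟨h1, h2⟩ := X.lt u hu
    simp [finTrans, transWords, Nat.mod_eq_of_lt h1, Nat.mod_eq_of_lt h2]
  simp only [BoundedReachInstance.encode, inst, List.length_map, List.ofFn_const]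
  rw [h]

theorem reach_iff (B : ℕ) (s t : Fin X.states) (u v : Fin D → ℕ) :
    X.toVASS.BReach B (s, u) (t, v) ↔
      Relation.ReflTransGen (X.Step B) (s.val, u) (t.val, v) := by
  constructor
  · intro h
    refine Relation.ReflTransGen.lift (r := X.toVASS.BStep B)
      (fun c : Fin X.states × (Fin D → ℕ) => ((c.1.val, c.2) : ℕ × (Fin D → ℕ))) ?_ _ _ h
    rintro c c' ⟨h1, h2, x, hx, h3⟩
    exact ⟨h1, h2, x, (X.mem_map_finTrans _ _ _).1 hx, h3⟩
  · intro h
    have key : ∀ c, Relation.ReflTransGen (X.Step B) (s.val, u) c →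
        ∃ q : Fin X.states, q.val = c.1 ∧ X.toVASS.BReach B (s, u) (q, c.2) := by
      intro c hc
      induction hc with
      | refl => exact ⟨s, rfl, Relation.ReflTransGen.refl⟩
      | @tail c c' _ hstep ih =>
        obtain ⟨q, hq, hr⟩ := ih
        obtain ⟨h1, h2, x, hx, h3⟩ := hstep
        refine ⟨⟨c'.1, (X.lt _ hx).2⟩, rfl, Relation.ReflTransGen.tail hr ⟨h1, h2, x, ?_, h3⟩⟩
        refine (X.mem_map_finTrans _ _ _).2 ?_
        rw [hq]; exact hx
    obtain ⟨q, hq, hr⟩ := key _ h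
    obtain rfl : q = t := Fin.ext hq
    exact hr

end ListVASS

/-! ### Sublinear time does not suffice to read the input -/

namespace WordRAM

/-- A computation of `t` steps depends on at most `t` memory cells. -/
theorem exists_finset_steps_congr {w : ℕ} {P : Program} {t : ℕ} {s s' : Config}
    (h : steps w P t s = some s') :
    ∃ F : Finset ℕ, F.card ≤ t ∧ ∀ mem : ℕ → ℕ, (∀ x ∈ F, mem x = s.mem x) →
      ∃ mem', steps w P t { s with mem := mem } = some { s' with mem := mem' } := by
  induction t generalizing s with
  | zero =>
    simp only [steps, Option.some.injEq] at h
    subst h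
    exact ⟨∅, le_rfl, fun mem _ => ⟨mem, rfl⟩⟩
  | succ t ih =>
    simp only [steps] at h
    cases h1 : step w P s with
    | none => rw [h1] at h; simp at h
    | some s1 =>
      rw [h1] at h
      obtain ⟨F, hF, hF'⟩ := ih h
      -- One step reads at most one cell, the one addressed by `load`; for the other instructions
      -- the witness 0 is a dummy.
      have key : ∃ a : ℕ, ∀ mem : ℕ → ℕ, (∀ x ∈ insert a F, mem x = s.mem x) →
          ∃ mem1, (∀ x ∈ F, mem1 x = s1.mem x) ∧
            step w P { s with mem := mem } = some { s1 with mem := mem1 } := by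
        unfold step at h1
        unfold step
        cases hi : P[s.pc]? with
        | none => rw [hi] at h1; simp at h1
        | some ins =>
          rw [hi] at h1
          cases ins with
          | halt => simp at h1
          | jump | jumpLt | jumpEq =>
            simp only [Option.some.injEq] at h1
            subst h1
            exact ⟨0, fun mem hm => ⟨mem, fun x hx => hm x (Finset.mem_insert_of_mem hx), by
              simp [hi]⟩⟩
          | const | op =>
            simp only [Config.setReg] at h1
            split at h1
            · rename_i hv
              simp only [Option.some.injEq] at h1
              subst h1
              exact ⟨0, fun mem hm => ⟨mem, fun x hx => hm x (Finset.mem_insert_of_mem hx), by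
                simp [hi, Config.setReg, hv]⟩⟩
            · simp at h1
          | load r a =>
            simp only [Config.setReg] at h1
            split at h1
            · rename_i hv
              simp only [Option.some.injEq] at h1
              subst h1
              refine ⟨s.reg a, fun mem hm => ⟨mem,
                fun x hx => hm x (Finset.mem_insert_of_mem hx), ?_⟩⟩
              simp [hi, Config.setReg, hm _ (Finset.mem_insert_self _ _), hv]
            · simp at h1
          | store a r =>
            simp only [Option.some.injEq] at h1
            subst h1
            refine ⟨0, fun mem hm => ⟨Function.update mem (s.reg a) (s.reg r), fun x hx => ?_, by
              simp [hi]⟩⟩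
            by_cases hxa : x = s.reg a
            · subst hxa; simp
            · simpa [Function.update_of_ne hxa] using hm x (Finset.mem_insert_of_mem hx)
      obtain ⟨a, ha⟩ := key
      refine ⟨insert a F, (Finset.card_insert_le _ _).trans (by omega), fun mem hm => ?_⟩
      obtain ⟨mem1, hm1, hs1⟩ := ha mem hm
      obtain ⟨mem', hm'⟩ := hF' mem1 hm1
      exact ⟨mem', by simp only [steps]; rw [hs1]; exact hm'⟩

theorem step_eq_none_of_halt {w : ℕ} {P : Program} {s : Config} (h : P[s.pc]? = some .halt) :
    step w P s = none := by
  simp [step, h]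

theorem steps_halt_unique {w : ℕ} {P : Program} {t t' : ℕ} {s s1 s2 : Config}
    (h1 : steps w P t s = some s1) (h2 : steps w P t' s = some s2)
    (hh1 : P[s1.pc]? = some .halt) (hh2 : P[s2.pc]? = some .halt) : s1 = s2 := by
  wlog hle : t ≤ t' generalizing t t' s1 s2
  · exact (this h2 h1 hh2 hh1 (by omega)).symm
  obtain ⟨e, rfl⟩ := Nat.exists_eq_add_of_le hle
  rw [steps_add, h1] at h2
  cases e with
  | zero => simpa [steps] using h2
  | succ e => simp [steps, step_eq_none_of_halt hh1] at h2

end WordRAM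

/-- A star with `M` transitions from state `0`; transition `a` leads to state `1`, the others lead
to different further states. -/
def starVASS (D M a : ℕ) (hM : 0 < M) : ListVASS D where
  states := M + 2
  trans := (List.range M).map fun i => (0, fun _ => 0, if i = a then 1 else i + 2)
  ne_nil := by simp; omega
  nodup := by
    refine List.Nodup.map ?_ List.nodup_range
    intro i j h
    simp only [Prod.mk.injEq, true_and] at h
    split_ifs at h <;> omega
  unary := by
    intro t ht i
    obtain ⟨j, -, rfl⟩ := List.mem_map.1 ht
    simp
  lt := by
    intro t ht
    obtain ⟨j, hj, rfl⟩ := List.mem_map.1 ht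
    rw [List.mem_range] at hj
    refine ⟨by simp, ?_⟩
    dsimp only
    split_ifs <;> omega

def starInst (D M a : ℕ) (hM : 0 < M) (B : ℕ → ℕ) : BoundedReachInstance D B :=
  (starVASS D M a hM).inst B ⟨0, by simp [starVASS]⟩ ⟨1, by simp [starVASS]⟩

theorem size_starInst (D M a : ℕ) (hM : 0 < M) (B : ℕ → ℕ) :
    (boundedReachability D B).size (starInst D M a hM B) = 2 * M + 2 := by
  refine ((starVASS D M a hM).unarySize_toVASS).trans ?_
  simp [ListVASS.size, starVASS]
  omega

theorem starInst_yes_iff (D M a : ℕ) (hM : 0 < M) (B : ℕ → ℕ) :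
    (boundedReachability D B).Yes (starInst D M a hM B) ↔ a < M := by
  refine (ListVASS.reach_iff _ _ _ _ _ _).trans ?_
  constructor
  · intro h
    have key : ∀ c : ℕ × (Fin D → ℕ),
        Relation.ReflTransGen ((starVASS D M a hM).Step
          (B ((starVASS D M a hM).inst B ⟨0, by simp [starVASS]⟩
            ⟨1, by simp [starVASS]⟩).vass.unarySize)) (0, fun _ => 0) c → c.1 = 1 → a < M := by
      intro c hc
      induction hc with
      | refl => intro h; simp at h
      | tail _ hs _ =>
        intro h1
        obtain ⟨-, -, x, hx, -⟩ := hs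
        obtain ⟨j, hj, he⟩ := List.mem_map.1 hx
        rw [List.mem_range] at hj
        simp only [Prod.mk.injEq] at he
        obtain ⟨-, -, he⟩ := he
        rw [h1] at he
        split_ifs at he <;> omega
    exact key _ h rfl
  · intro ha
    refine Relation.ReflTransGen.single ⟨by simp, by simp, fun _ => 0, ?_, by simp⟩
    exact List.mem_map.2 ⟨a, List.mem_range.2 ha, by simp⟩

def starHeader (D M : ℕ) : List ℕ :=
  [M + 2, M] ++ (0 :: List.replicate D 0) ++ (1 :: List.replicate D 0)

theorem encode_starInst (D M a : ℕ) (hM : 0 < M) (B : ℕ → ℕ) :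
    (boundedReachability D B).encode (starInst D M a hM B) = starHeader D M ++
      (List.range M).flatMap fun i =>
        ListVASS.transWords (0, (fun _ : Fin D => 0), if i = a then 1 else i + 2) := by
  refine (ListVASS.encode_inst _ _ _ _).trans ?_
  simp [starVASS, starHeader, List.flatMap_map]

/-- The parameter `M` is out of range and gives the star in which no transition leads to state 1.
Redirecting transition `a` to state 1 changes only the last word of its block of `D + 2` words. -/
theorem getD_encode_starInst (D M a : ℕ) (hM : 0 < M) (B : ℕ → ℕ) (x : ℕ)
    (hx : x ≠ (starHeader D M).length + (a * (D + 2) + (D + 1))) :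
    ((boundedReachability D B).encode (starInst D M a hM B)).getD x 0 =
      ((boundedReachability D B).encode (starInst D M M hM B)).getD x 0 := by
  rw [encode_starInst, encode_starInst]
  have hlen : ∀ b i, (ListVASS.transWords (0, (fun _ : Fin D => (0 : ℤ)),
      if i = b then 1 else i + 2)).length = D + 2 := by
    intro b i; simp [ListVASS.transWords]
  rcases lt_or_ge x (starHeader D M).length with h | h
  · rw [List.getD_append _ _ _ _ h, List.getD_append _ _ _ _ h]
  · obtain ⟨y, rfl⟩ := Nat.exists_eq_add_of_le h
    rw [List.getD_append_right _ _ _ _ h, List.getD_append_right _ _ _ _ h,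
      Nat.add_sub_cancel_left]
    rcases lt_or_ge y (M * (D + 2)) with hy | hy
    · have hi : y / (D + 2) < M := Nat.div_lt_of_lt_mul (by rwa [mul_comm])
      have hj : y % (D + 2) < D + 2 := Nat.mod_lt _ (by omega)
      have hy' := Nat.div_add_mod' y (D + 2)
      set i := y / (D + 2)
      set j := y % (D + 2)
      rw [← hy', List.getD_flatMap_range _ (D + 2) (hlen a) 0 hi hj,
        List.getD_flatMap_range _ (D + 2) (hlen M) 0 hi hj, if_neg hi.ne]
      by_cases hia : i = a
      · have hjD : j < D + 1 := by
          rcases Nat.lt_succ_iff_lt_or_eq.1 hj with h' | h'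
          · exact h'
          · rw [← hia, ← hy', h'] at hx; exact absurd rfl hx
        simp only [ListVASS.transWords, ← List.cons_append]
        rw [List.getD_append _ _ _ _ (by simpa using hjD),
          List.getD_append _ _ _ _ (by simpa using hjD)]
      · rw [if_neg hia]
    · rw [List.getD_eq_default, List.getD_eq_default]
      · rw [List.length_flatMap_range _ _ _ (hlen M)]; exact hy
      · rw [List.length_flatMap_range _ _ _ (hlen a)]; exact hy

open WordRAM in
-- An adversary argument: on the star without a transition to state 1 the run depends on fewer than
-- `M` cells, so for some `a < M` the target of transition `a` is irrelevant to it. Redirecting this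
-- transition to state 1 changes the answer but not the outcome of the run.
theorem not_decidableInTime_of_isLittleO (D : ℕ) (B : ℕ → ℕ) (T : ℕ → ℕ)
    (hT : (fun n : ℕ => (T n : ℝ)) =o[atTop] fun n : ℕ => (n : ℝ)) :
    ¬ (boundedReachability D B).DecidableInTime T := by
  rintro ⟨P, c, hP⟩
  obtain ⟨n0, hn0⟩ := eventually_atTop.1 (hT.def (c := 1 / 4) (by norm_num))
  -- The star has size `2 * M + 2`, and `T n ≤ n / 4` there gives at most `(M + 1) / 2` steps, less
  -- than `M` because `M ≥ 2`.
  set M := n0 + 2 with hMdef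
  have hM : 0 < M := by omega
  have hTM : T (2 * M + 2) < M := by
    have h := hn0 (2 * M + 2) (by omega)
    simp only [Real.norm_natCast] at h
    have hM2 : (2 : ℝ) ≤ M := by rw [hMdef]; push_cast; linarith [Nat.cast_nonneg (α := ℝ) n0]
    have : (T (2 * M + 2) : ℝ) < M := by
      push_cast at h; linarith
    exact_mod_cast this
  obtain ⟨t, ht, out, ⟨-, -, s, hs, hh, ho⟩, hout⟩ := hP (starInst D M M hM B)
  rw [starInst_yes_iff] at hout
  rw [size_starInst] at ht hs
  obtain ⟨F, hF, hF'⟩ := exists_finset_steps_congr hs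
  let pos : ℕ → ℕ := fun a => (starHeader D M).length + (a * (D + 2) + (D + 1))
  have hinj : Function.Injective pos := by
    intro a b hab
    have : a * (D + 2) = b * (D + 2) := by simp only [pos] at hab; omega
    exact Nat.eq_of_mul_eq_mul_right (by omega) this
  obtain ⟨x, hx, hxF⟩ := Finset.exists_mem_notMem_of_card_lt_card
    (s := F) (t := (Finset.range M).image pos)
    (by rw [Finset.card_image_of_injective _ hinj, Finset.card_range]; omega)
  obtain ⟨a, ha, rfl⟩ := Finset.mem_image.1 hx
  rw [Finset.mem_range] at ha
  obtain ⟨t', -, out', ⟨-, -, s', hs', hh', ho'⟩, hout'⟩ := hP (starInst D M a hM B)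
  rw [starInst_yes_iff] at hout'
  rw [size_starInst] at hs'
  obtain ⟨mem', hm'⟩ := hF'
    (fun x => ((boundedReachability D B).encode (starInst D M a hM B)).getD x 0) (by
      intro x hx
      exact getD_encode_starInst D M a hM B x fun h => hxF (by rw [h] at hx; exact hx))
  have hinit : ({ initial ((boundedReachability D B).encode (starInst D M M hM B)) with
      mem := fun x => ((boundedReachability D B).encode (starInst D M a hM B)).getD x 0 } : Config)
      = initial ((boundedReachability D B).encode (starInst D M a hM B)) := by
    simp only [initial, Config.mk.injEq, and_true, true_and]
    rw [encode_starInst, encode_starInst, List.length_append, List.length_append,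
      List.length_flatMap_range _ (D + 2) M (by intro i; simp [ListVASS.transWords]),
      List.length_flatMap_range _ (D + 2) M (by intro i; simp [ListVASS.transWords])]
  rw [hinit] at hm'
  have := steps_halt_unique hm' hs' hh hh'
  rw [← this] at ho'
  simp only at ho'
  omega

/-! ### The VASS of a hypergraph -/

namespace WordRAM.Expr

/-- Truncated subtraction turns comparisons into arithmetic with values 0 and 1. Case distinctions
thus need no jumps, and every index yields a block of the same length. -/
def lt (a b : Expr) : Expr := bin .sub (lit 1) (bin .sub (bin .add a (lit 1)) b)

def eq (a b : Expr) : Expr := bin .sub (lit 1) (bin .add (bin .sub a b) (bin .sub b a))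

def ite (c a b : Expr) : Expr :=
  bin .add (bin .mul c a) (bin .mul (bin .sub (lit 1) c) b)

@[simp] theorem eval_lt_expr (ρ : Fin 5 → ℕ) (a b : Expr) :
    (lt a b).eval ρ = if a.eval ρ < b.eval ρ then 1 else 0 := by
  simp only [lt, eval_sub, eval_lit, eval_add]
  split <;> omega

@[simp] theorem eval_eq (ρ : Fin 5 → ℕ) (a b : Expr) :
    (eq a b).eval ρ = if a.eval ρ = b.eval ρ then 1 else 0 := by
  simp only [eq, eval_sub, eval_lit, eval_add]
  split <;> omega

theorem eval_ite (ρ : Fin 5 → ℕ) (c a b : Expr) {p : Prop} [Decidable p]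
    (hc : c.eval ρ = if p then 1 else 0) :
    (ite c a b).eval ρ = if p then a.eval ρ else b.eval ρ := by
  simp only [ite, eval_add, eval_mul, eval_sub, eval_lit, hc]
  split <;> simp

end WordRAM.Expr

open WordRAM WordRAM.Expr

/-- A transition whose states are given by expressions. -/
structure TransExpr (D : ℕ) where
  src : Expr
  vec : Fin D → ℤ
  dst : Expr

namespace TransExpr

variable {D : ℕ}

def eval (ρ : Fin 5 → ℕ) (t : TransExpr D) : ℕ × (Fin D → ℤ) × ℕ :=
  (t.src.eval ρ, t.vec, t.dst.eval ρ)

def words (t : TransExpr D) : List Expr :=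
  t.src :: ((List.ofFn fun i => lit (t.vec i + 1).toNat) ++ [t.dst])

theorem map_words (ρ : Fin 5 → ℕ) (t : TransExpr D) :
    t.words.map (Expr.eval ρ) = ListVASS.transWords (t.eval ρ) := by
  simp [words, ListVASS.transWords, eval, List.map_ofFn, Function.comp_def]

end TransExpr

/-- The parameters of the reduction: there are `d` counters for `K` vertices each, and `R` triples
of vertices to check. A vertex is given by its counter and its position there. -/
structure Shape where
  d : ℕ
  K : ℕ
  R : ℕ
  tri : ℕ → Fin 3 → ℕ × ℕ
  pad : ℕ
  d_pos : 0 < d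
  R_pos : 0 < R
  tri_lt : ∀ r < R, ∀ σ, (tri r σ).1 < d ∧ (tri r σ).2 < K

namespace Shape

variable (S : Shape)

/-- The number of phases of a check. -/
def len : ℕ := 2 * S.d + 1

/-- The number of phases. -/
def phases : ℕ := S.R * S.len + 1

/-- The vector with the entries `x` for the first `d` counters and `y` for the next one. -/
def vec (x : ℕ → ℤ) (y : ℤ) : Fin (S.d + 2) → ℤ := fun i =>
  if i.val < S.d then x i.val else if i.val = S.d then y else 0

/-- The `j`-th unit vector. -/
def unit (j : ℕ) : ℕ → ℤ := fun k => if k = j then 1 else 0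

/-- State `i < N ^ (K + 3)` of phase `ρ` has the number `ρ * I + i`. From `phases * I` on there
follow two dead ends (if `I > 0`), the `R` states of the final chain, and the padding. -/
def stateE (ρ : ℕ) (e : Expr) : Expr := bin .add (bin .mul (lit ρ) (var 3)) e

def cubeE : Expr := (var 1).pow 3

/-- An index is `m + N ^ 3 * g`, with the guessed tensor index `m < N ^ 3` and the number `g` of
units under way. Phase 0 of a check cycles through the indices in order to guess; phase `2 * j + 1`
moves units of counter `j` into `g` and counts them in the accumulator; phase `2 * j + 2` moves
units back from `g` to counter `j`. -/
def walkVec (ρ : ℕ) : Fin (S.d + 2) → ℤ :=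
  if ρ % S.len = 0 then S.vec 0 0
  else if ρ % S.len % 2 = 1 then S.vec (-unit ((ρ % S.len - 1) / 2)) 1
  else S.vec (unit ((ρ % S.len - 1) / 2)) 0

/-- A walk that would leave the range of indices leads to a dead end, so that each state has exactly
one walk transition, as the generator requires. -/
def walkDst (ρ : ℕ) : Expr :=
  if ρ % S.len = 0 then stateE ρ (bin .mod (bin .add (var 2) (lit 1)) (var 3))
  else if ρ % S.len % 2 = 1 then
    ite (lt (bin .add (var 2) cubeE) (var 3)) (stateE ρ (bin .add (var 2) cubeE))
      (stateE S.phases (lit 0))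
  else ite (lt (var 2) cubeE) (stateE S.phases (lit 0)) (stateE ρ (bin .sub (var 2) cubeE))

/-- The digits of the index from position 3 on are those of `g`, the amount read from counter `j`;
the digit of `m` in question is at position `σ`. Vertices stored in other counters impose no
condition here. -/
def digitCond (r j : ℕ) (σ : Fin 3) : Expr :=
  if (S.tri r σ).1 = j then
    eq (bin .mod (bin .div (var 2) ((var 1).pow (3 + (S.tri r σ).2))) (var 1))
      (bin .mod (bin .div (var 2) ((var 1).pow σ.val)) (var 1))
  else lit 1

/-- Entering a check requires a hyperedge, leaving a reading phase requires matching digits, and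
leaving a restoring phase requires `g = 0`. The phase after the last check is never left by a
switch. -/
def switchCond (ρ : ℕ) : Expr :=
  if ρ % S.len = 0 then
    if ρ / S.len < S.R then bin .mul (lt (var 2) cubeE) (eq (var 4) (lit 1)) else lit 0
  else if ρ % S.len % 2 = 1 then
    bin .mul (S.digitCond (ρ / S.len) ((ρ % S.len - 1) / 2) 0)
      (bin .mul (S.digitCond (ρ / S.len) ((ρ % S.len - 1) / 2) 1)
        (S.digitCond (ρ / S.len) ((ρ % S.len - 1) / 2) 2))
  else lt (var 2) cubeE

def walk (ρ : ℕ) : TransExpr (S.d + 2) where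
  src := stateE ρ (var 2)
  vec := S.walkVec ρ
  dst := S.walkDst ρ

def switch (ρ : ℕ) : TransExpr (S.d + 2) where
  src := stateE ρ (var 2)
  vec := S.vec 0 0
  dst := ite (S.switchCond ρ) (stateE (ρ + 1) (var 2)) (stateE S.phases (lit 1))

/-- The transitions that increase the counters at the start. -/
def load (j : ℕ) : TransExpr (S.d + 2) where
  src := lit 0
  vec := S.vec (unit j) 0
  dst := lit 0

/-- The transitions that decrease a counter at the end. -/
def enter (j : ℕ) : TransExpr (S.d + 2) where
  src := stateE (S.R * S.len) (lit 0)
  vec := S.vec (-unit j) (-1)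
  dst := stateE S.phases (lit 2)

/-- The transitions that decrease the sum at the end. -/
def unload (t : ℕ) : TransExpr (S.d + 2) where
  src := stateE S.phases (lit (2 + t))
  -- `enter` has already taken one unit off the sum, so `R - 1` units remain; the last of the `R`
  -- chain states only leads back.
  vec := if t + 1 < S.R then S.vec 0 (-1) else S.vec 0 0
  dst := if t + 1 < S.R then stateE S.phases (lit (2 + t + 1)) else stateE (S.R * S.len) (lit 0)

def consts : List (TransExpr (S.d + 2)) :=
  (List.range S.d).map S.load ++ ((List.range S.d).map S.enter ++ (List.range S.R).map S.unload)

def body : List (TransExpr (S.d + 2)) :=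
  (List.range S.phases).flatMap fun ρ => [S.walk ρ, S.switch ρ]

def I (N : ℕ) : ℕ := N ^ (S.K + 3)

def trans (N : ℕ) (T : ℕ → ℕ) : List (ℕ × (Fin (S.d + 2) → ℤ) × ℕ) :=
  S.consts.map (TransExpr.eval (env N 0 (S.I N) 0)) ++ (List.range (S.I N)).flatMap fun i =>
    S.body.map (TransExpr.eval (env N i (S.I N) (T (i % N ^ 3))))

def walkTarget (N ρ i : ℕ) : ℕ :=
  if ρ % S.len = 0 then ρ * S.I N + (i + 1) % S.I N
  else if ρ % S.len % 2 = 1 then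
    if i + N ^ 3 < S.I N then ρ * S.I N + (i + N ^ 3) else S.phases * S.I N
  else if i < N ^ 3 then S.phases * S.I N else ρ * S.I N + (i - N ^ 3)

/-- The condition for going to the next phase. -/
def SwitchOK (N : ℕ) (T : ℕ → ℕ) (ρ i : ℕ) : Prop :=
  if ρ % S.len = 0 then ρ / S.len < S.R ∧ i < N ^ 3 ∧ T (i % N ^ 3) = 1
  else if ρ % S.len % 2 = 1 then
    ∀ σ : Fin 3, (S.tri (ρ / S.len) σ).1 = (ρ % S.len - 1) / 2 →
      i / N ^ (3 + (S.tri (ρ / S.len) σ).2) % N = i / N ^ σ.val % N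
  else i < N ^ 3

open Classical in
noncomputable def switchTarget (N : ℕ) (T : ℕ → ℕ) (ρ i : ℕ) : ℕ :=
  if S.SwitchOK N T ρ i then (ρ + 1) * S.I N + i else S.phases * S.I N + 1

theorem eval_stateE (N i I τ ρ : ℕ) (e : Expr) :
    (stateE ρ e).eval (env N i I τ) = ρ * I + e.eval (env N i I τ) := rfl

theorem eval_walk (N i τ ρ : ℕ) : (S.walk ρ).eval (env N i (S.I N) τ) =
    (ρ * S.I N + i, S.walkVec ρ, S.walkTarget N ρ i) := by
  simp only [TransExpr.eval, walk, Prod.mk.injEq, true_and, eval_stateE, eval_var, env_apply_two]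
  unfold walkDst walkTarget
  by_cases h1 : ρ % S.len = 0
  · rw [if_pos h1, if_pos h1]; rfl
  · rw [if_neg h1, if_neg h1]
    by_cases h2 : ρ % S.len % 2 = 1
    · rw [if_pos h2, if_pos h2, eval_ite _ _ _ _ (p := i + N ^ 3 < S.I N) (by simp [cubeE])]
      simp [eval_stateE, cubeE]
    · rw [if_neg h2, if_neg h2, eval_ite _ _ _ _ (p := i < N ^ 3) (by simp [cubeE])]
      simp [eval_stateE, cubeE]

theorem eval_digitCond (N i I τ r j : ℕ) (σ : Fin 3) :
    (S.digitCond r j σ).eval (env N i I τ) =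
      if (S.tri r σ).1 = j → i / N ^ (3 + (S.tri r σ).2) % N = i / N ^ σ.val % N
      then 1 else 0 := by
  unfold digitCond
  by_cases h : (S.tri r σ).1 = j <;> simp [h]

open Classical in
theorem eval_switchCond (N i I ρ : ℕ) (T : ℕ → ℕ) :
    (S.switchCond ρ).eval (env N i I (T (i % N ^ 3))) = if S.SwitchOK N T ρ i then 1 else 0 := by
  unfold switchCond SwitchOK
  by_cases h1 : ρ % S.len = 0
  · rw [if_pos h1, if_pos h1]
    by_cases h2 : ρ / S.len < S.R
    · simp only [h2, if_true, true_and, eval_mul, eval_lt_expr, eval_eq, eval_var, eval_lit,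
        env_apply_two, env_apply_four, cubeE, eval_pow, env_apply_one]
      by_cases h3 : i < N ^ 3 <;> by_cases h4 : T (i % N ^ 3) = 1 <;> simp [h3, h4]
    · simp [h2]
  · rw [if_neg h1, if_neg h1]
    by_cases h2 : ρ % S.len % 2 = 1
    · rw [if_pos h2, if_pos h2]
      simp only [eval_mul, eval_digitCond, Fin.forall_fin_succ]
      simp only [Fin.succ_zero_eq_one, Fin.succ_one_eq_two]
      split_ifs <;> simp_all
    · rw [if_neg h2, if_neg h2]
      simp [cubeE]

theorem eval_switch (N i ρ : ℕ) (T : ℕ → ℕ) :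
    (S.switch ρ).eval (env N i (S.I N) (T (i % N ^ 3))) =
      (ρ * S.I N + i, S.vec 0 0, S.switchTarget N T ρ i) := by
  classical
  simp only [TransExpr.eval, switch, Prod.mk.injEq, true_and, eval_stateE, eval_var,
    env_apply_two]
  rw [eval_ite _ _ _ _ (S.eval_switchCond N i (S.I N) ρ T)]
  rfl

/-- The transitions that do not depend on the hypergraph. -/
theorem mem_consts_iff (N : ℕ) (t : ℕ × (Fin (S.d + 2) → ℤ) × ℕ) :
    t ∈ S.consts.map (TransExpr.eval (env N 0 (S.I N) 0)) ↔
      (∃ j < S.d, t = (0, S.vec (unit j) 0, 0)) ∨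
      (∃ j < S.d, t = (S.R * S.len * S.I N, S.vec (-unit j) (-1), S.phases * S.I N + 2)) ∨
      (∃ k < S.R, t = (S.phases * S.I N + (2 + k),
        if k + 1 < S.R then S.vec 0 (-1) else S.vec 0 0,
        if k + 1 < S.R then S.phases * S.I N + (2 + k + 1) else S.R * S.len * S.I N)) := by
  have hu : ∀ k, (S.unload k).eval (env N 0 (S.I N) 0) = (S.phases * S.I N + (2 + k),
        if k + 1 < S.R then S.vec 0 (-1) else S.vec 0 0,
        if k + 1 < S.R then S.phases * S.I N + (2 + k + 1) else S.R * S.len * S.I N) := by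
    intro k
    simp only [TransExpr.eval, unload, eval_stateE, eval_lit, Prod.mk.injEq, true_and]
    split_ifs <;> rfl
  have hl : ∀ j, (S.load j).eval (env N 0 (S.I N) 0) = (0, S.vec (unit j) 0, 0) := fun _ => rfl
  have he : ∀ j, (S.enter j).eval (env N 0 (S.I N) 0) =
      (S.R * S.len * S.I N, S.vec (-unit j) (-1), S.phases * S.I N + 2) := fun _ => rfl
  simp only [consts, List.map_append, List.map_map, List.mem_append, List.mem_map, List.mem_range,
    Function.comp_apply, hu, hl, he, eq_comm (a := t)]

theorem mem_body_iff (N : ℕ) (T : ℕ → ℕ) (i : ℕ) (t : ℕ × (Fin (S.d + 2) → ℤ) × ℕ) :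
    t ∈ S.body.map (TransExpr.eval (env N i (S.I N) (T (i % N ^ 3)))) ↔
      ∃ ρ < S.phases, t = (ρ * S.I N + i, S.walkVec ρ, S.walkTarget N ρ i) ∨
        t = (ρ * S.I N + i, S.vec 0 0, S.switchTarget N T ρ i) := by
  simp only [body, List.map_flatMap, List.mem_flatMap, List.mem_range, List.map_cons, List.map_nil,
    List.mem_cons, List.not_mem_nil, or_false, eval_walk, eval_switch]

theorem mem_trans_iff (N : ℕ) (T : ℕ → ℕ) (t : ℕ × (Fin (S.d + 2) → ℤ) × ℕ) :
    t ∈ S.trans N T ↔ t ∈ S.consts.map (TransExpr.eval (env N 0 (S.I N) 0)) ∨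
      ∃ i < S.I N, t ∈ S.body.map (TransExpr.eval (env N i (S.I N) (T (i % N ^ 3)))) := by
  simp [trans]

/-! ### Well-formedness of the list of transitions -/

theorem decode {I ρ ρ' i i' : ℕ} (hi : i < I) (hi' : i' < I) (h : ρ * I + i = ρ' * I + i') :
    ρ = ρ' ∧ i = i' := by
  have h1 : (ρ * I + i) / I = ρ := by
    rw [mul_comm, Nat.mul_add_div (by omega), Nat.div_eq_of_lt hi, add_zero]
  have h2 : (ρ' * I + i') / I = ρ' := by
    rw [mul_comm, Nat.mul_add_div (by omega), Nat.div_eq_of_lt hi', add_zero]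
  have : ρ = ρ' := by rw [← h1, ← h2, h]
  subst this
  exact ⟨rfl, by omega⟩

theorem state_lt {I ρ P i : ℕ} (hρ : ρ < P) (hi : i < I) : ρ * I + i < P * I := by
  nlinarith

theorem vec_apply_lt {j : ℕ} (hj : j < S.d) (x : ℕ → ℤ) (y : ℤ) :
    S.vec x y ⟨j, by omega⟩ = x j := by
  simp [vec, hj]

theorem vec_ne {j : ℕ} (hj : j < S.d) {x x' : ℕ → ℤ} (y y' : ℤ) (h : x j ≠ x' j) :
    S.vec x y ≠ S.vec x' y' := by
  intro he
  have := congrFun he ⟨j, by omega⟩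
  rw [vec_apply_lt S hj, vec_apply_lt S hj] at this
  exact h this

theorem phase_lt (ρ : ℕ) : ρ % S.len < 2 * S.d + 1 := Nat.mod_lt _ (by unfold len; omega)

theorem walkTarget_lt_of_eq_zero {N ρ i : ℕ} (hi : i < S.I N) (h : ρ % S.len = 0) :
    S.walkTarget N ρ i < (ρ + 1) * S.I N := by
  unfold walkTarget
  rw [if_pos h]
  exact state_lt (Nat.lt_succ_self ρ) (Nat.mod_lt _ (by omega))

theorem le_switchTarget {N ρ i : ℕ} (T : ℕ → ℕ) (hρ : ρ < S.phases) :
    (ρ + 1) * S.I N ≤ S.switchTarget N T ρ i := by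
  unfold switchTarget
  split_ifs
  · omega
  · have : (ρ + 1) * S.I N ≤ S.phases * S.I N := Nat.mul_le_mul_right _ hρ
    omega

/-- Transitions with a common source differ in their vectors, except for walk and switch in phase 0
of a check, where both vectors vanish: there the walk stays in its block of states and the switch
leaves it. -/
theorem nodup_trans (N : ℕ) (T : ℕ → ℕ) : (S.trans N T).Nodup := by
  have hbody : ∀ i ∈ List.range (S.I N),
      (S.body.map (TransExpr.eval (env N i (S.I N) (T (i % N ^ 3))))).Nodup := by
    intro i hi
    rw [List.mem_range] at hi
    simp only [body, List.map_flatMap, List.map_cons, List.map_nil, eval_walk, eval_switch]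
    rw [List.nodup_flatMap]
    refine ⟨fun ρ hρ => ?_, ?_⟩
    · rw [List.mem_range] at hρ
      simp only [List.nodup_cons, List.mem_singleton, List.not_mem_nil, not_false_eq_true,
        List.nodup_nil, and_true, Prod.mk.injEq, true_and, not_and]
      intro hv ht
      by_cases h0 : ρ % S.len = 0
      · have h1 := S.walkTarget_lt_of_eq_zero hi h0
        have h2 := S.le_switchTarget (N := N) (i := i) T hρ
        omega
      · have hlt := S.phase_lt ρ
        have hj : (ρ % S.len - 1) / 2 < S.d := by omega
        unfold walkVec at hv
        rw [if_neg h0] at hv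
        split_ifs at hv
        · exact S.vec_ne hj _ _ (by simp [unit]) hv
        · exact S.vec_ne hj _ _ (by simp [unit]) hv
    · refine List.nodup_range.imp ?_
      intro ρ ρ' hne
      refine List.disjoint_left.2 ?_
      intro t h1 h2
      simp only [List.mem_cons, List.not_mem_nil, or_false] at h1 h2
      have e1 : t.1 = ρ * S.I N + i := by rcases h1 with rfl | rfl <;> rfl
      have e2 : t.1 = ρ' * S.I N + i := by rcases h2 with rfl | rfl <;> rfl
      exact hne (decode hi hi (e1.symm.trans e2)).1
  refine List.Nodup.append ?_ ?_ ?_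
  · have hph : S.R * S.len < S.phases := Nat.lt_succ_self _
    have hle : S.R * S.len * S.I N ≤ S.phases * S.I N := Nat.mul_le_mul_right _ hph.le
    simp only [consts, List.map_append, List.map_map]
    refine List.Nodup.append ?_ (List.Nodup.append ?_ ?_ ?_) ?_
    · refine List.Nodup.map_on ?_ List.nodup_range
      intro j hj j' hj' h
      rw [List.mem_range] at hj
      by_contra hne
      have h2 := congrArg (fun t => t.2.1) h
      exact S.vec_ne hj (x := unit j) (x' := unit j') 0 0 (by simp [unit, hne]) h2
    · refine List.Nodup.map_on ?_ List.nodup_range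
      intro j hj j' hj' h
      rw [List.mem_range] at hj
      by_contra hne
      have h2 := congrArg (fun t => t.2.1) h
      exact S.vec_ne hj (x := -unit j) (x' := -unit j') (-1) (-1) (by simp [unit, hne]) h2
    · refine List.Nodup.map ?_ List.nodup_range
      intro k k' h
      have h2 : S.phases * S.I N + (2 + k) = S.phases * S.I N + (2 + k') :=
        congrArg (fun t => t.1) h
      omega
    · refine List.disjoint_left.2 ?_
      intro t h1 h2
      obtain ⟨j, hj, rfl⟩ := List.mem_map.1 h1
      obtain ⟨k, hk, h⟩ := List.mem_map.1 h2
      have h3 : S.phases * S.I N + (2 + k) = S.R * S.len * S.I N + 0 := congrArg (fun t => t.1) h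
      omega
    · refine List.disjoint_left.2 ?_
      intro t h1 h2
      obtain ⟨j, hj, rfl⟩ := List.mem_map.1 h1
      rw [List.mem_range] at hj
      rcases List.mem_append.1 h2 with h2 | h2
      · obtain ⟨j', hj', h⟩ := List.mem_map.1 h2
        have h3 : S.vec (-unit j') (-1) = S.vec (unit j) 0 := congrArg (fun t => t.2.1) h
        refine S.vec_ne hj _ _ ?_ h3
        simp only [unit, Pi.neg_apply]
        split_ifs <;> simp
      · obtain ⟨k, hk, h⟩ := List.mem_map.1 h2
        have h3 : S.phases * S.I N + (2 + k) = 0 := congrArg (fun t => t.1) h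
        omega
  · rw [List.nodup_flatMap]
    refine ⟨hbody, ?_⟩
    rw [List.pairwise_iff_getElem]
    intro a b ha hb hab
    simp only [List.length_range] at ha hb
    simp only [List.getElem_range]
    refine List.disjoint_left.2 ?_
    intro t h1 h2
    obtain ⟨ρ, hρ, h1⟩ := (S.mem_body_iff N T a t).1 h1
    obtain ⟨ρ', hρ', h2⟩ := (S.mem_body_iff N T b t).1 h2
    have e1 : t.1 = ρ * S.I N + a := by rcases h1 with rfl | rfl <;> rfl
    have e2 : t.1 = ρ' * S.I N + b := by rcases h2 with rfl | rfl <;> rfl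
    have := (decode ha hb (e1.symm.trans e2)).2
    omega
  · refine List.disjoint_left.2 ?_
    intro t h1 h2
    obtain ⟨i, hi, h2⟩ := List.mem_flatMap.1 h2
    rw [List.mem_range] at hi
    obtain ⟨ρ, hρ, h2⟩ := (S.mem_body_iff N T i t).1 h2
    have e2 : t.1 = ρ * S.I N + i := by rcases h2 with rfl | rfl <;> rfl
    have hvec : ρ % S.len = 0 → t.2.1 = S.vec 0 0 := by
      intro h0
      rcases h2 with rfl | rfl
      · simp [walkVec, h0]
      · rfl
    rcases (S.mem_consts_iff N t).1 h1 with ⟨j, hj, rfl⟩ | ⟨j, hj, rfl⟩ | ⟨k, hk, rfl⟩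
    · have := (decode (ρ := 0) (i := 0) (by omega) hi (by simpa using e2)).1
      subst this
      exact S.vec_ne hj _ _ (by simp [unit]) (hvec (by simp))
    · have := (decode (i := 0) (by omega) hi (by simpa using e2)).1
      subst this
      exact S.vec_ne hj _ _ (by simp [unit]) (hvec (by simp))
    · have := state_lt hρ hi
      simp only at e2
      omega

theorem vec_mem {x : ℕ → ℤ} {y : ℤ} (hx : ∀ j, x j = -1 ∨ x j = 0 ∨ x j = 1)
    (hy : y = -1 ∨ y = 0 ∨ y = 1) (i) : S.vec x y i = -1 ∨ S.vec x y i = 0 ∨ S.vec x y i = 1 := by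
  unfold vec
  split_ifs
  · exact hx _
  · exact hy
  · simp

theorem unit_mem (j k : ℕ) : unit j k = -1 ∨ unit j k = 0 ∨ unit j k = 1 := by
  unfold unit; split_ifs <;> simp

theorem neg_unit_mem (j k : ℕ) : (-unit j) k = -1 ∨ (-unit j) k = 0 ∨ (-unit j) k = 1 := by
  simp only [unit, Pi.neg_apply]; split_ifs <;> simp

theorem zero_mem (k : ℕ) : (0 : ℕ → ℤ) k = -1 ∨ (0 : ℕ → ℤ) k = 0 ∨ (0 : ℕ → ℤ) k = 1 := by
  simp

theorem unary_trans (N : ℕ) (T : ℕ → ℕ) : ∀ t ∈ S.trans N T, ∀ i,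
    t.2.1 i = -1 ∨ t.2.1 i = 0 ∨ t.2.1 i = 1 := by
  intro t ht
  rcases (S.mem_trans_iff N T t).1 ht with h | ⟨i, hi, h⟩
  · rcases (S.mem_consts_iff N t).1 h with ⟨j, hj, rfl⟩ | ⟨j, hj, rfl⟩ | ⟨k, hk, rfl⟩
    · exact S.vec_mem (unit_mem j) (by simp)
    · exact S.vec_mem (neg_unit_mem j) (by simp)
    · dsimp only
      split_ifs
      · exact S.vec_mem zero_mem (by simp)
      · exact S.vec_mem zero_mem (by simp)
  · obtain ⟨ρ, hρ, rfl | rfl⟩ := (S.mem_body_iff N T i t).1 h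
    · dsimp only [walkVec]
      split_ifs
      · exact S.vec_mem zero_mem (by simp)
      · exact S.vec_mem (neg_unit_mem _) (by simp)
      · exact S.vec_mem (unit_mem _) (by simp)
    · exact S.vec_mem zero_mem (by simp)

/-- The number of states. -/
def numStates (N : ℕ) : ℕ := S.phases * S.I N + 2 + S.R + S.pad * S.I N

theorem switchOK_lt {N : ℕ} {T : ℕ → ℕ} {ρ i : ℕ} (hρ : ρ < S.phases) (h : S.SwitchOK N T ρ i) :
    ρ + 1 < S.phases := by
  by_contra hc
  have hR : ρ = S.R * S.len := by unfold phases at hρ hc; omega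
  have hl : 0 < S.len := by unfold len; omega
  unfold SwitchOK at h
  rw [hR, Nat.mul_mod_left, if_pos rfl, Nat.mul_div_cancel _ hl] at h
  exact lt_irrefl _ h.1

theorem trans_lt (N : ℕ) (T : ℕ → ℕ) : ∀ t ∈ S.trans N T,
    t.1 < S.numStates N ∧ t.2.2 < S.numStates N := by
  intro t ht
  have hle : S.R * S.len * S.I N ≤ S.phases * S.I N := Nat.mul_le_mul_right _ (Nat.le_succ _)
  have hp := Nat.zero_le (S.pad * S.I N)
  unfold numStates
  rcases (S.mem_trans_iff N T t).1 ht with h | ⟨i, hi, h⟩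
  · rcases (S.mem_consts_iff N t).1 h with ⟨j, hj, rfl⟩ | ⟨j, hj, rfl⟩ | ⟨k, hk, rfl⟩
    · dsimp only; omega
    · have := S.R_pos
      dsimp only; omega
    · dsimp only
      split_ifs <;> omega
  · obtain ⟨ρ, hρ, rfl | rfl⟩ := (S.mem_body_iff N T i t).1 h
    · have h1 := state_lt hρ hi
      refine ⟨by dsimp only; omega, ?_⟩
      dsimp only [walkTarget]
      have h2 := state_lt hρ (Nat.mod_lt (i + 1) (by omega : S.I N > 0))
      split_ifs with _ _ h3
      · omega
      · have := state_lt hρ h3; omega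
      · omega
      · omega
      · have := state_lt hρ (by omega : i - N ^ 3 < S.I N); omega
    · have h1 := state_lt hρ hi
      refine ⟨by dsimp only; omega, ?_⟩
      dsimp only [switchTarget]
      split_ifs with h2
      · have := state_lt (S.switchOK_lt hρ h2) hi
        omega
      · omega

def toListVASS (N : ℕ) (T : ℕ → ℕ) : ListVASS (S.d + 2) where
  states := S.numStates N
  trans := S.trans N T
  ne_nil := by
    intro h
    have : (0, S.vec (unit 0) 0, 0) ∈ S.trans N T :=
      (S.mem_trans_iff N T _).2 (Or.inl ((S.mem_consts_iff N _).2 (Or.inl ⟨0, S.d_pos, rfl⟩)))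
    rw [h] at this
    simp at this
  nodup := S.nodup_trans N T
  unary := S.unary_trans N T
  lt := S.trans_lt N T

/-- The number of the vertex `p` in a valuation `h` of the counters. -/
def vertex (N : ℕ) (h : ℕ → ℕ) (p : ℕ × ℕ) : ℕ := h p.1 / N ^ p.2 % N

/-- The triple number `r` is a hyperedge. -/
def Check (N : ℕ) (T : ℕ → ℕ) (r : ℕ) (h : ℕ → ℕ) : Prop :=
  T (vertex N h (S.tri r 0) + vertex N h (S.tri r 1) * N + vertex N h (S.tri r 2) * N ^ 2) = 1

def sum (h : ℕ → ℕ) : ℕ := ∑ j ∈ Finset.range S.d, h j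

/-- The first `d` counters. -/
def counters (u : Fin (S.d + 2) → ℕ) : ℕ → ℕ := fun j => if h : j < S.d then u ⟨j, by omega⟩ else 0

/-- The counter that accumulates the guesses. -/
def total (u : Fin (S.d + 2) → ℕ) : ℕ := u ⟨S.d, by omega⟩

/-- Add `g` to the `j`-th counter. -/
def bump (c : ℕ → ℕ) (j g : ℕ) : ℕ → ℕ := fun k => if k = j then c k + g else c k

theorem bump_zero (c : ℕ → ℕ) (j : ℕ) : bump c j 0 = c := by
  funext k; simp [bump]

theorem bump_bump (c : ℕ → ℕ) (j g g' : ℕ) : bump (bump c j g) j g' = bump c j (g + g') := by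
  funext k; unfold bump; split_ifs <;> omega

theorem sum_bump (c : ℕ → ℕ) {j : ℕ} (hj : j < S.d) (g : ℕ) : S.sum (bump c j g) = S.sum c + g := by
  have : ∀ k, bump c j g k = c k + if k = j then g else 0 := by
    intro k; unfold bump; split_ifs <;> omega
  simp only [sum, this, Finset.sum_add_distrib, Finset.sum_ite_eq', Finset.mem_range, hj, if_true]

section Step

variable {S} {u u' : Fin (S.d + 2) → ℕ} {x : ℕ → ℤ} {y : ℤ}

theorem counters_of_step (h : ∀ i, (u' i : ℤ) = u i + S.vec x y i) {j : ℕ} (hj : j < S.d) :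
    (S.counters u' j : ℤ) = S.counters u j + x j := by
  have := h ⟨j, by omega⟩
  rw [vec_apply_lt S hj] at this
  simpa [counters, hj] using this

theorem total_of_step (h : ∀ i, (u' i : ℤ) = u i + S.vec x y i) :
    (S.total u' : ℤ) = S.total u + y := by
  have := h ⟨S.d, by omega⟩
  simpa [total, vec] using this

theorem counters_of_step_zero (h : ∀ i, (u' i : ℤ) = u i + S.vec 0 y i) :
    S.counters u' = S.counters u := by
  funext j
  by_cases hj : j < S.d
  · have := counters_of_step h hj
    simp only [Pi.zero_apply, add_zero] at this
    exact_mod_cast this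
  · simp [counters, hj]

theorem counters_of_step_unit {j : ℕ} (hj : j < S.d)
    (h : ∀ i, (u' i : ℤ) = u i + S.vec (unit j) y i) :
    S.counters u' = bump (S.counters u) j 1 := by
  funext k
  by_cases hk : k < S.d
  · have := counters_of_step h hk
    unfold unit at this
    unfold bump
    split_ifs at this ⊢ <;> omega
  · have : k ≠ j := by omega
    simp [counters, hk, bump, this]

theorem counters_of_step_neg_unit {j : ℕ} (hj : j < S.d)
    (h : ∀ i, (u' i : ℤ) = u i + S.vec (-unit j) y i) :
    S.counters u = bump (S.counters u') j 1 := by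
  funext k
  by_cases hk : k < S.d
  · have := counters_of_step h hk
    simp only [unit, Pi.neg_apply] at this
    unfold bump
    split_ifs at this ⊢ <;> omega
  · have : k ≠ j := by omega
    simp [counters, hk, bump, this]

end Step

/-- What has been verified in check `r` after its first `j` counters have been read, if the sum of
all guesses is as large as possible. -/
def Good (N : ℕ) (T : ℕ → ℕ) (r j m : ℕ) (h : ℕ → ℕ) (z : ℕ) : Prop :=
  z ≤ r * S.sum h + ∑ k ∈ Finset.range j, h k ∧
    (z = r * S.sum h + ∑ k ∈ Finset.range j, h k →
      (∀ r' < r, S.Check N T r' h) ∧ T m = 1 ∧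
        ∀ σ : Fin 3, (S.tri r σ).1 < j → vertex N h (S.tri r σ) = m / N ^ σ.val % N)

/-- The invariant in phase `u` of check `r`. -/
def PhaseInv (N : ℕ) (T : ℕ → ℕ) (r u i : ℕ) (c : ℕ → ℕ) (z : ℕ) : Prop :=
  -- Up to the end of the checks `h` is the current valuation. Afterwards the counters are being
  -- emptied, and `h` remembers the valuation that was checked.
  if u = 0 then ∃ h, (r < S.R → h = c) ∧ z ≤ r * S.sum c ∧
    (z = r * S.sum c → ∀ r' < r, S.Check N T r' h)
  -- `bump` adds the units under way back to their counter and so recovers the valuation under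
  -- examination. In a reading phase `z0` is the accumulator before this counter was read.
  else if u % 2 = 1 then ∃ z0, z = z0 + i / N ^ 3 ∧
    S.Good N T r ((u - 1) / 2) (i % N ^ 3) (bump c ((u - 1) / 2) (i / N ^ 3)) z0
  else S.Good N T r ((u - 1) / 2 + 1) (i % N ^ 3) (bump c ((u - 1) / 2) (i / N ^ 3)) z

/-- The invariant in the last part. -/
def FinalInv (N : ℕ) (T : ℕ → ℕ) (t : ℕ) (c : ℕ → ℕ) (z : ℕ) : Prop :=
  -- At chain state `t` the accumulator still owes `R - 1 - t` units for the last decrement of a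
  -- working counter.
  ∃ h, z ≤ S.R * S.sum c + (S.R - 1 - t) ∧
    (z = S.R * S.sum c + (S.R - 1 - t) → ∀ r < S.R, S.Check N T r h)

def Inv (N : ℕ) (T : ℕ → ℕ) (s : ℕ) (c : ℕ → ℕ) (z : ℕ) : Prop :=
  (∃ ρ < S.phases, ∃ i < S.I N, s = ρ * S.I N + i ∧ S.PhaseInv N T (ρ / S.len) (ρ % S.len) i c z) ∨
  (∃ t < S.R, s = S.phases * S.I N + (2 + t) ∧ S.FinalInv N T t c z) ∨
  (s = S.phases * S.I N ∨ s = S.phases * S.I N + 1)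

/-! ### Soundness: the invariant holds along all runs -/

section Soundness

variable {S} {N : ℕ} {T : ℕ → ℕ}

theorem len_pos : 0 < S.len := by unfold len; omega

theorem Inv.phase {ρ i z : ℕ} {c : ℕ → ℕ} (h : S.Inv N T (ρ * S.I N + i) c z)
    (hρ : ρ < S.phases) (hi : i < S.I N) : S.PhaseInv N T (ρ / S.len) (ρ % S.len) i c z := by
  have hlt := state_lt hρ hi
  rcases h with ⟨ρ', _, i', hi', he, h⟩ | ⟨t, _, he, _⟩ | he
  · obtain ⟨rfl, rfl⟩ := decode hi hi' he
    exact h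
  · omega
  · omega

theorem Inv.final {t z : ℕ} {c : ℕ → ℕ} (h : S.Inv N T (S.phases * S.I N + (2 + t)) c z) :
    S.FinalInv N T t c z := by
  rcases h with ⟨ρ', hρ', i', hi', he, h⟩ | ⟨t', _, he, h⟩ | he
  · have := state_lt hρ' hi'
    omega
  · obtain rfl : t = t' := by omega
    exact h
  · omega

theorem phase_div_lt {ρ : ℕ} (hρ : ρ < S.phases) (h : ρ % S.len ≠ 0) : ρ / S.len < S.R := by
  have h1 := Nat.div_add_mod ρ S.len
  by_contra hc
  have h2 : S.len * S.R ≤ S.len * (ρ / S.len) := Nat.mul_le_mul_left _ (by omega)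
  rw [mul_comm S.len S.R] at h2
  unfold phases at hρ
  omega

/-- Moving a unit between counter `j` and the index preserves `bump c j (i / N ^ 3)` and `i % N ^
3`. In a reading phase the accumulator and `i / N ^ 3` grow together, so `z0` is preserved as well.
-/
theorem inv_walk {ρ i : ℕ} {u u' : Fin (S.d + 2) → ℕ} (hρ : ρ < S.phases) (hi : i < S.I N)
    (hN : 0 < N)
    (h : S.PhaseInv N T (ρ / S.len) (ρ % S.len) i (S.counters u) (S.total u))
    (hu : ∀ i, (u' i : ℤ) = u i + S.walkVec ρ i) :
    S.Inv N T (S.walkTarget N ρ i) (S.counters u') (S.total u') := by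
  have hN3 : 0 < N ^ 3 := by positivity
  have hph := S.phase_lt ρ
  unfold walkVec at hu
  unfold walkTarget
  by_cases h0 : ρ % S.len = 0
  · rw [if_pos h0] at hu ⊢
    refine Or.inl ⟨ρ, hρ, _, Nat.mod_lt _ (by omega), rfl, ?_⟩
    have hc := counters_of_step_zero hu
    have hz := total_of_step hu
    simp only [add_zero, Nat.cast_inj] at hz
    unfold PhaseInv at h ⊢
    rw [if_pos h0] at h ⊢
    rw [hc, hz]
    exact h
  · have hj : (ρ % S.len - 1) / 2 < S.d := by omega
    rw [if_neg h0] at hu ⊢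
    unfold PhaseInv at h
    rw [if_neg h0] at h
    by_cases h1 : ρ % S.len % 2 = 1
    · rw [if_pos h1] at hu h ⊢
      split_ifs with h2
      · refine Or.inl ⟨ρ, hρ, _, h2, rfl, ?_⟩
        have hc := counters_of_step_neg_unit hj hu
        have hz := total_of_step hu
        unfold PhaseInv
        rw [if_neg h0, if_pos h1]
        obtain ⟨z0, hz0, hg⟩ := h
        refine ⟨z0, ?_, ?_⟩
        · rw [Nat.add_div_right _ hN3]; omega
        · rw [Nat.add_div_right _ hN3, Nat.add_mod_right]
          rw [hc, bump_bump, add_comm 1] at hg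
          exact hg
      · exact Or.inr (Or.inr (Or.inl rfl))
    · rw [if_neg h1] at hu h ⊢
      split_ifs with h2
      · exact Or.inr (Or.inr (Or.inl rfl))
      · refine Or.inl ⟨ρ, hρ, _, by omega, rfl, ?_⟩
        have hc := counters_of_step_unit hj hu
        have hz := total_of_step hu
        simp only [add_zero, Nat.cast_inj] at hz
        unfold PhaseInv
        rw [if_neg h0, if_neg h1]
        obtain ⟨k, rfl⟩ := Nat.exists_eq_add_of_le' (not_lt.1 h2)
        rw [Nat.add_div_right _ hN3, Nat.add_mod_right] at h
        rw [Nat.add_sub_cancel, hz, hc, bump_bump, add_comm 1]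
        exact h

theorem vertex_digits {m : ℕ} (hm : m < N ^ 3) :
    m / N ^ 0 % N + m / N ^ 1 % N * N + m / N ^ 2 % N * N ^ 2 = m := by
  have h1 := Nat.div_add_mod m N
  have h2 := Nat.div_add_mod (m / N) N
  have h3 : m / N / N < N := by
    rw [Nat.div_div_eq_div_mul]
    refine Nat.div_lt_of_lt_mul ?_
    calc m < N ^ 3 := hm
      _ = N * N * N := by ring
  have h4 : m / N ^ 2 = m / N / N := by rw [Nat.div_div_eq_div_mul, sq]
  rw [h4, pow_zero, Nat.div_one, pow_one, Nat.mod_eq_of_lt h3]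
  calc m % N + m / N % N * N + m / N / N * N ^ 2 = N * (N * (m / N / N) + m / N % N) + m % N := by
        ring
    _ = m := by rw [h2, h1]

theorem digit_mod (i : ℕ) (σ : Fin 3) : i % N ^ 3 / N ^ σ.val % N = i / N ^ σ.val % N := by
  have hpow : N ^ 3 = N ^ σ.val * (N * N ^ (2 - σ.val)) := by
    rw [← pow_succ', ← pow_add]
    congr 1
    omega
  rw [hpow, Nat.mod_mul_right_div_self, Nat.mod_mul_right_mod]

/-- This is where the accumulator replaces zero tests. After the reading of `g` units with `c j`
units left behind, the accumulator has gained `g`, while the maximal gain is `c j + g`. A deficit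
can never be made up, so only complete readings have to be analysed. -/
theorem inv_switch {ρ i : ℕ} {u u' : Fin (S.d + 2) → ℕ} (hρ : ρ < S.phases) (hi : i < S.I N)
    (hN : 0 < N)
    (h : S.PhaseInv N T (ρ / S.len) (ρ % S.len) i (S.counters u) (S.total u))
    (hu : ∀ i, (u' i : ℤ) = u i + S.vec 0 0 i) :
    S.Inv N T (S.switchTarget N T ρ i) (S.counters u') (S.total u') := by
  have hN3 : 0 < N ^ 3 := by positivity
  have hph := S.phase_lt ρ
  have hc := counters_of_step_zero hu
  have hz := total_of_step hu
  simp only [add_zero, Nat.cast_inj] at hz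
  rw [hc, hz]
  unfold switchTarget
  split_ifs with hs
  swap
  · exact Or.inr (Or.inr (Or.inr rfl))
  refine Or.inl ⟨ρ + 1, S.switchOK_lt hρ hs, i, hi, rfl, ?_⟩
  have hdm := Nat.div_add_mod ρ S.len
  have hlen : S.len = 2 * S.d + 1 := rfl
  have hd := S.d_pos
  set c := S.counters u
  set z := S.total u
  set r := ρ / S.len
  unfold SwitchOK at hs
  unfold PhaseInv at h
  have hnext : ρ % S.len + 1 < S.len → (ρ + 1) / S.len = r ∧ (ρ + 1) % S.len = ρ % S.len + 1 := by
    intro hlt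
    have : ρ + 1 = S.len * r + (ρ % S.len + 1) := by omega
    rw [this, Nat.mul_add_div S.len_pos, Nat.mul_add_mod, Nat.div_eq_of_lt hlt,
      Nat.mod_eq_of_lt hlt]
    simp
  by_cases h0 : ρ % S.len = 0
  · rw [if_pos h0] at hs h
    obtain ⟨hr, hi3, hT⟩ := hs
    obtain ⟨g, hg, hle, heq⟩ := h
    obtain rfl := hg hr
    obtain ⟨e1, e2⟩ := hnext (by omega)
    rw [e1, e2, h0]
    unfold PhaseInv
    rw [if_neg (by omega), if_pos rfl]
    simp only [zero_add, Nat.sub_self, Nat.zero_div]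
    rw [Nat.div_eq_of_lt hi3]
    refine ⟨z, rfl, ?_⟩
    rw [bump_zero]
    exact ⟨by simpa using hle, fun he => ⟨heq (by simpa using he), hT, fun σ hσ => by omega⟩⟩
  · rw [if_neg h0] at hs h
    have hr := phase_div_lt hρ h0
    by_cases h1 : ρ % S.len % 2 = 1
    · rw [if_pos h1] at hs h
      obtain ⟨e1, e2⟩ := hnext (by omega)
      rw [e1, e2]
      unfold PhaseInv
      rw [if_neg (by omega), if_neg (by omega)]
      have hj : (ρ % S.len + 1 - 1) / 2 = (ρ % S.len - 1) / 2 := by omega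
      rw [hj]
      set j := (ρ % S.len - 1) / 2
      obtain ⟨z0, hz0, hle, heq⟩ := h
      set g := i / N ^ 3
      have hbj : bump c j g j = c j + g := by simp [bump]
      refine ⟨?_, ?_⟩
      · rw [Finset.sum_range_succ, hbj]; omega
      · intro he
        rw [Finset.sum_range_succ, hbj] at he
        -- A maximal accumulator leaves no unit unread. Hence `g` is the full value of the counter,
        -- and the compared digits are those of its vertices.
        have hcj : c j = 0 := by omega
        obtain ⟨a1, a2, a3⟩ := heq (by omega)
        refine ⟨a1, a2, fun σ hσ => ?_⟩
        rcases Nat.lt_succ_iff_lt_or_eq.1 hσ with hσ | hσ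
        · exact a3 σ hσ
        · rw [digit_mod, ← hs σ hσ, vertex, hσ, hbj, hcj, zero_add, Nat.div_div_eq_div_mul,
            ← pow_add]
    · rw [if_neg h1] at hs h
      rw [Nat.div_eq_of_lt hs, bump_zero] at h
      by_cases hlast : ρ % S.len + 1 < S.len
      · obtain ⟨e1, e2⟩ := hnext hlast
        rw [e1, e2]
        unfold PhaseInv
        rw [if_neg (by omega), if_pos (by omega)]
        have hj : (ρ % S.len + 1 - 1) / 2 = (ρ % S.len - 1) / 2 + 1 := by omega
        rw [hj, Nat.div_eq_of_lt hs, bump_zero]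
        exact ⟨z, rfl, h⟩
      · have hj : (ρ % S.len - 1) / 2 + 1 = S.d := by omega
        have : ρ + 1 = S.len * (r + 1) := by rw [mul_add, mul_one]; omega
        rw [this, Nat.mul_div_cancel_left _ S.len_pos, Nat.mul_mod_right]
        unfold PhaseInv
        rw [if_pos rfl]
        rw [hj] at h
        obtain ⟨hle, heq⟩ := h
        have hsum : (r + 1) * S.sum c = r * S.sum c + ∑ k ∈ Finset.range S.d, c k := by
          rw [add_mul, one_mul]; rfl
        rw [hsum]
        refine ⟨c, fun _ => rfl, hle, fun he r' hr' => ?_⟩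
        obtain ⟨a1, a2, a3⟩ := heq he
        rcases Nat.lt_succ_iff_lt_or_eq.1 hr' with hr' | rfl
        · exact a1 r' hr'
        · unfold Check
          -- Each of the three vertices lies in one of the `d` counters, so all three digits of `m`
          -- have been compared and `m` is the tensor index of the triple.
          rw [a3 0 (S.tri_lt _ hr 0).1, a3 1 (S.tri_lt _ hr 1).1, a3 2 (S.tri_lt _ hr 2).1]
          rw [← vertex_digits (Nat.mod_lt i hN3)] at a2
          exact a2

theorem last_phase : S.R * S.len / S.len = S.R ∧ S.R * S.len % S.len = 0 :=
  ⟨Nat.mul_div_cancel _ S.len_pos, Nat.mul_mod_left _ _⟩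

theorem I_pos (hN : 0 < N) : 0 < S.I N := by unfold I; positivity

theorem inv_step {B : ℕ} (hN : 0 < N) {a b : ℕ × (Fin (S.d + 2) → ℕ)}
    (h : S.Inv N T a.1 (S.counters a.2) (S.total a.2)) (hs : (S.toListVASS N T).Step B a b) :
    S.Inv N T b.1 (S.counters b.2) (S.total b.2) := by
  obtain ⟨s, u⟩ := a
  obtain ⟨s', u'⟩ := b
  obtain ⟨-, -, x, hx, hu⟩ := hs
  have hI := S.I_pos hN
  have hR := S.R_pos
  simp only at h hx hu ⊢
  rcases (S.mem_trans_iff N T _).1 hx with hx | ⟨i, hi, hx⟩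
  · rcases (S.mem_consts_iff N _).1 hx with ⟨j, hj, he⟩ | ⟨j, hj, he⟩ | ⟨k, hk, he⟩ <;>
      simp only [Prod.mk.injEq] at he <;> obtain ⟨rfl, rfl, rfl⟩ := he
    · have h0 := Inv.phase (ρ := 0) (i := 0) (by simpa using h) (Nat.succ_pos _) hI
      -- In state 0 no check has been made and the accumulator is 0, so the counters may be changed
      -- freely.
      refine Or.inl ⟨0, Nat.succ_pos _, 0, hI, by simp, ?_⟩
      have hz := total_of_step hu
      simp only [add_zero, Nat.cast_inj] at hz
      simp only [Nat.zero_div, Nat.zero_mod, PhaseInv, if_true] at h0 ⊢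
      obtain ⟨_, -, hle, -⟩ := h0
      exact ⟨_, fun _ => rfl, by rw [hz]; simpa using hle, fun _ r' hr' => by omega⟩
    · have h0 := Inv.phase (ρ := S.R * S.len) (i := 0) h (Nat.lt_succ_self _) hI
      refine Or.inr (Or.inl ⟨0, hR, rfl, ?_⟩)
      have hz := total_of_step hu
      have hc := counters_of_step_neg_unit hj hu
      rw [last_phase.1, last_phase.2] at h0
      simp only [PhaseInv, if_true] at h0
      obtain ⟨g, -, hle, heq⟩ := h0
      have hsum : S.R * S.sum (S.counters u) = S.R * S.sum (S.counters u') + S.R := by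
        rw [hc, S.sum_bump _ hj, mul_add, mul_one]
      rw [hsum] at hle heq
      exact ⟨g, by omega, fun he => heq (by omega)⟩
    · obtain ⟨g, hle, heq⟩ := h.final
      split_ifs at hu ⊢ with hk'
      · refine Or.inr (Or.inl ⟨k + 1, hk', by ring, ?_⟩)
        have hz := total_of_step hu
        rw [← counters_of_step_zero hu] at hle heq
        exact ⟨g, by omega, fun he => heq (by omega)⟩
      · refine Or.inl ⟨S.R * S.len, Nat.lt_succ_self _, 0, hI, rfl, ?_⟩
        have hz := total_of_step hu
        rw [← counters_of_step_zero hu] at hle heq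
        rw [last_phase.1, last_phase.2]
        simp only [PhaseInv, if_true]
        exact ⟨g, fun hlt => absurd hlt (lt_irrefl _), by omega, fun he => heq (by omega)⟩
  · obtain ⟨ρ, hρ, he | he⟩ := (S.mem_body_iff N T i _).1 hx <;>
      simp only [Prod.mk.injEq] at he <;> obtain ⟨rfl, rfl, rfl⟩ := he
    · exact inv_walk hρ hi hN (h.phase hρ hi) hu
    · exact inv_switch hρ hi hN (h.phase hρ hi) hu

/-- In the target configuration both sides of `z ≤ R * sum` are 0, so equality holds, and the
invariant supplies a valuation that passes all checks. -/
theorem soundness {B : ℕ} (hN : 0 < N)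
    (h : Relation.ReflTransGen ((S.toListVASS N T).Step B) (0, fun _ => 0)
      (S.R * S.len * S.I N, fun _ => 0)) : ∃ v, ∀ r < S.R, S.Check N T r v := by
  have hI := S.I_pos hN
  have hc : S.counters (fun _ => 0) = fun _ => 0 := by funext j; simp [counters]
  have hsum : S.sum (fun _ => 0) = 0 := by simp [sum]
  have key : ∀ b, Relation.ReflTransGen ((S.toListVASS N T).Step B) (0, fun _ => 0) b →
      S.Inv N T b.1 (S.counters b.2) (S.total b.2) := by
    intro b hb
    induction hb with
    | refl =>
      refine Or.inl ⟨0, Nat.succ_pos _, 0, hI, by simp, ?_⟩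
      simp only [Nat.zero_div, Nat.zero_mod, PhaseInv, if_true]
      exact ⟨_, fun _ => rfl, by simp [total], fun _ r' hr' => by omega⟩
    | tail _ hs ih => exact inv_step hN ih hs
  have h0 := Inv.phase (ρ := S.R * S.len) (i := 0) (key _ h) (Nat.lt_succ_self _) hI
  rw [last_phase.1, last_phase.2] at h0
  simp only [PhaseInv, if_true, hc, hsum] at h0
  obtain ⟨g, -, -, heq⟩ := h0
  exact ⟨g, heq (by simp [total])⟩

end Soundness

/-- The counter values `c`, and `z` for the accumulating counter. -/
def cfg (c : ℕ → ℕ) (z : ℕ) : Fin (S.d + 2) → ℕ := fun i =>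
  if i.val < S.d then c i.val else if i.val = S.d then z else 0

theorem cfg_congr {c c' : ℕ → ℕ} (z : ℕ) (h : ∀ j < S.d, c j = c' j) : S.cfg c z = S.cfg c' z := by
  funext i
  unfold cfg
  split_ifs with h1
  · exact h _ h1
  · rfl
  · rfl

/-- Reachability in the `B`-bounded VASS. -/
def Reach (N : ℕ) (T : ℕ → ℕ) (B : ℕ) : ℕ × (Fin (S.d + 2) → ℕ) → ℕ × (Fin (S.d + 2) → ℕ) → Prop :=
  Relation.ReflTransGen ((S.toListVASS N T).Step B)

/-- The counter values `c` and `z` are at most `B`. -/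
def Bounded (B : ℕ) (c : ℕ → ℕ) (z : ℕ) : Prop := (∀ j < S.d, c j ≤ B) ∧ z ≤ B

/-! ### Completeness: the honest run -/

section Completeness

variable {S} {N : ℕ} {T : ℕ → ℕ} {B : ℕ}

theorem cfg_le {c : ℕ → ℕ} {z : ℕ} (h : S.Bounded B c z) (i) : S.cfg c z i ≤ B := by
  unfold cfg
  split_ifs with h1
  · exact h.1 _ h1
  · exact h.2
  · exact Nat.zero_le _

theorem reach_step {p q : ℕ} {x : ℕ → ℤ} {y : ℤ} {c c' : ℕ → ℕ} {z z' : ℕ}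
    (ht : (p, S.vec x y, q) ∈ S.trans N T) (hb : S.Bounded B c z) (hb' : S.Bounded B c' z')
    (hc : ∀ j < S.d, (c' j : ℤ) = c j + x j) (hz : (z' : ℤ) = z + y) :
    S.Reach N T B (p, S.cfg c z) (q, S.cfg c' z') := by
  refine Relation.ReflTransGen.single ⟨cfg_le hb, cfg_le hb', S.vec x y, ht, fun i => ?_⟩
  simp only [cfg, vec]
  split_ifs with h1 h2
  · exact hc _ h1
  · exact hz
  · simp

theorem mem_consts_of {t : ℕ × (Fin (S.d + 2) → ℤ) × ℕ}
    (h : (∃ j < S.d, t = (0, S.vec (unit j) 0, 0)) ∨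
      (∃ j < S.d, t = (S.R * S.len * S.I N, S.vec (-unit j) (-1), S.phases * S.I N + 2)) ∨
      (∃ k < S.R, t = (S.phases * S.I N + (2 + k),
        if k + 1 < S.R then S.vec 0 (-1) else S.vec 0 0,
        if k + 1 < S.R then S.phases * S.I N + (2 + k + 1) else S.R * S.len * S.I N))) :
    t ∈ S.trans N T :=
  (S.mem_trans_iff N T t).2 (Or.inl ((S.mem_consts_iff N t).2 h))

theorem walk_mem {ρ i : ℕ} (hρ : ρ < S.phases) (hi : i < S.I N) :
    (ρ * S.I N + i, S.walkVec ρ, S.walkTarget N ρ i) ∈ S.trans N T :=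
  (S.mem_trans_iff N T _).2 (Or.inr ⟨i, hi, (S.mem_body_iff N T i _).2 ⟨ρ, hρ, Or.inl rfl⟩⟩)

theorem switch_mem {ρ i : ℕ} (hρ : ρ < S.phases) (hi : i < S.I N) :
    (ρ * S.I N + i, S.vec 0 0, S.switchTarget N T ρ i) ∈ S.trans N T :=
  (S.mem_trans_iff N T _).2 (Or.inr ⟨i, hi, (S.mem_body_iff N T i _).2 ⟨ρ, hρ, Or.inr rfl⟩⟩)

theorem reach_switch {ρ i : ℕ} {c : ℕ → ℕ} {z : ℕ} (hρ : ρ < S.phases) (hi : i < S.I N)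
    (hs : S.SwitchOK N T ρ i) (hb : S.Bounded B c z) :
    S.Reach N T B (ρ * S.I N + i, S.cfg c z) ((ρ + 1) * S.I N + i, S.cfg c z) := by
  have h := switch_mem (T := T) hρ hi
  unfold switchTarget at h
  rw [if_pos hs] at h
  exact reach_step h hb hb (by simp) (by simp)

theorem reach_guess {ρ i m : ℕ} {c : ℕ → ℕ} {z : ℕ} (hρ : ρ < S.phases) (h0 : ρ % S.len = 0)
    (hi : i < S.I N) (hm : m < S.I N) (hb : S.Bounded B c z) :
    S.Reach N T B (ρ * S.I N + i, S.cfg c z) (ρ * S.I N + m, S.cfg c z) := by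
  have key : ∀ n, S.Reach N T B (ρ * S.I N + i, S.cfg c z)
      (ρ * S.I N + (i + n) % S.I N, S.cfg c z) := by
    intro n
    induction n with
    | zero => rw [add_zero, Nat.mod_eq_of_lt hi]; exact Relation.ReflTransGen.refl
    | succ n ih =>
      refine ih.trans ?_
      have h := walk_mem (S := S) (N := N) (T := T) hρ (Nat.mod_lt (i + n) (by omega))
      unfold walkVec walkTarget at h
      rw [if_pos h0, if_pos h0, Nat.mod_add_mod] at h
      exact reach_step h hb hb (by simp) (by simp)
  -- Walking past the end of the cycle once reaches `m` whether or not it lies before `i`.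
  have h := key (S.I N - i + m)
  rwa [show i + (S.I N - i + m) = S.I N + m by omega, Nat.add_mod_left, Nat.mod_eq_of_lt hm] at h

theorem index_lt {m g : ℕ} (hm : m < N ^ 3) (hg : g < N ^ S.K) : m + N ^ 3 * g < S.I N := by
  have h1 : N ^ 3 * (g + 1) ≤ N ^ 3 * N ^ S.K := Nat.mul_le_mul_left _ hg
  unfold I
  rw [add_comm S.K 3, pow_add]
  rw [mul_add, mul_one] at h1
  omega

theorem reach_down {ρ m j G z : ℕ} {c : ℕ → ℕ} (hρ : ρ < S.phases) (h1 : ρ % S.len = 2 * j + 1)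
    (hm : m < N ^ 3) (hG : G < N ^ S.K) (hb : S.Bounded B (bump c j G) (z + G))
    (g : ℕ) (hg : g ≤ G) :
    S.Reach N T B (ρ * S.I N + m, S.cfg (bump c j G) z)
      (ρ * S.I N + (m + N ^ 3 * g), S.cfg (bump c j (G - g)) (z + g)) := by
  have hbd : ∀ g ≤ G, S.Bounded B (bump c j (G - g)) (z + g) := by
    intro g hg
    refine ⟨fun k hk => le_trans ?_ (hb.1 k hk), le_trans (by omega) hb.2⟩
    unfold bump
    split_ifs <;> omega
  induction g with
  | zero => exact Relation.ReflTransGen.refl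
  | succ g ih =>
    refine (ih (by omega)).trans ?_
    have hlt := index_lt (S := S) hm (by omega : g < N ^ S.K)
    have hlt' := index_lt (S := S) hm (by omega : g + 1 < N ^ S.K)
    rw [mul_add, mul_one, ← add_assoc] at hlt'
    have h := walk_mem (S := S) (N := N) (T := T) hρ hlt
    unfold walkVec walkTarget at h
    have h0 : ρ % S.len ≠ 0 := by omega
    have h2 : ρ % S.len % 2 = 1 := by omega
    rw [if_neg h0, if_neg h0, if_pos h2, if_pos h2, if_pos hlt', h1,
      show (2 * j + 1 - 1) / 2 = j by omega] at h
    rw [show m + N ^ 3 * (g + 1) = m + N ^ 3 * g + N ^ 3 by ring]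
    refine reach_step h (hbd g (by omega)) (hbd (g + 1) hg) (fun k _ => ?_) (by push_cast; ring)
    simp only [bump, unit, Pi.neg_apply]
    split_ifs <;> omega

theorem reach_up {ρ m j z : ℕ} (hρ : ρ < S.phases) (h2 : ρ % S.len = 2 * j + 2)
    (hm : m < N ^ 3) (g : ℕ) (hg : g < N ^ S.K) {c : ℕ → ℕ}
    (hb : S.Bounded B (bump c j g) z) :
    S.Reach N T B (ρ * S.I N + (m + N ^ 3 * g), S.cfg c z)
      (ρ * S.I N + m, S.cfg (bump c j g) z) := by
  induction g generalizing c with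
  | zero => rw [bump_zero]; exact Relation.ReflTransGen.refl
  | succ g ih =>
    have hlt := index_lt (S := S) hm hg
    have h := walk_mem (S := S) (N := N) (T := T) hρ hlt
    unfold walkVec walkTarget at h
    have hge : ¬ m + N ^ 3 * (g + 1) < N ^ 3 := by rw [mul_add, mul_one]; omega
    have h0 : ρ % S.len ≠ 0 := by omega
    have h1 : ρ % S.len % 2 ≠ 1 := by omega
    rw [if_neg h0, if_neg h0, if_neg h1, if_neg h1, if_neg hge,
      h2, show (2 * j + 2 - 1) / 2 = j by omega,
      show m + N ^ 3 * (g + 1) - N ^ 3 = m + N ^ 3 * g by rw [mul_add, mul_one]; omega] at h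
    have hbb : bump c j (g + 1) = bump (bump c j 1) j g := by rw [bump_bump, add_comm]
    rw [hbb] at hb ⊢
    refine Relation.ReflTransGen.trans (reach_step h ?_ ?_ (fun k _ => ?_) (by simp))
      (ih (by omega) hb)
    · refine ⟨fun k hk => le_trans ?_ (hb.1 k hk), hb.2⟩
      unfold bump
      split_ifs <;> omega
    · refine ⟨fun k hk => le_trans ?_ (hb.1 k hk), hb.2⟩
      unfold bump
      split_ifs <;> omega
    · simp only [bump, unit]
      split_ifs <;> simp

/-- The number whose last three digits are `v 0`, `v 1`, `v 2`. -/
def number (N : ℕ) (v : Fin 3 → ℕ) : ℕ := v 0 + v 1 * N + v 2 * N ^ 2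

theorem number_lt {v : Fin 3 → ℕ} (hv : ∀ σ, v σ < N) : number N v < N ^ 3 := by
  have h0 := hv 0
  have h1 : (v 1 + 1) * N ≤ N * N := Nat.mul_le_mul_right _ (hv 1)
  have h2 : (v 2 + 1) * N ^ 2 ≤ N * N ^ 2 := Nat.mul_le_mul_right _ (hv 2)
  unfold number
  nlinarith

theorem number_digit {v : Fin 3 → ℕ} (hv : ∀ σ, v σ < N) (σ : Fin 3) :
    number N v / N ^ σ.val % N = v σ := by
  have hN : 0 < N := (Nat.zero_le _).trans_lt (hv 0)
  have e1 : number N v = v 0 + N * (v 1 + N * v 2) := by unfold number; ring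
  have e2 : number N v / N = v 1 + N * v 2 := by
    rw [e1, Nat.add_mul_div_left _ _ hN, Nat.div_eq_of_lt (hv 0), zero_add]
  fin_cases σ
  · simp [e1, Nat.mod_eq_of_lt (hv 0)]
  · simp [e2, Nat.mod_eq_of_lt (hv 1)]
  · simp only [Fin.reduceFinMk]
    rw [sq, ← Nat.div_div_eq_div_mul, e2, Nat.add_mul_div_left _ _ hN, Nat.div_eq_of_lt (hv 1),
      zero_add, Nat.mod_eq_of_lt (hv 2)]

theorem phase_add_div_mod (r : ℕ) {u : ℕ} (hu : u < S.len) :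
    (r * S.len + u) / S.len = r ∧ (r * S.len + u) % S.len = u := by
  rw [mul_comm, Nat.mul_add_div S.len_pos, Nat.mul_add_mod, Nat.div_eq_of_lt hu,
    Nat.mod_eq_of_lt hu]
  simp

theorem phase_add_lt {r u : ℕ} (hr : r < S.R) (hu : u < S.len) : r * S.len + u < S.phases :=
  (state_lt hr hu).trans (Nat.lt_succ_self _)

theorem reach_check {r i : ℕ} {h : ℕ → ℕ} {z : ℕ} (hr : r < S.R) (hi : i < S.I N) (hN : 0 < N)
    (hh : ∀ j < S.d, h j < N ^ S.K) (hT : S.Check N T r h) (hb : S.Bounded B h (z + S.sum h)) :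
    ∃ m < S.I N, S.Reach N T B (r * S.len * S.I N + i, S.cfg h z)
      ((r + 1) * S.len * S.I N + m, S.cfg h (z + S.sum h)) := by
  set v : Fin 3 → ℕ := fun σ => vertex N h (S.tri r σ) with hv
  have hvN : ∀ σ, v σ < N := fun σ => Nat.mod_lt _ hN
  set m := number N v with hm
  have hm3 : m < N ^ 3 := number_lt hvN
  have hmI : m < S.I N := by
    simpa using index_lt (S := S) hm3 (g := 0) (by positivity)
  have hbz : ∀ z' ≤ z + S.sum h, S.Bounded B h z' := fun z' hz' => ⟨hb.1, hz'.trans hb.2⟩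
  have hlen : S.len = 2 * S.d + 1 := rfl
  have hd := S.d_pos
  refine ⟨m, hmI, ?_⟩
  have key : ∀ n ≤ S.d, S.Reach N T B (r * S.len * S.I N + i, S.cfg h z)
      ((r * S.len + (2 * n + 1)) * S.I N + m,
        S.cfg h (z + ∑ k ∈ Finset.range n, h k)) := by
    intro n
    induction n with
    | zero =>
      intro _
      have e := phase_add_div_mod (S := S) r (u := 0) S.len_pos
      have hlt := phase_add_lt hr S.len_pos
      rw [add_zero] at e hlt
      refine (reach_guess hlt e.2 hi hmI (hbz z (by omega))).trans ?_
      simp only [Finset.range_zero, Finset.sum_empty, add_zero]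
      refine reach_switch hlt hmI ?_ (hbz z (by omega))
      unfold SwitchOK
      rw [e.2, if_pos rfl, e.1]
      refine ⟨hr, hm3, ?_⟩
      rw [Nat.mod_eq_of_lt hm3]
      exact hT
    | succ n ih =>
      intro hn
      refine (ih (by omega)).trans ?_
      have hsum : z + ∑ k ∈ Finset.range (n + 1), h k ≤ z + S.sum h := by
        refine Nat.add_le_add_left ?_ _
        exact Finset.sum_le_sum_of_subset (Finset.range_subset_range.2 hn)
      rw [Finset.sum_range_succ, ← add_assoc z] at hsum ⊢
      set z1 := z + ∑ k ∈ Finset.range n, h k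
      -- The honest run empties counter `n` completely: `c0` is the valuation between the reading
      -- and the restoring phase.
      set c0 : ℕ → ℕ := Function.update h n 0 with hc0
      have hbump : bump c0 n (h n) = h := by
        funext k
        simp only [bump, hc0, Function.update_apply]
        split_ifs with hk
        · rw [hk, zero_add]
        · rfl
      have hbump0 : bump c0 n (h n - h n) = c0 := by rw [Nat.sub_self, bump_zero]
      have e1 := phase_add_div_mod (S := S) r (u := 2 * n + 1) (by omega)
      have e2 := phase_add_div_mod (S := S) r (u := 2 * n + 2) (by omega)
      have l1 := phase_add_lt hr (by omega : 2 * n + 1 < S.len)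
      have l2 := phase_add_lt hr (by omega : 2 * n + 2 < S.len)
      have hidx := index_lt (S := S) hm3 (hh n (by omega))
      have hbc0 : S.Bounded B c0 (z1 + h n) := by
        refine ⟨fun k hk => ?_, hsum.trans hb.2⟩
        simp only [hc0, Function.update_apply]
        split_ifs
        · exact Nat.zero_le _
        · exact hb.1 k hk
      have s1 := reach_down (T := T) (B := B) (z := z1) (c := c0) l1 e1.2 hm3
        (hh n (by omega)) (by rw [hbump]; exact hbz _ hsum) (h n) le_rfl
      rw [hbump, hbump0] at s1
      have s2 : S.Reach N T B
          ((r * S.len + (2 * n + 1)) * S.I N + (m + N ^ 3 * h n), S.cfg c0 (z1 + h n))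
          ((r * S.len + (2 * n + 2)) * S.I N + (m + N ^ 3 * h n), S.cfg c0 (z1 + h n)) := by
        refine reach_switch l1 hidx ?_ hbc0
        unfold SwitchOK
        rw [if_neg (by omega), if_pos (by omega), e1.1, e1.2,
          show (2 * n + 1 - 1) / 2 = n by omega]
        intro σ hσ
        rw [← digit_mod, Nat.add_mul_mod_self_left, Nat.mod_eq_of_lt hm3, hm, number_digit hvN,
          pow_add, ← Nat.div_div_eq_div_mul, Nat.add_mul_div_left _ _ (by positivity),
          ← hm, Nat.div_eq_of_lt hm3, zero_add]
        simp only [hv, vertex, hσ]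
      have s3 := reach_up (T := T) (B := B) (z := z1 + h n) (c := c0) l2 e2.2
        hm3 (h n) (hh n (by omega)) (by rw [hbump]; exact hbz _ hsum)
      rw [hbump] at s3
      have s4 : S.Reach N T B
          ((r * S.len + (2 * n + 2)) * S.I N + m, S.cfg h (z1 + h n))
          ((r * S.len + (2 * (n + 1) + 1)) * S.I N + m, S.cfg h (z1 + h n)) := by
        refine reach_switch l2 hmI ?_ (hbz _ hsum)
        unfold SwitchOK
        rw [if_neg (by omega), if_neg (by omega)]
        exact hm3
      exact ((s1.trans s2).trans s3).trans s4
  have h := key S.d le_rfl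
  rwa [← hlen, ← Nat.succ_mul] at h

theorem reach_load {h : ℕ → ℕ} (hh : S.Bounded B h 0) :
    S.Reach N T B (0, S.cfg (fun _ => 0) 0) (0, S.cfg h 0) := by
  have key : ∀ n ≤ S.d, S.Reach N T B (0, S.cfg (fun _ => 0) 0)
      (0, S.cfg (fun k => if k < n then h k else 0) 0) := by
    intro n
    induction n with
    | zero => intro _; simp only [Nat.not_lt_zero, if_false]; exact Relation.ReflTransGen.refl
    | succ n ih =>
      intro hn
      refine (ih (by omega)).trans ?_
      have key2 : ∀ a ≤ h n, S.Reach N T B (0, S.cfg (fun k => if k < n then h k else 0) 0)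
          (0, S.cfg (fun k => if k < n then h k else if k = n then a else 0) 0) := by
        have hbd : ∀ a ≤ h n, S.Bounded B
            (fun k => if k < n then h k else if k = n then a else 0) 0 := by
          intro a ha
          refine ⟨fun k hk => ?_, Nat.zero_le _⟩
          have := hh.1 k hk
          dsimp only
          split_ifs with h1 h2
          · exact this
          · subst h2; omega
          · exact Nat.zero_le _
        intro a
        induction a with
        | zero => intro _; simp only [ite_self]; exact Relation.ReflTransGen.refl
        | succ a iha =>
          intro ha
          refine (iha (by omega)).trans ?_
          refine reach_step (mem_consts_of (Or.inl ⟨n, hn, rfl⟩)) (hbd a (by omega))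
            (hbd _ ha) (fun k _ => ?_) (by simp)
          simp only [unit]
          split_ifs <;> omega
      have h2 := key2 (h n) le_rfl
      have he : (fun k => if k < n then h k else if k = n then h n else 0) =
          fun k => if k < n + 1 then h k else 0 := by
        funext k
        rcases lt_trichotomy k n with h1 | rfl | h1
        · rw [if_pos h1, if_pos (by omega)]
        · rw [if_neg (lt_irrefl _), if_pos rfl, if_pos (by omega)]
        · rw [if_neg (by omega), if_neg (by omega), if_neg (by omega)]
      rwa [he] at h2
  have h1 := key S.d le_rfl
  rwa [S.cfg_congr (c' := h) 0 (fun j hj => if_pos hj)] at h1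

/-- One round through the chain takes one unit from a nonzero counter and `R` units from the
accumulator, so the relation between accumulator and sum persists until both vanish. -/
theorem reach_unload (s : ℕ) {c : ℕ → ℕ} (hs : S.sum c = s) (hb : S.Bounded B c (S.R * s)) :
    S.Reach N T B (S.R * S.len * S.I N, S.cfg c (S.R * s))
      (S.R * S.len * S.I N, S.cfg (fun _ => 0) 0) := by
  induction s generalizing c with
  | zero =>
    rw [mul_zero, S.cfg_congr (c := c) (c' := fun _ => 0) 0]
    · exact Relation.ReflTransGen.refl
    · intro j hj
      exact Finset.sum_eq_zero_iff.1 hs j (Finset.mem_range.2 hj)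
  | succ s ih =>
    obtain ⟨j, hj, hcj⟩ : ∃ j < S.d, c j ≠ 0 := by
      by_contra hc
      push Not at hc
      have : S.sum c = 0 := Finset.sum_eq_zero fun j hj => hc j (Finset.mem_range.1 hj)
      omega
    set c' : ℕ → ℕ := Function.update c j (c j - 1) with hc'
    have hcc : c = bump c' j 1 := by
      funext k
      simp only [bump, hc', Function.update_apply]
      split_ifs with h
      · subst h; omega
      · rfl
    have hs' : S.sum c' = s := by rw [hcc, S.sum_bump c' hj] at hs; omega
    have hR := S.R_pos
    have hb' : ∀ z ≤ S.R * (s + 1), S.Bounded B c' z := by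
      intro z hz
      refine ⟨fun k hk => le_trans ?_ (hb.1 k hk), hz.trans hb.2⟩
      rw [hcc]; unfold bump; split_ifs <;> omega
    have h1 : S.Reach N T B (S.R * S.len * S.I N, S.cfg c (S.R * (s + 1)))
        (S.phases * S.I N + (2 + 0), S.cfg c' (S.R * s + (S.R - 1 - 0))) := by
      refine reach_step (mem_consts_of (Or.inr (Or.inl ⟨j, hj, rfl⟩))) hb
        (hb' _ (by rw [mul_add]; omega)) (fun k _ => ?_) ?_
      · rw [hcc]
        simp only [bump, unit, Pi.neg_apply]
        split_ifs <;> push_cast <;> ring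
      · rw [mul_add, mul_one]; omega
    have h2 : ∀ t < S.R, S.Reach N T B (S.phases * S.I N + (2 + 0),
        S.cfg c' (S.R * s + (S.R - 1 - 0)))
        (S.phases * S.I N + (2 + t), S.cfg c' (S.R * s + (S.R - 1 - t))) := by
      intro t
      induction t with
      | zero => intro _; exact Relation.ReflTransGen.refl
      | succ t iht =>
        intro ht
        refine (iht (by omega)).trans ?_
        have hmem := mem_consts_of (S := S) (N := N) (T := T)
          (Or.inr (Or.inr ⟨t, by omega, rfl⟩))
        rw [if_pos ht, if_pos ht] at hmem
        refine reach_step hmem (hb' _ (by rw [mul_add]; omega)) (hb' _ (by rw [mul_add]; omega))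
          (by simp) (by omega)
    have h3 : S.Reach N T B (S.phases * S.I N + (2 + (S.R - 1)),
        S.cfg c' (S.R * s + (S.R - 1 - (S.R - 1)))) (S.R * S.len * S.I N, S.cfg c' (S.R * s)) := by
      have hmem := mem_consts_of (S := S) (N := N) (T := T)
        (Or.inr (Or.inr ⟨S.R - 1, by omega, rfl⟩))
      rw [if_neg (by omega), if_neg (by omega)] at hmem
      exact reach_step hmem (hb' _ (by rw [mul_add]; omega)) (hb' _ (by rw [mul_add]; omega))
          (by simp) (by omega)
    exact ((h1.trans (h2 _ (by omega))).trans h3).trans (ih hs' (hb' _ (by rw [mul_add]; omega)))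

/-- The accumulator takes the value `r * sum h` after `r` checks, hence never exceeds `R * (d * N ^
K)`; this also dominates the working counters. -/
theorem completeness {h : ℕ → ℕ} (hN : 0 < N) (hh : ∀ j < S.d, h j < N ^ S.K)
    (hT : ∀ r < S.R, S.Check N T r h) (hB : S.R * (S.d * N ^ S.K) ≤ B) :
    Relation.ReflTransGen ((S.toListVASS N T).Step B) (0, fun _ => 0)
      (S.R * S.len * S.I N, fun _ => 0) := by
  have hzero : S.cfg (fun _ => 0) 0 = fun _ => 0 := by funext i; simp [cfg]
  have hsum : S.sum h ≤ S.d * N ^ S.K := by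
    refine (Finset.sum_le_sum fun j hj => (hh j (Finset.mem_range.1 hj)).le).trans ?_
    simp
  have hR := S.R_pos
  have hI := S.I_pos hN
  have hbd : ∀ r ≤ S.R, S.Bounded B h (r * S.sum h) := by
    intro r hr
    refine ⟨fun j hj => ?_, ?_⟩
    · refine (hh j hj).le.trans (le_trans ?_ hB)
      rw [← mul_assoc]
      exact Nat.le_mul_of_pos_left _ (Nat.mul_pos hR S.d_pos)
    · exact (Nat.mul_le_mul hr hsum).trans hB
  have h1 := reach_load (N := N) (T := T) (by simpa using hbd 0 (Nat.zero_le _))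
  have h2 : ∀ r ≤ S.R, ∃ i < S.I N, S.Reach N T B (0, S.cfg h 0)
      (r * S.len * S.I N + i, S.cfg h (r * S.sum h)) := by
    intro r
    induction r with
    | zero => intro _; exact ⟨0, hI, by simp only [zero_mul]; exact Relation.ReflTransGen.refl⟩
    | succ r ih =>
      intro hr
      obtain ⟨i, hi, hreach⟩ := ih (by omega)
      have hb := hbd (r + 1) hr
      rw [add_mul, one_mul] at hb
      obtain ⟨m, hm, hstep⟩ := reach_check hr hi hN hh (hT r hr) hb
      rw [← add_one_mul r] at hstep
      exact ⟨m, hm, hreach.trans hstep⟩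
  obtain ⟨i, hi, h2⟩ := h2 S.R le_rfl
  have h3 := reach_guess (T := T) (Nat.lt_succ_self _ : S.R * S.len < S.phases) last_phase.2 hi hI
    (hbd S.R le_rfl)
  have h4 := reach_unload (N := N) (T := T) (S.sum h) rfl (hbd S.R le_rfl)
  have := ((h1.trans h2).trans h3).trans h4
  rwa [hzero] at this

end Completeness

end Shape

/-! ### Hypergraphs -/

namespace Hypergraph

variable {n : ℕ} (H : Hypergraph (Fin n))

theorem length_encode3 : H.encode3.length = n ^ 3 + 1 := by
  unfold encode3
  rw [List.length_cons, List.length_flatMap_const _ _ (n * n)]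
  · simp only [List.length_finRange]; ring
  · intro i
    rw [List.length_flatMap_const _ _ n]
    · simp
    · simp

open Classical in
theorem encode3_getD (a b c : Fin n) :
    H.encode3.getD (1 + (c.val + b.val * n + a.val * n ^ 2)) 0 =
      if ({a, b, c} : Set (Fin n)) ∈ H.edgeSet then 1 else 0 := by
  unfold encode3
  have hbc : b.val * n + c.val < n * n := by nlinarith [b.isLt, c.isLt]
  rw [show 1 + (c.val + b.val * n + a.val * n ^ 2) = (a.val * (n * n) + (b.val * n + c.val)) + 1 by
    ring, List.getD_cons_succ, List.getD_flatMap_const _ _ (n * n) _ 0 (by simp) hbc,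
    List.getD_flatMap_const _ _ n _ 0 (by simp) c.isLt]
  · simp
  · simp
  · intro i
    rw [List.length_flatMap_const _ _ n]
    · simp
    · simp

theorem encode3_getD_le_one (x : ℕ) (hx : 1 ≤ x) : H.encode3.getD x 0 ≤ 1 := by
  by_cases h : x < H.encode3.length
  · rw [List.getD_eq_getElem _ _ h]
    obtain ⟨y, rfl⟩ := Nat.exists_eq_add_of_le' hx
    unfold encode3 at h ⊢
    rw [List.getElem_cons_succ]
    have := List.getElem_mem (Nat.lt_of_succ_lt_succ h)
    rw [List.mem_flatMap] at this
    obtain ⟨i, -, hi⟩ := this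
    rw [List.mem_flatMap] at hi
    obtain ⟨j, -, hj⟩ := hi
    obtain ⟨l, -, hl⟩ := List.mem_map.1 hj
    rw [← hl]
    split_ifs <;> omega
  · rw [List.getD_eq_default _ _ (by omega)]
    omega

theorem genInput_encode3 : GenInput n H.encode3 where
  zero := rfl
  length := H.length_encode3
  le_one := H.encode3_getD_le_one

/-- The entry `m` of the adjacency tensor. -/
noncomputable def tensor (m : ℕ) : ℕ := H.encode3.getD (1 + m) 0

theorem tensor_eq_one_iff (a b c : Fin n) :
    H.tensor (c.val + b.val * n + a.val * n ^ 2) = 1 ↔ ({a, b, c} : Set (Fin n)) ∈ H.edgeSet := by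
  classical
  unfold tensor
  rw [encode3_getD]
  split_ifs with h <;> simp [h]

end Hypergraph

/-! ### Hypercliques as valuations that pass all checks -/

theorem exists_digits {N : ℕ} (K : ℕ) (f : ℕ → ℕ) (hf : ∀ a < K, f a < N) :
    ∃ x < N ^ K, ∀ a < K, x / N ^ a % N = f a := by
  induction K generalizing f with
  | zero => exact ⟨0, by simp, by simp⟩
  | succ K ih =>
    obtain ⟨y, hy, hd⟩ := ih (fun a => f (a + 1)) fun a ha => hf _ (by omega)
    have h0 := hf 0 (by omega)
    have hN : 0 < N := by omega
    have hdiv : (f 0 + N * y) / N = y := by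
      rw [Nat.add_mul_div_left _ _ hN, Nat.div_eq_of_lt h0, zero_add]
    refine ⟨f 0 + N * y, ?_, fun a ha => ?_⟩
    · have : N * (y + 1) ≤ N * N ^ K := Nat.mul_le_mul_left _ hy
      rw [pow_succ']
      nlinarith
    · cases a with
      | zero => rw [pow_zero, Nat.div_one, Nat.add_mul_mod_self_left, Nat.mod_eq_of_lt h0]
      | succ a =>
        rw [pow_succ', ← Nat.div_div_eq_div_mul, hdiv]
        exact hd a (by omega)

theorem exists_embedding_three {α : Type*} {p q s : α} (hpq : p ≠ q) (hps : p ≠ s) (hqs : q ≠ s) :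
    ∃ e : Fin 3 ↪ α, e 0 = p ∧ e 1 = q ∧ e 2 = s := by
  refine ⟨⟨![p, q, s], ?_⟩, rfl, rfl, rfl⟩
  intro i j hij
  fin_cases i <;> fin_cases j <;> first
    | rfl
    | exact absurd hij hpq
    | exact absurd hij hps
    | exact absurd hij hqs
    | exact absurd hij.symm hpq
    | exact absurd hij.symm hps
    | exact absurd hij.symm hqs

theorem exists_ne_ne {α : Type*} [Fintype α] [DecidableEq α] (h : 3 ≤ Fintype.card α) (p q : α) :
    ∃ s, p ≠ s ∧ q ≠ s := by
  obtain ⟨s, hs⟩ : ∃ s, s ∉ ({p, q} : Finset α) := by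
    by_contra hc
    push Not at hc
    have h1 : Fintype.card α ≤ ({p, q} : Finset α).card :=
      Finset.card_le_card fun x _ => hc x
    have := Finset.card_le_two (a := p) (b := q)
    omega
  simp only [Finset.mem_insert, Finset.mem_singleton, not_or] at hs
  exact ⟨s, Ne.symm hs.1, Ne.symm hs.2⟩

namespace Shape

/-- All triples of different vertices, for `d` counters with `K` vertices each. -/
noncomputable def ofTriples (d K pad : ℕ) (hd : 0 < d) (hdK : 3 ≤ d * K) : Shape where
  d := d
  K := K
  R := Fintype.card (Fin 3 ↪ Fin d × Fin K)
  tri r σ :=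
    if h : r < Fintype.card (Fin 3 ↪ Fin d × Fin K) then
      (((Fintype.equivFin _).symm ⟨r, h⟩ σ).1.val, ((Fintype.equivFin _).symm ⟨r, h⟩ σ).2.val)
    else (0, 0)
  pad := pad
  d_pos := hd
  R_pos := by
    rw [Fintype.card_pos_iff, Function.Embedding.nonempty_iff_card_le]
    simpa using hdK
  tri_lt r hr σ := by
    rw [dif_pos hr]
    exact ⟨Fin.isLt _, Fin.isLt _⟩

variable {d K pad : ℕ} {hd : 0 < d} {hdK : 3 ≤ d * K}

theorem ofTriples_tri (e : Fin 3 ↪ Fin d × Fin K) :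
    (ofTriples d K pad hd hdK).tri (Fintype.equivFin _ e).val =
      fun σ => ((e σ).1.val, (e σ).2.val) := by
  funext σ
  refine (dif_pos (Fin.isLt _)).trans ?_
  rw [Fin.eta, Equiv.symm_apply_apply]

theorem forall_tri_iff (Q : (Fin 3 → ℕ × ℕ) → Prop) :
    (∀ r < (ofTriples d K pad hd hdK).R, Q ((ofTriples d K pad hd hdK).tri r)) ↔
      ∀ e : Fin 3 ↪ Fin d × Fin K, Q fun σ => ((e σ).1.val, (e σ).2.val) := by
  constructor
  · intro h e
    have := h (Fintype.equivFin _ e).val (Fintype.equivFin _ e).isLt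
    rwa [ofTriples_tri] at this
  · intro h r hr
    have h1 := h ((Fintype.equivFin _).symm ⟨r, hr⟩)
    rw [← ofTriples_tri (pad := pad) (hd := hd) (hdK := hdK), Equiv.apply_symm_apply] at h1
    exact h1

/-- The checks range over all ordered triples of different positions. The lowest digit of a tensor
number is the last index in lexicographic order, which explains the reversed triples. The converse
direction also provides the bound `N ^ K` on the counters, needed for the honest run. -/
theorem exists_checks_iff {N : ℕ} (hN : 0 < N) (H : Hypergraph (Fin N))
    (hV : H.vertexSet = Set.univ) (hU : H.IsUniform 3) :
    ((∃ h, ∀ r < (ofTriples d K pad hd hdK).R, (ofTriples d K pad hd hdK).Check N H.tensor r h) →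
      H.HasHyperclique 3 (d * K)) ∧
    (H.HasHyperclique 3 (d * K) → ∃ h : ℕ → ℕ, (∀ j < d, h j < N ^ K) ∧
      ∀ r < (ofTriples d K pad hd hdK).R, (ofTriples d K pad hd hdK).Check N H.tensor r h) := by
  have hcheck : ∀ (h : ℕ → ℕ) (v : Fin d × Fin K → Fin N),
      (∀ p, (v p).val = vertex N h (p.1.val, p.2.val)) →
      ((∀ r < (ofTriples d K pad hd hdK).R, (ofTriples d K pad hd hdK).Check N H.tensor r h) ↔
        ∀ e : Fin 3 ↪ Fin d × Fin K, ({v (e 2), v (e 1), v (e 0)} : Set (Fin N)) ∈ H.edgeSet) := by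
    intro h v hv
    refine (forall_tri_iff (fun t => H.tensor (vertex N h (t 0) + vertex N h (t 1) * N +
      vertex N h (t 2) * N ^ 2) = 1)).trans (forall_congr' fun e => ?_)
    rw [← hv, ← hv, ← hv]
    exact H.tensor_eq_one_iff _ _ _
  have hcard : Fintype.card (Fin d × Fin K) = d * K := by simp
  constructor
  · rintro ⟨h, hh⟩
    set v : Fin d × Fin K → Fin N := fun p => ⟨vertex N h (p.1.val, p.2.val), Nat.mod_lt _ hN⟩
    rw [hcheck h v fun _ => rfl] at hh
    -- Two positions with the same vertex, together with a third position, would give a hyperedge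
    -- with at most two elements, contrary to uniformity.
    have hinj : Function.Injective v := by
      intro p q hpq
      by_contra hne
      obtain ⟨s, hps, hqs⟩ := exists_ne_ne (by rw [hcard]; exact hdK) p q
      obtain ⟨e, rfl, rfl, rfl⟩ := exists_embedding_three hne hps hqs
      have h3 := (hU _ (hh e)).2
      rw [hpq, Set.pair_eq_singleton] at h3
      have := Set.ncard_insert_le (v (e 2)) {v (e 1)}
      rw [Set.ncard_singleton] at this
      omega
    refine ⟨Finset.univ.map ⟨v, hinj⟩, by rw [hV]; exact Set.subset_univ _, by simp, ?_⟩
    intro e he hcard3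
    obtain ⟨x, y, z, hxy, hxz, hyz, rfl⟩ := Finset.card_eq_three.1 hcard3
    have hex : ∀ w ∈ ({x, y, z} : Finset (Fin N)), ∃ p, v p = w := by
      intro w hw
      simpa using he hw
    obtain ⟨p, rfl⟩ := hex x (by simp)
    obtain ⟨q, rfl⟩ := hex y (by simp)
    obtain ⟨s, rfl⟩ := hex z (by simp)
    have hpq : p ≠ q := fun h => hxy (by rw [h])
    have hps : p ≠ s := fun h => hxz (by rw [h])
    have hqs : q ≠ s := fun h => hyz (by rw [h])
    obtain ⟨e, rfl, rfl, rfl⟩ := exists_embedding_three hqs.symm hps.symm hpq.symm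
    simpa using hh e
  · rintro ⟨C, -, hC, hedge⟩
    have hCc : Fintype.card (Fin d × Fin K) = Fintype.card C := by simp [hC]
    set w := Fintype.equivOfCardEq hCc
    have hdig : ∀ j : ℕ, ∃ x : ℕ, ∀ hj : j < d, x < N ^ K ∧
        ∀ a : Fin K, x / N ^ a.val % N = (w (⟨j, hj⟩, a)).val.val := by
      intro j
      by_cases hj : j < d
      · obtain ⟨x, hx, hxd⟩ := exists_digits (N := N) K
          (fun a => if ha : a < K then (w (⟨j, hj⟩, ⟨a, ha⟩)).val.val else 0) (by
            intro a ha
            rw [dif_pos ha]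
            exact Fin.isLt _)
        refine ⟨x, fun _ => ⟨hx, fun a => ?_⟩⟩
        rw [hxd a.val a.isLt, dif_pos a.isLt]
      · exact ⟨0, fun h => absurd h hj⟩
    choose h hh using hdig
    refine ⟨h, fun j hj => (hh j hj).1, ?_⟩
    rw [hcheck h (fun p => (w p).val) (fun p => ((hh p.1.val p.1.isLt).2 p.2).symm)]
    intro e
    have hinj : ∀ i j, i ≠ j → (w (e i)).val ≠ (w (e j)).val := fun i j hij he =>
      hij (e.injective (w.injective (Subtype.ext he)))
    have := hedge {(w (e 2)).val, (w (e 1)).val, (w (e 0)).val} (by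
      intro x hx
      simp only [Finset.mem_insert, Finset.mem_singleton] at hx
      rcases hx with rfl | rfl | rfl <;> exact Subtype.property _)
      (Finset.card_eq_three.2 ⟨_, _, _, hinj 2 1 (by decide), hinj 2 0 (by decide),
        hinj 1 0 (by decide), rfl⟩)
    simpa using this

end Shape

/-! ### The reduction on encoded instances -/

namespace Shape

variable (S : Shape)

/-- The number of the target state; for the empty hypergraph it is an unreachable state. -/
def target (N : ℕ) : ℕ := if 0 < S.I N then S.R * S.len * S.I N else S.phases * S.I N + 1

theorem target_lt (N : ℕ) : S.target N < S.numStates N := by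
  have hle : S.R * S.len * S.I N ≤ S.phases * S.I N := Nat.mul_le_mul_right _ (Nat.le_succ _)
  unfold target numStates
  split_ifs <;> omega

def targetE : Expr :=
  ite (lt (lit 0) (var 3)) (stateE (S.R * S.len) (lit 0)) (stateE S.phases (lit 1))

theorem eval_targetE (N : ℕ) : S.targetE.eval (env N 0 (S.I N) 0) = S.target N := by
  have h : (lt (lit 0) (var 3)).eval (env N 0 (S.I N) 0) = if 0 < S.I N then 1 else 0 :=
    eval_lt_expr _ _ _
  unfold targetE target
  rw [eval_ite _ _ _ _ h, eval_stateE, eval_stateE]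
  rfl

/-- The instance of the reachability problem that belongs to a hypergraph. -/
def inst (B : ℕ → ℕ) (N : ℕ) (T : ℕ → ℕ) : BoundedReachInstance (S.d + 2) B :=
  (S.toListVASS N T).inst B ⟨0, (S.toListVASS N T).pos⟩ ⟨S.target N, S.target_lt N⟩

/-- The transitions in `consts` occur once rather than once per index, so they are part of the
header. -/
def headerE : List Expr :=
  [bin .add (bin .add (bin .add (bin .mul (lit S.phases) (var 3)) (lit 2)) (lit S.R))
      (bin .mul (lit S.pad) (var 3)),
    bin .add (lit S.consts.length) (bin .mul (var 3) (lit S.body.length))] ++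
    (lit 0 :: List.replicate (S.d + 2) (lit 0)) ++
    (S.targetE :: List.replicate (S.d + 2) (lit 0)) ++ S.consts.flatMap TransExpr.words

def bodyE : List Expr := S.body.flatMap TransExpr.words

theorem length_trans (N : ℕ) (T : ℕ → ℕ) :
    (S.trans N T).length = S.consts.length + S.I N * S.body.length := by
  rw [trans, List.length_append, List.length_flatMap_range _ S.body.length]
  · simp
  · simp

theorem map_flatMap_words {D : ℕ} (ρ : Fin 5 → ℕ) (l : List (TransExpr D)) :
    (l.flatMap TransExpr.words).map (Expr.eval ρ) =
      (l.map (TransExpr.eval ρ)).flatMap ListVASS.transWords := by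
  rw [List.map_flatMap, List.flatMap_map]
  exact List.flatMap_congr fun t _ => t.map_words ρ

theorem genOutput_eq (B : ℕ → ℕ) (N : ℕ) (inp : List ℕ) :
    genOutput (S.K + 3) S.headerE S.bodyE N inp =
      (S.inst B N fun m => inp.getD (1 + m) 0).encode := by
  rw [inst, ListVASS.encode_inst]
  have hI : N ^ (S.K + 3) = S.I N := rfl
  have htr : (S.toListVASS N fun m => inp.getD (1 + m) 0).trans =
    S.trans N fun m => inp.getD (1 + m) 0 := rfl
  have hst : (S.toListVASS N fun m => inp.getD (1 + m) 0).states = S.numStates N := rfl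
  simp only [genOutput, headerE, bodyE, List.map_append, List.map_cons, List.map_nil,
    List.map_replicate, map_flatMap_words, hI, htr, hst, length_trans, eval_targetE, eval_add,
    eval_mul, eval_lit, eval_var, env_apply_three]
  simp only [trans, List.flatMap_append, List.flatMap_assoc, List.append_assoc, numStates]

theorem size_inst (B : ℕ → ℕ) (N : ℕ) (T : ℕ → ℕ) : (S.inst B N T).vass.unarySize =
    (S.phases + S.pad + S.body.length) * S.I N + (2 + S.R + S.consts.length) := by
  refine (S.toListVASS N T).unarySize_toVASS.trans ?_
  have : (S.toListVASS N T).size = S.numStates N + (S.trans N T).length := rfl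
  rw [this, length_trans, numStates]
  ring

/-- Without vertices all blocks of states are empty. The remaining transitions lead only to state 0
and to chain states, which are numbered from 2 on, so the target 1 is never entered. -/
theorem not_reach_of_I_eq_zero {N : ℕ} (T : ℕ → ℕ) (B : ℕ) (h : S.I N = 0) :
    ¬ Relation.ReflTransGen ((S.toListVASS N T).Step B) (0, fun _ => 0)
      (S.target N, fun _ => 0) := by
  intro hr
  have key : ∀ b, Relation.ReflTransGen ((S.toListVASS N T).Step B) (0, fun _ => 0) b →
      b.1 ≠ 1 := by
    intro b hb
    induction hb with
    | refl => simp
    | tail _ hs _ =>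
      obtain ⟨-, -, x, hx, -⟩ := hs
      rcases (S.mem_trans_iff N T _).1 hx with hx | ⟨i, hi, -⟩
      · rcases (S.mem_consts_iff N _).1 hx with ⟨j, hj, he⟩ | ⟨j, hj, he⟩ | ⟨k, hk, he⟩ <;>
          simp only [Prod.mk.injEq, h, mul_zero] at he <;> obtain ⟨-, -, he⟩ := he
        · omega
        · omega
        · split_ifs at he <;> omega
      · omega
  refine key _ hr ?_
  simp [target, h]

theorem yes_iff {d K pad : ℕ} (hd : 0 < d) (hdK : 3 ≤ d * K) {N : ℕ} (H : Hypergraph (Fin N))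
    (hV : H.vertexSet = Set.univ) (hU : H.IsUniform 3) (B : ℕ → ℕ)
    (hB : ∀ T, (ofTriples d K pad hd hdK).R * (d * N ^ K) ≤
      B ((ofTriples d K pad hd hdK).inst B N T).vass.unarySize) :
    (boundedReachability (d + 2) B).Yes ((ofTriples d K pad hd hdK).inst B N H.tensor) ↔
      H.HasHyperclique 3 (d * K) := by
  set S := ofTriples d K pad hd hdK with hS
  refine (ListVASS.reach_iff _ _ _ _ _ _).trans ?_
  rcases Nat.eq_zero_or_pos N with rfl | hN
  · refine iff_of_false (S.not_reach_of_I_eq_zero _ _ (by simp [I])) ?_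
    rintro ⟨C, -, hC, -⟩
    have : C.card ≤ Fintype.card (Fin 0) := Finset.card_le_univ C
    rw [Fintype.card_fin] at this
    omega
  · have ht : S.target N = S.R * S.len * S.I N := if_pos (S.I_pos hN)
    obtain ⟨h1, h2⟩ := exists_checks_iff (d := d) (K := K) (pad := pad) (hd := hd) (hdK := hdK)
      hN H hV hU
    dsimp only
    rw [ht]
    constructor
    · intro h
      exact h1 (soundness hN h)
    · intro h
      obtain ⟨v, hv, hc⟩ := h2 h
      exact completeness hN hv hc (hB _)

end Shape

/-! ### Word lengths, running times and the conclusion -/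

/-- The VASS has size `a * N ^ q + b`, polynomial in `N`, so words of logarithmic length for it are
still of length `O(log N)`. -/
theorem log_size_le (N q a b : ℕ) :
    Nat.log 2 (a * N ^ q + b) + 1 ≤ (a + b + q + 1) * (Nat.log 2 N + 1) := by
  set W := 2 ^ (Nat.log 2 N + 1) with hW
  have hNW : N < W := Nat.lt_pow_succ_log_self (by norm_num) N
  have hW2 : 2 ≤ W := by rw [hW, pow_succ]; have := Nat.one_le_two_pow (n := Nat.log 2 N); omega
  have ha : a < W ^ a := Nat.lt_pow_self hW2
  have hb : b < W ^ b := Nat.lt_pow_self hW2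
  have hq : N ^ q + 1 ≤ W ^ (q + 1) := by
    have h1 : N ^ q ≤ W ^ q := Nat.pow_le_pow_left hNW.le q
    have h2 : 1 ≤ W ^ q := Nat.one_le_pow _ _ (by omega)
    rw [pow_succ]
    nlinarith
  have h : a * N ^ q + b < 2 ^ ((a + b + q + 1) * (Nat.log 2 N + 1)) := by
    rw [mul_comm (a + b + q + 1), pow_mul, ← hW,
      show a + b + q + 1 = a + b + (q + 1) by ring, pow_add, pow_add]
    calc a * N ^ q + b < (a + 1) * (b + 1) * (N ^ q + 1) := by
          nlinarith [Nat.zero_le (a * b * N ^ q), Nat.zero_le (b * N ^ q), Nat.zero_le (a * b),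
            Nat.zero_le (N ^ q)]
      _ ≤ W ^ a * W ^ b * W ^ (q + 1) := Nat.mul_le_mul (Nat.mul_le_mul ha hb) hq
  exact Nat.log_lt_of_lt_pow' (by positivity) h

open Shape in
/-- A program for bounded reachability yields one for hypercliques. -/
theorem hyperclique_decidableInTime {d K pad : ℕ} (hd : 0 < d) (hdK : 3 ≤ d * K) {B T : ℕ → ℕ}
    (hB : ∀ N T, (ofTriples d K pad hd hdK).R * (d * N ^ K) ≤
      B ((ofTriples d K pad hd hdK).inst B N T).vass.unarySize)
    (h : (boundedReachability (d + 2) B).DecidableInTime T) :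
    ∃ a b k : ℕ, 0 < a ∧ (hypercliqueProblem (d * K)).DecidableInTime
      fun N => k * (N ^ (K + 3) + 1) + T (a * N ^ (K + 3) + b) := by
  obtain ⟨P, c, hP⟩ := h
  set S := ofTriples d K pad hd hdK with hS
  have hK : S.K = K := rfl
  have hbody : 1 ≤ S.bodyE.length := by
    refine List.length_pos_of_mem (a := (S.walk 0).src) ?_
    refine List.mem_flatMap.2 ⟨S.walk 0, ?_, by simp [TransExpr.words]⟩
    exact List.mem_flatMap.2 ⟨0, List.mem_range.2 (Nat.succ_pos _), by simp⟩
  obtain ⟨A, c1, k, hA⟩ := exists_generator (q := S.K + 3) (header := S.headerE) (body := S.bodyE)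
    (by omega) (by simp [headerE]) hbody
  set a := S.phases + S.pad + S.body.length
  set b := 2 + S.R + S.consts.length
  -- The three summands of the word length serve the generator, the program `P` on the larger
  -- instance, and the `N ^ 3 + 1` words of the input, whose number and values are below `(N + 1) ^
  -- 4` for `N > 0`.
  refine ⟨a, b, k, by have : 0 < S.phases := Nat.succ_pos _; omega,
    A ++ P.map (Instr.shift A.length), c1 + c * (a + b + (K + 3) + 1) + 4, ?_⟩
  rintro ⟨N, H, hV, hU⟩
  set w := (c1 + c * (a + b + (K + 3) + 1) + 4) * (Nat.log 2 N + 1) with hw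
  have hw1 : c1 * (Nat.log 2 N + 1) ≤ w := Nat.mul_le_mul_right _ (by omega)
  obtain ⟨t, ht, hrun⟩ := hA N H.encode3 H.genInput_encode3 w hw1
  rw [S.genOutput_eq B N H.encode3] at hrun
  obtain ⟨t', ht', out, hout, hyes⟩ := hP (S.inst B N H.tensor)
  have hsize : (boundedReachability (d + 2) B).size (S.inst B N H.tensor) =
    a * N ^ (K + 3) + b := S.size_inst B N H.tensor
  rw [hsize] at ht' hout
  have hw2 : c * (Nat.log 2 (a * N ^ (K + 3) + b) + 1) ≤ w := by
    refine (Nat.mul_le_mul_left c (log_size_le N (K + 3) a b)).trans ?_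
    rw [← mul_assoc]
    exact Nat.mul_le_mul_right _ (by omega)
  have hN4 : (N + 1) ^ 4 ≤ 2 ^ w := by
    have h1 : N + 1 ≤ 2 ^ (Nat.log 2 N + 1) := Nat.lt_pow_succ_log_self (by norm_num) N
    refine (Nat.pow_le_pow_left h1 4).trans ?_
    rw [← pow_mul]
    refine Nat.pow_le_pow_right (by norm_num) ?_
    rw [mul_comm]
    exact Nat.mul_le_mul_right _ (by omega)
  have hw0 : 1 < 2 ^ w := Nat.one_lt_two_pow (by
    have : 4 * 1 ≤ w := Nat.mul_le_mul (by omega) (by omega)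
    omega)
  refine ⟨t + t', Nat.add_le_add ht ht', out, ?_, ?_⟩
  · refine Outputs.comp hw2 ?_ ?_ hrun hout
    · change H.encode3.length < 2 ^ w
      rw [H.length_encode3]
      rcases Nat.eq_zero_or_pos N with rfl | hN
      · simp
      · refine lt_of_lt_of_le ?_ hN4
        nlinarith [Nat.zero_le (N ^ 4), Nat.zero_le (N ^ 3), Nat.zero_le (N ^ 2)]
    · intro x hx
      change x ∈ H.encode3 at hx
      change x < 2 ^ w
      obtain ⟨i, hi, rfl⟩ := List.mem_iff_getElem.1 hx
      rw [← List.getD_eq_getElem _ 0 hi]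
      rcases Nat.eq_zero_or_pos i with rfl | hi0
      · rw [H.genInput_encode3.zero]
        refine lt_of_lt_of_le ?_ hN4
        nlinarith [Nat.zero_le (N ^ 4), Nat.zero_le (N ^ 3), Nat.zero_le (N ^ 2)]
      · exact (H.encode3_getD_le_one i hi0).trans_lt hw0
  · have := yes_iff (pad := pad) hd hdK H hV hU B (hB N)
    rw [this] at hyes
    exact hyes

/-- The time bound for hypercliques that results from a time bound for bounded reachability. -/
theorem isBigO_reduction_time {d K a b k : ℕ} (hd : 2 ≤ d) (hK : 4 ≤ K) {ε : ℝ} (hε : 0 < ε)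
    (hε1 : ε ≤ 1) (hKε : 3 * d + 1 ≤ K * ε) (ha : 0 < a) {T : ℕ → ℕ}
    (hT : (fun n : ℕ => (T n : ℝ)) =O[atTop] fun n : ℕ => (n : ℝ) ^ ((d : ℝ) - ε)) :
    (fun N : ℕ => ((k * (N ^ (K + 3) + 1) + T (a * N ^ (K + 3) + b) : ℕ) : ℝ)) =O[atTop]
      fun N : ℕ => (N : ℝ) ^ (((d * K : ℕ) : ℝ) - 1) := by
  have hd' : (2 : ℝ) ≤ d := by exact_mod_cast hd
  have hK' : (4 : ℝ) ≤ K := by exact_mod_cast hK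
  have h1 : (fun N : ℕ => ((k * (N ^ (K + 3) + 1) : ℕ) : ℝ)) =O[atTop]
      fun N : ℕ => (N : ℝ) ^ (((d * K : ℕ) : ℝ) - 1) := by
    refine IsBigO.of_bound (2 * k) ?_
    filter_upwards [eventually_ge_atTop 1] with N hN
    have hN' : (1 : ℝ) ≤ N := by exact_mod_cast hN
    have hpow : (N : ℝ) ^ (K + 3) ≤ (N : ℝ) ^ (((d * K : ℕ) : ℝ) - 1) := by
      rw [← Real.rpow_natCast]
      refine Real.rpow_le_rpow_of_exponent_le hN' ?_
      push_cast
      -- `K + 3 ≤ d * K - 1` because `d ≥ 2` and `K ≥ 4`.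
      nlinarith
    have hone : (1 : ℝ) ≤ (N : ℝ) ^ (K + 3) := one_le_pow₀ hN'
    rw [Real.norm_natCast, Real.norm_of_nonneg (by positivity)]
    have hk := mul_le_mul_of_nonneg_left
      (by linarith : (N : ℝ) ^ (K + 3) + 1 ≤ 2 * (N : ℝ) ^ (((d * K : ℕ) : ℝ) - 1))
      (Nat.cast_nonneg (α := ℝ) k)
    push_cast at hk ⊢
    linarith
  have h2 : (fun N : ℕ => (T (a * N ^ (K + 3) + b) : ℝ)) =O[atTop]
      fun N : ℕ => (N : ℝ) ^ (((d * K : ℕ) : ℝ) - 1) := by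
    have htend : Tendsto (fun N : ℕ => a * N ^ (K + 3) + b) atTop atTop := by
      refine tendsto_atTop_mono (fun N => ?_) tendsto_id
      have : N ≤ N ^ (K + 3) := Nat.le_self_pow (by omega) N
      have h3 : N ^ (K + 3) ≤ a * N ^ (K + 3) := Nat.le_mul_of_pos_left _ ha
      simp only [id]
      omega
    refine (hT.comp_tendsto htend).trans ?_
    refine IsBigO.of_bound (((a : ℝ) + b) ^ ((d : ℝ) - ε)) ?_
    filter_upwards [eventually_ge_atTop 1] with N hN
    have hN' : (1 : ℝ) ≤ N := by exact_mod_cast hN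
    have hone : (1 : ℝ) ≤ (N : ℝ) ^ (K + 3) := one_le_pow₀ hN'
    have hb : (0 : ℝ) ≤ b := Nat.cast_nonneg b
    simp only [Function.comp_apply]
    rw [Real.norm_of_nonneg (by positivity), Real.norm_of_nonneg (by positivity)]
    calc ((a * N ^ (K + 3) + b : ℕ) : ℝ) ^ ((d : ℝ) - ε)
        ≤ (((a : ℝ) + b) * (N : ℝ) ^ (K + 3)) ^ ((d : ℝ) - ε) := by
          refine Real.rpow_le_rpow (by positivity) ?_ (by linarith)
          push_cast
          nlinarith
      _ = ((a : ℝ) + b) ^ ((d : ℝ) - ε) * (N : ℝ) ^ (((K + 3 : ℕ) : ℝ) * ((d : ℝ) - ε)) := by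
          rw [Real.mul_rpow (by positivity) (by positivity), Real.rpow_natCast_mul (by positivity)]
      _ ≤ ((a : ℝ) + b) ^ ((d : ℝ) - ε) * (N : ℝ) ^ (((d * K : ℕ) : ℝ) - 1) := by
          refine mul_le_mul_of_nonneg_left ?_ (by positivity)
          -- `(K + 3) * (d - ε) = d * K + 3 * d - K * ε - 3 * ε`, which is at most `d * K - 1`
          -- because `K * ε ≥ 3 * d + 1`.
          refine Real.rpow_le_rpow_of_exponent_le hN' ?_
          push_cast
          nlinarith
  simpa only [Nat.cast_add] using h1.add h2

theorem mainTheorem5 (hyp : HypercliqueHypothesis) (d : ℕ) (γ : ℝ) (hγ : 0 < γ) :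
    (boundedReachability (d + 2) (fun n => ⌊γ * (n : ℝ)⌋₊)).RequiresTimePow (d : ℝ) := by
  intro ε hε T hT hdec
  rcases Nat.lt_or_ge d 2 with hd | hd
  -- For `d ≤ 1` the time bound is sublinear.
  · refine not_decidableInTime_of_isLittleO _ _ T (hT.trans_isLittleO ?_) hdec
    have hd1 : (d : ℝ) ≤ 1 := by exact_mod_cast Nat.le_of_lt_succ hd
    have h : (fun x : ℝ => x ^ ((d : ℝ) - ε)) =o[atTop] fun x : ℝ => x := by
      refine (isLittleO_iff_tendsto' ?_).2 ?_
      · filter_upwards [eventually_gt_atTop 0] with x hx h0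
        exact absurd h0 hx.ne'
      · refine (tendsto_rpow_neg_atTop (y := 1 - ((d : ℝ) - ε)) (by linarith)).congr' ?_
        filter_upwards [eventually_gt_atTop 0] with x hx
        rw [neg_sub, Real.rpow_sub_one hx.ne']
    exact h.comp_tendsto tendsto_natCast_atTop_atTop
  -- A smaller saving only weakens the assumption; `δ ≤ 1` keeps the exponent `d - δ` nonnegative.
  · set δ := min ε 1 with hδ
    have hδ0 : 0 < δ := lt_min hε one_pos
    have hT' : (fun n : ℕ => (T n : ℝ)) =O[atTop] fun n : ℕ => (n : ℝ) ^ ((d : ℝ) - δ) := by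
      refine hT.trans (IsBigO.of_bound 1 ?_)
      filter_upwards [eventually_ge_atTop 1] with n hn
      have hn' : (1 : ℝ) ≤ n := by exact_mod_cast hn
      rw [Real.norm_of_nonneg (by positivity), Real.norm_of_nonneg (by positivity), one_mul]
      refine Real.rpow_le_rpow_of_exponent_le hn' ?_
      have := min_le_left ε 1
      linarith
    set K := max 4 ⌈(3 * (d : ℝ) + 1) / δ⌉₊ with hK
    have hK4 : 4 ≤ K := le_max_left _ _
    have hKδ : 3 * (d : ℝ) + 1 ≤ K * δ := by
      rw [← div_le_iff₀ hδ0]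
      refine (Nat.le_ceil _).trans ?_
      exact Nat.cast_le.2 (le_max_right _ _)
    have hdK : 3 ≤ d * K := by nlinarith
    have hd0 : 0 < d := by omega
    set R := Fintype.card (Fin 3 ↪ Fin d × Fin K) with hR
    -- The padding contributes `pad * N ^ (K + 3)` states, so `γ` times the size is at least `R * d
    -- * N ^ K`, the counter bound of the honest run.
    set pad := ⌈(R * d : ℝ) / γ⌉₊ with hpad
    have hpadγ : (R * d : ℝ) ≤ γ * pad := by
      rw [mul_comm γ, ← div_le_iff₀ hγ]
      exact Nat.le_ceil _
    obtain ⟨a, b, k, ha, hdec'⟩ := hyperclique_decidableInTime (pad := pad) hd0 hdK (by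
      intro N T'
      rw [Shape.size_inst]
      refine Nat.le_floor ?_
      have hle : N ^ K ≤ N ^ (K + 3) ∨ N = 0 := by
        rcases Nat.eq_zero_or_pos N with rfl | hN
        · exact Or.inr rfl
        · exact Or.inl (Nat.pow_le_pow_right hN (by omega))
      have hle' : ((N ^ K : ℕ) : ℝ) ≤ ((N ^ (K + 3) : ℕ) : ℝ) := by
        rcases hle with h | rfl
        · exact_mod_cast h
        · rw [zero_pow (by omega), zero_pow (by omega)]
      set S := Shape.ofTriples d K pad hd0 hdK
      have hI : S.I N = N ^ (K + 3) := rfl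
      have hSR : S.R = R := rfl
      have hSp : S.pad = pad := rfl
      rw [hI, hSR, hSp]
      have hsz : pad * N ^ (K + 3) ≤ (S.phases + pad + S.body.length) * N ^ (K + 3) +
          (2 + R + S.consts.length) :=
        (Nat.mul_le_mul_right _ (by omega)).trans (Nat.le_add_right _ _)
      have hsz' : ((pad * N ^ (K + 3) : ℕ) : ℝ) ≤ (((S.phases + pad + S.body.length) *
        N ^ (K + 3) + (2 + R + S.consts.length) : ℕ) : ℝ) := by exact_mod_cast hsz
      calc ((R * (d * N ^ K) : ℕ) : ℝ) = (R * d : ℝ) * ((N ^ K : ℕ) : ℝ) := by push_cast; ring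
        _ ≤ (γ * pad) * ((N ^ (K + 3) : ℕ) : ℝ) :=
          mul_le_mul hpadγ hle' (by positivity) (by positivity)
        _ = γ * ((pad * N ^ (K + 3) : ℕ) : ℝ) := by push_cast; ring
        _ ≤ _ := mul_le_mul_of_nonneg_left hsz' hγ.le) hdec
    exact hyp (d * K) hdK 1 one_pos _
      (isBigO_reduction_time hd hK4 hδ0 (min_le_right _ _) hKδ ha hT') hdec'
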